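/- Let $M$ be a connected, complete, noncompact smooth Riemannian surface of (variable) negative curvature, let $\tilde M\to M$ be its universal cover with the lifted metric and distance $d$, and let $\Gamma$ be the fundamental group of $M$, acting on $\tilde M$ by deck transformations. An isometry of $\tilde M$ is called hyperbolic if it has exactly two fixed points in $\tilde M\cup\partial_\infty\tilde M$ and both lie on $\partial_\infty\tilde M$, where $\partial_\infty\tilde M$ is the set of unit speed geodesics of $\tilde M$ modulo the relation that identifies $c$ and $c'$ when $\sup_{t>0}d(c(t),c'(t))<\infty$. Suppose that $M$ is tight with constant $A\in\mathbb R$: every non-identity element of $\Gamma$ is hyperbolic, and $M=\bigcup_{n\ge 1} M_n$ with $M_n\subset M_{n+1}$ for all $n$, where each $M_n$ is a compact, not necessarily connected, two-dimensional submanifold with boundary whose boundary components are closed geodesics of length at most $A$. For $p\in M$ put $\mathrm{Inj}(p)=\min_{\mathrm{Id}\ne\gamma\in\Gamma}d(\tilde p,\gamma\tilde p)$, where $\tilde p$ is any lift of $p$. Let $v:\mathbb R\to M$ be a unit speed geodesic whose ray $v[0,\infty)$ is almost minimizing: there is $c>0$ with $d(v(t),v(0))\ge t-c$ for all $t\ge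 0$. Then the injectivity radius of the ray is finite and bounded by $A$: $$\underline{\mathrm{Inj}}(v[0,\infty)):=\liminf_{t\to\infty}\mathrm{Inj}(v(t))\le A<\infty .$$ -/

import Mathlib

open Set Filter Topology Bundle
open scoped Manifold ContDiff ENNReal

noncomputable section

/-- The model plane of a surface. -/
abbrev Plane : Type := EuclideanSpace ℝ (Fin 2)

namespace Surface

/-! ### Local Riemannian geometry of a metric `G = (g_ij)` on an open subset of the plane -/

/-- The partial derivative `∂_i f`. -/
def partialD (i : Fin 2) (f : Plane → ℝ) (y : Plane) : ℝ :=
  fderiv ℝ f y (EuclideanSpace.single i 1)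

/-- The Christoffel symbol
`Γ^k_ij = (1/2) ∑_l g^{kl} (∂_i g_jl + ∂_j g_il - ∂_l g_ij)` of the metric `G`. -/
def christoffel (G : Plane → Matrix (Fin 2) (Fin 2) ℝ) (k i j : Fin 2) (y : Plane) : ℝ :=
  (1 / 2) * ∑ l : Fin 2, (G y)⁻¹ k l *
    (partialD i (fun z => G z j l) y + partialD j (fun z => G z i l) y
      - partialD l (fun z => G z i j) y)

/-- The component along `∂_l` of `R(∂_i, ∂_j) ∂_k`, where
`R(X, Y) Z = ∇_X ∇_Y Z - ∇_Y ∇_X Z - ∇_[X, Y] Z`. -/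
def curvatureCoeff (G : Plane → Matrix (Fin 2) (Fin 2) ℝ) (l k i j : Fin 2) (y : Plane) : ℝ :=
  partialD i (christoffel G l j k) y - partialD j (christoffel G l i k) y
    + ∑ m : Fin 2, (christoffel G l i m y * christoffel G m j k y
        - christoffel G l j m y * christoffel G m i k y)

/-- The Gaussian curvature `⟨R(∂_0, ∂_1) ∂_1, ∂_0⟩ / det G`. -/
def coordCurvature (G : Plane → Matrix (Fin 2) (Fin 2) ℝ) (y : Plane) : ℝ :=
  (∑ l : Fin 2, curvatureCoeff G l 1 0 1 y * G y l 0) / (G y).det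

/-! ### Riemannian surfaces -/

section OneSurface

variable {M : Type*} [MetricSpace M] [ChartedSpace Plane M]
  [RiemannianBundle (fun x : M => TangentSpace (𝓡 2) x)]

/-- The coordinate vector field `∂_i` of the chart `e`, at the point with coordinates `y`. -/
def coordVector (e : OpenPartialHomeomorph M Plane) (i : Fin 2) (y : Plane) :
    TangentSpace (𝓡 2) (e.symm y) :=
  mfderiv (𝓡 2) (𝓡 2) e.symm y (EuclideanSpace.single i 1 : Plane)

/-- The matrix `g_ij = ⟨∂_i, ∂_j⟩` of the Riemannian metric in the chart `e`. -/
def metricMatrix (e : OpenPartialHomeomorph M Plane) (y : Plane) : Matrix (Fin 2) (Fin 2) ℝ :=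
  Matrix.of fun i j => inner ℝ (coordVector e i y) (coordVector e j y)

/-- The Gaussian curvature at `x`, computed in a chart `e` around `x`; it does not depend on the
chart. -/
def gaussCurvature (e : OpenPartialHomeomorph M Plane) (x : M) : ℝ :=
  coordCurvature (metricMatrix e) (e x)

variable (M) in
/-- The surface has (variable) negative curvature: the Gaussian curvature is `< 0` at each
point. -/
def NegativelyCurved : Prop :=
  ∀ e ∈ IsManifold.maximalAtlas (𝓡 2) ∞ M, ∀ x ∈ e.source, gaussCurvature e x < 0

/-- A unit speed geodesic `c : ℝ → M`: a smooth curve of unit speed which satisfies the geodesic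
equation `u_k'' + ∑ Γ^k_ij u_i' u_j' = 0` in every chart. On a complete surface such curves are
the same as unit tangent vectors `v = c'(0)`, with `v(t) = c t` the base point of `g_t(v)`. -/
structure IsUnitSpeedGeodesic (c : ℝ → M) : Prop where
  smooth : ContMDiff 𝓘(ℝ, ℝ) (𝓡 2) ∞ c
  unit_speed : ∀ t : ℝ, ‖mfderiv 𝓘(ℝ, ℝ) (𝓡 2) c t (1 : ℝ)‖ = 1
  geodesic_eq : ∀ e ∈ IsManifold.maximalAtlas (𝓡 2) ∞ M, ∀ t : ℝ, c t ∈ e.source → ∀ k : Fin 2,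
    deriv (deriv fun s => e (c s) k) t
      + ∑ i : Fin 2, ∑ j : Fin 2, christoffel (metricMatrix e) k i j (e (c t))
          * deriv (fun s => e (c s) i) t * deriv (fun s => e (c s) j) t = 0

/-- The geodesic ray `c [0, ∞)` is almost minimizing. -/
def IsAlmostMinimizing (c : ℝ → M) : Prop :=
  ∃ C : ℝ, 0 < C ∧ ∀ t : ℝ, 0 ≤ t → t - C ≤ dist (c t) (c 0)

/-- The subset `S` is a simple closed geodesic of length `L`. -/
def IsClosedGeodesicOfLength (S : Set M) (L : ℝ) : Prop :=
  0 < L ∧ ∃ c : ℝ → M, IsUnitSpeedGeodesic c ∧ Function.Periodic c L ∧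
    InjOn c (Ico 0 L) ∧ range c = S

/-- A compact (not necessarily connected) smooth two-dimensional submanifold with boundary:
near each point of its frontier, `S` is a half plane in some smooth chart of the surface. The
boundary `∂S` is then the frontier of `S`. -/
structure IsCompactSubsurface (S : Set M) : Prop where
  isCompact : IsCompact S
  half_plane : ∀ x ∈ frontier S, ∃ e ∈ IsManifold.maximalAtlas (𝓡 2) ∞ M,
    x ∈ e.source ∧ e x 0 = 0 ∧ ∀ y ∈ e.source, (y ∈ S ↔ 0 ≤ e y 0)

/-! ### Points at infinity, hyperbolic isometries -/

/-- Two geodesics (directed by unit tangent vectors) have the same endpoint at infinity if their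
positive rays stay at bounded distance. -/
def SameEndpoint (c c' : ℝ → M) : Prop :=
  ∃ C : ℝ, ∀ t : ℝ, 0 < t → dist (c t) (c' t) ≤ C

variable (M) in
/-- The relation of having the same endpoint, on the unit speed geodesics of a surface. -/
def endpointSetoid : Setoid {c : ℝ → M // IsUnitSpeedGeodesic c} where
  r c c' := SameEndpoint c.1 c'.1
  iseqv :=
    { refl := fun c => ⟨0, fun t _ => by simp⟩
      symm := by
        rintro c c' ⟨C, h⟩
        exact ⟨C, fun t ht => by rw [dist_comm]; exact h t ht⟩
      trans := by
        rintro c c' c'' ⟨C, h⟩ ⟨C', h'⟩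
        exact ⟨C + C', fun t ht => (dist_triangle _ _ _).trans (add_le_add (h t ht) (h' t ht))⟩ }

variable (M) in
/-- The boundary at infinity. It is meant for simply connected surfaces. -/
def BoundaryAtInfinity : Type _ := Quotient (endpointSetoid M)

/-- The isometry `φ` fixes the point `ξ` at infinity: it maps geodesics ending at `ξ` to geodesics
ending at `ξ`. -/
def FixesAtInfinity (φ : M ≃ᵢ M) (ξ : BoundaryAtInfinity M) : Prop :=
  ∀ c : {c : ℝ → M // IsUnitSpeedGeodesic c}, Quotient.mk (endpointSetoid M) c = ξ →
    SameEndpoint (fun t => φ (c.1 t)) c.1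

/-- A hyperbolic isometry: it has exactly two fixed points, and both of them lie on the boundary at
infinity. -/
def IsHyperbolicIsometry (φ : M ≃ᵢ M) : Prop :=
  (∀ x : M, φ x ≠ x) ∧ {ξ : BoundaryAtInfinity M | FixesAtInfinity φ ξ}.encard = 2

end OneSurface

section Cover

variable {M : Type*} [MetricSpace M] [ChartedSpace Plane M]
  [RiemannianBundle (fun x : M => TangentSpace (𝓡 2) x)]
  {N : Type*} [MetricSpace N] [ChartedSpace Plane N]
  [RiemannianBundle (fun x : N => TangentSpace (𝓡 2) x)]

/-- `proj : N → M` is the universal cover of the Riemannian surface `M`, with the Riemannian metric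
lifted from `M`. -/
structure IsRiemannianUniversalCover (proj : N → M) : Prop where
  simplyConnected : SimplyConnectedSpace N
  isCoveringMap : IsCoveringMap proj
  surjective : Function.Surjective proj
  smooth : ContMDiff (𝓡 2) (𝓡 2) ∞ proj
  norm_mfderiv : ∀ (x : N) (w : TangentSpace (𝓡 2) x), ‖mfderiv (𝓡 2) (𝓡 2) proj x w‖ = ‖w‖

/-- The fundamental group `Γ` of `M`, acting on the universal cover by deck transformations (which
are isometries of the lifted metric). -/
def deckGroup (proj : N → M) : Subgroup (N ≃ᵢ N) where
  carrier := {γ | ∀ x, proj (γ x) = proj x}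
  one_mem' := fun _ => rfl
  mul_mem' := fun {a b} ha hb x => (ha (b x)).trans (hb x)
  inv_mem' := fun {a} ha x => by
    have h := ha (a⁻¹ x)
    rw [IsometryEquiv.apply_inv_self] at h
    exact h.symm

/-- The injectivity radius `Inj(p) = min_{γ ≠ 1} d(q, γ q)`, for `q` a lift of `p`. The value of the
inner infimum is the same for all lifts `q` of `p`, as the deck group permutes them transitively. -/
def injRadius (proj : N → M) (p : M) : ℝ≥0∞ :=
  ⨅ (q : N) (_ : proj q = p), ⨅ (γ : N ≃ᵢ N) (_ : γ ∈ deckGroup proj ∧ γ ≠ 1), edist q (γ q)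

/-- The injectivity radius `liminf_{t → ∞} Inj(v(t))` of a geodesic ray. -/
def rayInjRadius (proj : N → M) (v : ℝ → M) : ℝ≥0∞ :=
  liminf (fun t : ℝ => injRadius proj (v t)) atTop

/-- The surface `M`, with universal cover `proj : N → M`, is tight, with bound `A` on the lengths of
the boundary geodesics. -/
structure IsTight (proj : N → M) (A : ℝ) : Prop where
  noncompact : NoncompactSpace M
  negativelyCurved : NegativelyCurved M
  purelyHyperbolic : ∀ γ ∈ deckGroup proj, γ ≠ 1 → IsHyperbolicIsometry γ
  exhaustion : ∃ S : ℕ → Set M, (⋃ n, S n) = univ ∧ (∀ n, S n ⊆ S (n + 1)) ∧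
    (∀ n, IsCompactSubsurface (S n)) ∧
    ∀ n, ∀ x ∈ frontier (S n), ∃ L ≤ A,
      IsClosedGeodesicOfLength (connectedComponentIn (frontier (S n)) x) L

end Cover

end Surface

end

/-!
An almost minimizing ray leaves every compact set, so it meets the boundaries of the compact pieces
of the exhaustion at arbitrarily large times. Each boundary component is a closed geodesic of length
at most `A`; at its points the injectivity radius is at most `A`, provided that the closed geodesic
lifts to a curve in the universal cover that is not closed. Then a nontrivial deck transformation
moves the initial point of the lift to its final point (`IsRiemannianUniversalCover.injRadius_le`), and
the `liminf` is bounded by `A` (`IsRiemannianUniversalCover.rayInjRadius_le`).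

That lifts of closed geodesics are not closed (`IsUnitSpeedGeodesic.lift_not_closed`) is the part of
the Cartan-Hadamard theorem that is needed here. The exponential map `exp` of a point `p` is
defined on the whole plane by completeness (`exists_geodesic`). Its differential is given by Jacobi
fields, and in negative curvature the norm of a Jacobi field `J` with `J(0) = 0` is a convex function
of time. Hence `exp` is a local diffeomorphism whose differential is bounded below
(`IsGeodesicFamily.exists_isExpanding`). The plane is complete, so all paths in `M` lift through `exp`
(`IsExpanding.exists_section`), and the monodromy theorem applies. The lift through `exp` of a
geodesic from `p` is a straight line, whose endpoint is not the origin; so no initial segment of the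
geodesic is a null-homotopic loop.

There is no theory of geodesics in Mathlib to build on: they are treated as integral curves of the
geodesic spray in charts, and the derivative of the flow in the initial condition is obtained from
Gronwall's inequality (`hasStrictFDerivAt_flow`).
-/

/-! ### Metric coefficients of a Riemannian surface in charts -/

namespace Surface
section
variable {M : Type*} [MetricSpace M] [ChartedSpace Plane M]

/-- The value `∑ g_ij u_i v_j` at the point `y` of the metric `G` on the vectors `u` and `v`. -/
noncomputable def form (G : Plane → Matrix (Fin 2) (Fin 2) ℝ) (y u v : Plane) : ℝ :=
  ∑ i : Fin 2, ∑ j : Fin 2, G y i j * u i * v j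

theorem contMDiffAt_chart_symm {e : OpenPartialHomeomorph M Plane} (he : e ∈ IsManifold.maximalAtlas (𝓡 2) ∞ M)
    {y : Plane} (hy : y ∈ e.target) : ContMDiffAt (𝓡 2) (𝓡 2) ∞ e.symm y :=
  (contMDiffOn_symm_of_mem_maximalAtlas he).contMDiffAt (e.open_target.mem_nhds hy)

theorem contMDiffAt_chart {e : OpenPartialHomeomorph M Plane} (he : e ∈ IsManifold.maximalAtlas (𝓡 2) ∞ M)
    {x : M} (hx : x ∈ e.source) : ContMDiffAt (𝓡 2) (𝓡 2) ∞ e x :=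
  (contMDiffOn_of_mem_maximalAtlas he).contMDiffAt (e.open_source.mem_nhds hx)

variable [RiemannianBundle (fun x : M => TangentSpace (𝓡 2) x)]

theorem form_metricMatrix (e : OpenPartialHomeomorph M Plane) (y u v : Plane) :
    form (metricMatrix e) y u v =
      inner ℝ (mfderiv (𝓡 2) (𝓡 2) e.symm y u) (mfderiv (𝓡 2) (𝓡 2) e.symm y v) := by
  have key : ∀ w : Plane, mfderiv (𝓡 2) (𝓡 2) e.symm y w =
      w 0 • coordVector e 0 y + w 1 • coordVector e 1 y := by
    intro w
    have : w = w 0 • (EuclideanSpace.single 0 1 : Plane) + w 1 • (EuclideanSpace.single 1 1 : Plane) := by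
      ext i; fin_cases i <;> simp
    conv_lhs => rw [this]
    unfold coordVector
    erw [map_add, map_smul, map_smul]
  rw [key u, key v]
  simp only [form, metricMatrix, Matrix.of_apply, Fin.sum_univ_two, inner_add_left, inner_add_right,
    inner_smul_left, inner_smul_right]
  simp
  ring

/-- All tangent spaces of `M` are the type `Plane` by definition, but carry different norms. The
equality of base points therefore has to be transported explicitly. -/
theorem norm_tangent_congr {p q : M} (h : p = q) (w : Plane) :
    ‖(show TangentSpace (𝓡 2) p from w)‖ = ‖(show TangentSpace (𝓡 2) q from w)‖ := by
  subst h; rfl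

/-- If `z` represents the map `f` in the chart `e`, then the norm of `df(u)` is computed by the metric
coefficients of `e` and the derivative `D` of `z`. All passages between coordinates and tangent vectors
of the surface use this formula. -/
theorem form_metricMatrix_self {E' : Type*} [NormedAddCommGroup E'] [NormedSpace ℝ E']
    {e : OpenPartialHomeomorph M Plane} (he : e ∈ IsManifold.maximalAtlas (𝓡 2) ∞ M)
    {f : E' → M} {x : E'} {D : E' →L[ℝ] Plane}
    {z : E' → Plane} (hz : HasFDerivAt z D x) (hzx : z x ∈ e.target)
    (hf : f =ᶠ[𝓝 x] fun x' => e.symm (z x')) (u : E') :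
    form (metricMatrix e) (z x) (D u) (D u) = ‖mfderiv 𝓘(ℝ, E') (𝓡 2) f x u‖ ^ 2 := by
  have h1 : HasMFDerivAt 𝓘(ℝ, E') (𝓡 2) z x D := hz.hasMFDerivAt
  have h2 := ((contMDiffAt_chart_symm he hzx).mdifferentiableAt (by simp)).hasMFDerivAt
  have h3 := (h2.comp x h1).congr_of_eventuallyEq hf
  rw [form_metricMatrix, real_inner_self_eq_norm_sq]
  have h4 := congrArg (fun L : E' →L[ℝ] Plane => L u) h3.mfderiv
  have h5 := norm_tangent_congr hf.self_of_nhds (mfderiv 𝓘(ℝ, E') (𝓡 2) f x u)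
  refine congrArg (fun a : ℝ => a ^ 2) ?_
  refine Eq.trans ?_ h5.symm
  exact (congrArg (fun w : Plane => ‖(show TangentSpace (𝓡 2) (e.symm (z x)) from w)‖) h4).symm

theorem contDiffOn_metricMatrix [IsManifold (𝓡 2) ∞ M]
    [IsContMDiffRiemannianBundle (𝓡 2) ∞ Plane (fun x : M => TangentSpace (𝓡 2) x)]
    {e : OpenPartialHomeomorph M Plane} (he : e ∈ IsManifold.maximalAtlas (𝓡 2) ∞ M) (i j : Fin 2) :
    ContDiffOn ℝ ∞ (fun y => metricMatrix e y i j) e.target := by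
  have hc : ∀ i : Fin 2, ContMDiffOn (𝓡 2) ((𝓡 2).prod 𝓘(ℝ, Plane)) ∞
      (fun y => (⟨e.symm y, coordVector e i y⟩ : TotalSpace Plane (fun x : M => TangentSpace (𝓡 2) x)))
      e.target := by
    intro i
    have h1 := (contMDiffOn_symm_of_mem_maximalAtlas he).contMDiffOn_tangentMapWithin (m := ∞)
      (by simp) e.open_target.uniqueMDiffOn
    have h2 : ContMDiffOn (𝓡 2) ((𝓡 2).prod 𝓘(ℝ, Plane)) ∞
      (fun y => (⟨y, (EuclideanSpace.single i 1 : Plane)⟩ : TangentBundle (𝓡 2) Plane)) e.target := by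
      intro y hy
      exact (contMDiffWithinAt_vectorSpace_iff_contDiffWithinAt
        (V := fun _ => (EuclideanSpace.single i 1 : Plane))).2 contDiffWithinAt_const
    refine (h1.comp h2 (fun y hy => hy)).congr fun y hy => ?_
    simp only [Function.comp, tangentMapWithin, coordVector]
    rw [mfderivWithin_of_isOpen e.open_target hy]
  have := (hc i).inner_bundle (hc j)
  rw [← contMDiffOn_iff_contDiffOn]
  exact this

theorem metricMatrix_symm (e : OpenPartialHomeomorph M Plane) (y : Plane) (i j : Fin 2) :
    metricMatrix e y i j = metricMatrix e y j i := by
  simp [metricMatrix, real_inner_comm]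

theorem form_metricMatrix_pos {e : OpenPartialHomeomorph M Plane}
    (he : e ∈ IsManifold.maximalAtlas (𝓡 2) ∞ M) {y : Plane} (hy : y ∈ e.target) {u : Plane}
    (hu : u ≠ 0) : 0 < form (metricMatrix e) y u u := by
  rw [form_metricMatrix, real_inner_self_eq_norm_sq]
  have h2 := ((contMDiffAt_chart_symm he hy).mdifferentiableAt (by simp)).hasMFDerivAt
  have h1 := ((contMDiffAt_chart he (e.map_target hy)).mdifferentiableAt (by simp)).hasMFDerivAt
  have h3 := h1.comp y h2
  have h4 : HasMFDerivAt (𝓡 2) (𝓡 2) (e ∘ e.symm) y (ContinuousLinearMap.id ℝ Plane) := by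
    refine (hasMFDerivAt_id y).congr_of_eventuallyEq ?_
    filter_upwards [e.open_target.mem_nhds hy] with z hz using e.right_inv hz
  have h5 := hasMFDerivAt_unique h3 h4
  have h6 : mfderiv (𝓡 2) (𝓡 2) e.symm y u ≠ 0 := by
    intro h0
    have := congrArg (fun L : Plane →L[ℝ] Plane => L u) h5
    apply hu
    have h7 : (mfderiv (𝓡 2) (𝓡 2) e (e.symm y)) (mfderiv (𝓡 2) (𝓡 2) e.symm y u) = u := this
    rw [h0, map_zero] at h7
    exact h7.symm
  positivity

end
end Surface

/-! ### Geodesic spray, covariant derivative and the Jacobi equation -/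

namespace Surface

/-- `G` is a smooth Riemannian metric on the open set `U` of the plane. -/
structure IsMetricOn (G : Plane → Matrix (Fin 2) (Fin 2) ℝ) (U : Set Plane) : Prop where
  isOpen : IsOpen U
  smooth : ∀ i j, ContDiffOn ℝ ∞ (fun y => G y i j) U
  symm : ∀ y ∈ U, ∀ i j, G y i j = G y j i
  pos : ∀ y ∈ U, ∀ u : Plane, u ≠ 0 → 0 < form G y u u

/-- The vector `Γ(u, v)` with components `∑ Γ^k_ij u_i v_j`. -/
noncomputable def chr (G : Plane → Matrix (Fin 2) (Fin 2) ℝ) (y u v : Plane) : Plane :=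
  WithLp.toLp 2 fun k => ∑ i : Fin 2, ∑ j : Fin 2, christoffel G k i j y * u i * v j

/-- The derivative of the Christoffel symbols in the direction `X`, applied to `u` and `v`. -/
noncomputable def dchr (G : Plane → Matrix (Fin 2) (Fin 2) ℝ) (y X u v : Plane) : Plane :=
  WithLp.toLp 2 fun k => ∑ i : Fin 2, ∑ j : Fin 2,
    (∑ m : Fin 2, partialD m (christoffel G k i j) y * X m) * u i * v j

/-- The covariant derivative `w₂ + Γ(v, w₁)` of the variation field `w₁` along the curve with position
and velocity `z = (x, v)`; here `w = (w₁, w₁')` is a tangent vector of the phase space at `z`. -/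
noncomputable def covD (G : Plane → Matrix (Fin 2) (Fin 2) ℝ) (z w : Plane × Plane) : Plane :=
  w.2 + chr G z.1 z.2 w.1

/-- The geodesic spray `(x, v) ↦ (v, -Γ(v, v))`. -/
noncomputable def spray (G : Plane → Matrix (Fin 2) (Fin 2) ℝ) (z : Plane × Plane) : Plane × Plane :=
  (z.2, -chr G z.1 z.2 z.2)

theorem fderiv_eq_sum_partialD (f : Plane → ℝ) (y u : Plane) :
    fderiv ℝ f y u = partialD 0 f y * u 0 + partialD 1 f y * u 1 := by
  have : u = u 0 • (EuclideanSpace.single 0 1 : Plane) + u 1 • (EuclideanSpace.single 1 1 : Plane) := by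
    ext i; fin_cases i <;> simp
  conv_lhs => rw [this]
  simp [partialD, mul_comm]

theorem partialD_add {f g : Plane → ℝ} {y : Plane} (i : Fin 2) (hf : DifferentiableAt ℝ f y)
    (hg : DifferentiableAt ℝ g y) :
    partialD i (fun z => f z + g z) y = partialD i f y + partialD i g y := by
  simp [partialD, fderiv_fun_add hf hg]

theorem partialD_mul {f g : Plane → ℝ} {y : Plane} (i : Fin 2) (hf : DifferentiableAt ℝ f y)
    (hg : DifferentiableAt ℝ g y) :
    partialD i (fun z => f z * g z) y = f y * partialD i g y + partialD i f y * g y := by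
  simp [partialD, fderiv_fun_mul hf hg, mul_comm]

theorem partialD_congr {f g : Plane → ℝ} {y : Plane} (i : Fin 2) (h : f =ᶠ[𝓝 y] g) :
    partialD i f y = partialD i g y := by
  simp [partialD, h.fderiv_eq]

theorem partialD_comm {f : Plane → ℝ} {y : Plane} (hf : ContDiffAt ℝ 2 f y) (i j : Fin 2) :
    partialD i (partialD j f) y = partialD j (partialD i f) y := by
  have hd : DifferentiableAt ℝ (fderiv ℝ f) y :=
    (hf.fderiv_right (m := 1) (by norm_num)).differentiableAt (by simp)
  have key : ∀ a b : Plane, fderiv ℝ (fun z => fderiv ℝ f z b) y a = fderiv ℝ (fderiv ℝ f) y a b := by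
    intro a b
    rw [fderiv_clm_apply hd (differentiableAt_const b)]
    simp
  have hs : IsSymmSndFDerivAt ℝ f y := hf.isSymmSndFDerivAt (by simp)
  unfold partialD
  rw [key, key, hs.eq]

theorem HasDerivAt.comp_partialD {f : Plane → ℝ} {x : ℝ → Plane} {T : Plane} {t : ℝ}
    (hf : DifferentiableAt ℝ f (x t)) (hx : HasDerivAt x T t) :
    HasDerivAt (fun s => f (x s)) (partialD 0 f (x t) * T 0 + partialD 1 f (x t) * T 1) t := by
  rw [← fderiv_eq_sum_partialD]
  exact hf.hasFDerivAt.comp_hasDerivAt t hx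

theorem hasDerivAt_plane {X : ℝ → Plane} {X' : Plane} {t : ℝ} :
    HasDerivAt X X' t ↔ ∀ i, HasDerivAt (fun s => X s i) (X' i) t := by
  constructor
  · intro h i
    exact (EuclideanSpace.proj (𝕜 := ℝ) i).hasFDerivAt.comp_hasDerivAt t h
  · intro h
    have h1 := hasDerivAt_pi.2 h
    exact (PiLp.continuousLinearEquiv 2 ℝ (fun _ : Fin 2 => ℝ)).symm.hasFDerivAt.comp_hasDerivAt t h1

namespace IsMetricOn
variable {G : Plane → Matrix (Fin 2) (Fin 2) ℝ} {U : Set Plane} (hG : IsMetricOn G U)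
include hG

theorem contDiffAt {y : Plane} (hy : y ∈ U) (i j : Fin 2) : ContDiffAt ℝ ∞ (fun y => G y i j) y :=
  (hG.smooth i j).contDiffAt (hG.isOpen.mem_nhds hy)

theorem det_pos {y : Plane} (hy : y ∈ U) : 0 < (G y).det := by
  have h0 := hG.pos y hy (EuclideanSpace.single 0 1) (by simp)
  -- the vector orthogonal to the first basis vector has square norm `g_00 det G`
  have h1 := hG.pos y hy (WithLp.toLp 2 ![-G y 0 1, G y 0 0]) (by
    intro h
    have := congrArg (fun v : Plane => v 1) h
    simp [form] at h0 this
    linarith)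
  simp [form, Fin.sum_univ_two] at h0 h1
  rw [Matrix.det_fin_two]
  rw [hG.symm y hy 1 0] at h1 ⊢
  have : 0 < G y 0 0 * (G y 0 0 * G y 1 1 - G y 0 1 * G y 0 1) := by linarith
  exact (mul_pos_iff_of_pos_left h0).1 this

theorem diag_pos {y : Plane} (hy : y ∈ U) (i : Fin 2) : 0 < G y i i := by
  have h0 := hG.pos y hy (EuclideanSpace.single i 1) (by simp)
  fin_cases i <;> simpa [form, Fin.sum_univ_two] using h0

/-- The Euclidean norm is bounded by the norm of the metric: the smallest eigenvalue of `G` is at least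
the determinant divided by the trace. -/
theorem norm_sq_le {y : Plane} (hy : y ∈ U) (u : Plane) :
    (G y).det * ‖u‖ ^ 2 ≤ (G y 0 0 + G y 1 1) * form G y u u := by
  rw [EuclideanSpace.norm_sq_eq, Matrix.det_fin_two]
  simp only [form, Fin.sum_univ_two, Real.norm_eq_abs, sq_abs]
  rw [hG.symm y hy 1 0]
  nlinarith [sq_nonneg (G y 0 0 * u 0 + G y 0 1 * u 1), sq_nonneg (G y 0 1 * u 0 + G y 1 1 * u 1)]

theorem inv_smooth (i j : Fin 2) : ContDiffOn ℝ ∞ (fun y => (G y)⁻¹ i j) U := by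
  have hdet : ContDiffOn ℝ ∞ (fun y => (G y).det) U := by
    simp only [Matrix.det_fin_two]
    exact ((hG.smooth 0 0).mul (hG.smooth 1 1)).sub ((hG.smooth 0 1).mul (hG.smooth 1 0))
  have hinv : ContDiffOn ℝ ∞ (fun y => ((G y).det)⁻¹) U := hdet.inv fun y hy => (hG.det_pos hy).ne'
  have h : ∀ y, (G y)⁻¹ i j = ((G y).det)⁻¹ * (G y).adjugate i j := by
    intro y; simp [Matrix.inv_def, Ring.inverse_eq_inv']
  simp only [h]
  refine hinv.mul ?_
  simp only [Matrix.adjugate_fin_two]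
  fin_cases i <;> fin_cases j <;> simp
  · exact hG.smooth 1 1
  · exact (hG.smooth 0 1).neg
  · exact (hG.smooth 1 0).neg
  · exact hG.smooth 0 0

theorem partialD_smooth {f : Plane → ℝ} (hf : ContDiffOn ℝ ∞ f U) (i : Fin 2) :
    ContDiffOn ℝ ∞ (partialD i f) U :=
  (hf.fderiv_of_isOpen (m := ∞) hG.isOpen (by simp)).clm_apply contDiffOn_const

theorem christoffel_smooth (k i j : Fin 2) : ContDiffOn ℝ ∞ (christoffel G k i j) U := by
  unfold christoffel
  refine contDiffOn_const.mul (ContDiffOn.sum fun l _ => ?_)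
  refine (hG.inv_smooth k l).mul (((hG.partialD_smooth (hG.smooth j l) i).add
    (hG.partialD_smooth (hG.smooth i l) j)).sub (hG.partialD_smooth (hG.smooth i j) l))

theorem christoffel_diff {y : Plane} (hy : y ∈ U) (k i j : Fin 2) :
    DifferentiableAt ℝ (christoffel G k i j) y :=
  ((hG.christoffel_smooth k i j).contDiffAt (hG.isOpen.mem_nhds hy)).differentiableAt (by simp)

theorem diff {y : Plane} (hy : y ∈ U) (i j : Fin 2) : DifferentiableAt ℝ (fun y => G y i j) y :=
  (hG.contDiffAt hy i j).differentiableAt (by simp)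

theorem partialD_symm {y : Plane} (hy : y ∈ U) (l i j : Fin 2) :
    partialD l (fun z => G z i j) y = partialD l (fun z => G z j i) y :=
  partialD_congr l (by filter_upwards [hG.isOpen.mem_nhds hy] with z hz using hG.symm z hz i j)

theorem christoffel_symm {y : Plane} (hy : y ∈ U) (k i j : Fin 2) :
    christoffel G k i j y = christoffel G k j i y := by
  unfold christoffel
  congr 1
  refine Finset.sum_congr rfl fun l _ => ?_
  rw [hG.partialD_symm hy l i j]
  ring

theorem partialD_christoffel_symm {y : Plane} (hy : y ∈ U) (m k i j : Fin 2) :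
    partialD m (christoffel G k i j) y = partialD m (christoffel G k j i) y :=
  partialD_congr m
    (by filter_upwards [hG.isOpen.mem_nhds hy] with z hz using hG.christoffel_symm hz k i j)

/-- The Christoffel symbols of the first kind. -/
theorem christoffel_lower {y : Plane} (hy : y ∈ U) (l i j : Fin 2) :
    G y l 0 * christoffel G 0 i j y + G y l 1 * christoffel G 1 i j y =
      (partialD i (fun z => G z j l) y + partialD j (fun z => G z i l) y
      - partialD l (fun z => G z i j) y) / 2 := by
  have h := Matrix.mul_nonsing_inv (G y) (hG.det_pos hy).ne'.isUnit
  have h' : ∀ a b, G y a 0 * (G y)⁻¹ 0 b + G y a 1 * (G y)⁻¹ 1 b = (1 : Matrix (Fin 2) (Fin 2) ℝ) a b := by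
    intro a b; rw [← h, Matrix.mul_apply, Fin.sum_univ_two]
  unfold christoffel
  simp only [Fin.sum_univ_two]
  have h0 := h' l 0
  have h1 := h' l 1
  obtain rfl | rfl : l = 0 ∨ l = 1 := by fin_cases l <;> simp
  all_goals
    simp at h0 h1
    linear_combination (partialD i (fun z => G z j 0) y + partialD j (fun z => G z i 0) y
      - partialD 0 (fun z => G z i j) y) / 2 * h0 + (partialD i (fun z => G z j 1) y + partialD j (fun z => G z i 1) y
      - partialD 1 (fun z => G z i j) y) / 2 * h1

/-- Metric compatibility of the Levi-Civita connection. -/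
theorem partialD_eq_christoffel {y : Plane} (hy : y ∈ U) (k i j : Fin 2) :
    partialD k (fun z => G z i j) y =
      (G y 0 j * christoffel G 0 k i y + G y 1 j * christoffel G 1 k i y) +
      (G y i 0 * christoffel G 0 k j y + G y i 1 * christoffel G 1 k j y) := by
  have h1 := hG.christoffel_lower hy j k i
  have h2 := hG.christoffel_lower hy i k j
  rw [hG.symm y hy j 0, hG.symm y hy j 1] at h1
  rw [h1, h2, hG.partialD_symm hy k j i]
  ring

/-- The curvature operator `R(∂_0, ∂_1)` is skew with respect to the metric: this expresses that the
second partial derivatives of `g_ij` commute. -/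
theorem curvature_antisymm {y : Plane} (hy : y ∈ U) (i j : Fin 2) :
    (curvatureCoeff G 0 i 0 1 y * G y 0 j + curvatureCoeff G 1 i 0 1 y * G y 1 j) +
    (curvatureCoeff G 0 j 0 1 y * G y 0 i + curvatureCoeff G 1 j 0 1 y * G y 1 i) = 0 := by
  have hdd : ∀ m k, partialD m (partialD k (fun z => G z i j)) y =
      (G y 0 j * partialD m (christoffel G 0 k i) y + partialD m (fun z => G z 0 j) y * christoffel G 0 k i y
      + (G y 1 j * partialD m (christoffel G 1 k i) y + partialD m (fun z => G z 1 j) y * christoffel G 1 k i y)) +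
      (G y i 0 * partialD m (christoffel G 0 k j) y + partialD m (fun z => G z i 0) y * christoffel G 0 k j y
      + (G y i 1 * partialD m (christoffel G 1 k j) y + partialD m (fun z => G z i 1) y * christoffel G 1 k j y)) := by
    intro m k
    have := partialD_congr (f := partialD k (fun z => G z i j)) (y := y) m
      (by filter_upwards [hG.isOpen.mem_nhds hy] with z hz using hG.partialD_eq_christoffel hz k i j)
    rw [this]
    have d1 := hG.diff hy
    have d2 := hG.christoffel_diff hy
    rw [partialD_add, partialD_add, partialD_add, partialD_mul, partialD_mul, partialD_mul, partialD_mul] <;>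
    first | exact d1 _ _ | exact d2 _ _ _ | skip
    all_goals first
      | exact ((d1 _ _).mul (d2 _ _ _))
      | exact ((d1 _ _).mul (d2 _ _ _)).add ((d1 _ _).mul (d2 _ _ _))
  have hc := partialD_comm (f := fun z => G z i j) (y := y)
    ((hG.contDiffAt hy i j).of_le (WithTop.coe_le_coe.2 le_top)) 0 1
  rw [hdd, hdd] at hc
  simp only [hG.partialD_eq_christoffel hy] at hc
  simp only [curvatureCoeff, Fin.sum_univ_two]
  have e1 := hG.symm y hy i 0
  have e2 := hG.symm y hy i 1
  have e3 := hG.symm y hy 1 0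
  rw [e1, e2, e3] at hc
  linear_combination hc

theorem chr_symm {y : Plane} (hy : y ∈ U) (u v : Plane) : chr G y u v = chr G y v u := by
  ext k
  simp only [chr, Fin.sum_univ_two]
  rw [hG.christoffel_symm hy k 1 0]
  ring

theorem form_symm {y : Plane} (hy : y ∈ U) (u v : Plane) : form G y u v = form G y v u := by
  simp only [form, Fin.sum_univ_two]
  rw [hG.symm y hy 1 0]
  ring

/-- Metric compatibility of the Levi-Civita connection along a curve. -/
theorem hasDerivAt_form {x X Y : ℝ → Plane} {T X' Y' : Plane} {t : ℝ} (hx : HasDerivAt x T t)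
    (hU : x t ∈ U) (hX : HasDerivAt X X' t) (hY : HasDerivAt Y Y' t) :
    HasDerivAt (fun s => form G (x s) (X s) (Y s))
      (form G (x t) (X' + chr G (x t) T (X t)) (Y t) + form G (x t) (X t) (Y' + chr G (x t) T (Y t))) t := by
  have hX' : ∀ i, HasDerivAt (fun s => X s i) (X' i) t := fun i => hasDerivAt_plane.1 hX i
  have hY' : ∀ i, HasDerivAt (fun s => Y s i) (Y' i) t := fun i => hasDerivAt_plane.1 hY i
  have hg := fun i j => HasDerivAt.comp_partialD (hG.diff hU i j) hx
  have := HasDerivAt.fun_sum (u := Finset.univ) fun i (_ : i ∈ (Finset.univ : Finset (Fin 2))) =>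
    HasDerivAt.fun_sum (u := Finset.univ) fun j (_ : j ∈ (Finset.univ : Finset (Fin 2))) =>
      ((hg i j).fun_mul (hX' i)).fun_mul (hY' j)
  refine this.congr_deriv ?_
  simp only [hG.partialD_eq_christoffel hU, form, chr, Fin.sum_univ_two, PiLp.add_apply]
  have e3 := hG.symm _ hU 1 0
  rw [e3]
  ring

theorem hasDerivAt_chr {x X Y : ℝ → Plane} {T X' Y' : Plane} {t : ℝ} (hx : HasDerivAt x T t)
    (hU : x t ∈ U) (hX : HasDerivAt X X' t) (hY : HasDerivAt Y Y' t) :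
    HasDerivAt (fun s => chr G (x s) (X s) (Y s))
      (chr G (x t) X' (Y t) + chr G (x t) (X t) Y' + dchr G (x t) T (X t) (Y t)) t := by
  have hX' : ∀ i, HasDerivAt (fun s => X s i) (X' i) t := fun i => hasDerivAt_plane.1 hX i
  have hY' : ∀ i, HasDerivAt (fun s => Y s i) (Y' i) t := fun i => hasDerivAt_plane.1 hY i
  have hg := fun k i j => HasDerivAt.comp_partialD (hG.christoffel_diff hU k i j) hx
  refine hasDerivAt_plane.2 fun k => ?_
  have := HasDerivAt.fun_sum (u := Finset.univ) fun i (_ : i ∈ (Finset.univ : Finset (Fin 2))) =>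
    HasDerivAt.fun_sum (u := Finset.univ) fun j (_ : j ∈ (Finset.univ : Finset (Fin 2))) =>
      ((hg k i j).fun_mul (hX' i)).fun_mul (hY' j)
  refine this.congr_deriv ?_
  simp only [chr, dchr, Fin.sum_univ_two, PiLp.add_apply]
  ring

theorem spray_smooth : ContDiffOn ℝ ∞ (spray G) (U ×ˢ univ) := by
  unfold spray
  refine contDiffOn_snd.prodMk (ContDiffOn.neg ?_)
  rw [contDiffOn_euclidean]
  intro k
  simp only [chr]
  refine ContDiffOn.sum fun i _ => ContDiffOn.sum fun j _ => ?_
  have hc : ContDiffOn ℝ ∞ (fun z : Plane × Plane => christoffel G k i j z.1) (U ×ˢ univ) :=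
    (hG.christoffel_smooth k i j).comp contDiffOn_fst fun z hz => hz.1
  have hv : ∀ i, ContDiffOn ℝ ∞ (fun z : Plane × Plane => z.2 i) (U ×ˢ univ) := fun i =>
    (contDiffOn_euclidean.1 (contDiffOn_snd (n := ∞) (𝕜 := ℝ) (E := Plane) (F := Plane)) i)
  exact (hc.mul (hv i)).mul (hv j)

theorem spray_contDiffAt {z : Plane × Plane} (hz : z.1 ∈ U) : ContDiffAt ℝ ∞ (spray G) z :=
  hG.spray_smooth.contDiffAt ((hG.isOpen.prod isOpen_univ).mem_nhds ⟨hz, mem_univ _⟩)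

theorem fderiv_spray {z : Plane × Plane} (hz : z.1 ∈ U) (w : Plane × Plane) :
    fderiv ℝ (spray G) z w = (w.2, -(chr G z.1 w.2 z.2 + chr G z.1 z.2 w.2 + dchr G z.1 w.1 z.2 z.2)) := by
  have hl : HasDerivAt (fun s : ℝ => z + s • w) w 0 := by
    simpa using ((hasDerivAt_id (0 : ℝ)).smul_const w).const_add z
  have h1 : HasDerivAt (fun s : ℝ => (z + s • w).1) w.1 0 :=
    (ContinuousLinearMap.fst ℝ Plane Plane).hasFDerivAt.comp_hasDerivAt 0 hl
  have h2 : HasDerivAt (fun s : ℝ => (z + s • w).2) w.2 0 :=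
    (ContinuousLinearMap.snd ℝ Plane Plane).hasFDerivAt.comp_hasDerivAt 0 hl
  have h3 := (hG.hasDerivAt_chr h1 (by simpa using hz) h2 h2).neg
  have h4 := h2.prodMk h3
  have h5 : HasDerivAt (fun s : ℝ => spray G (z + s • w)) (fderiv ℝ (spray G) z w) 0 := by
    have := ((hG.spray_contDiffAt hz).differentiableAt (by simp)).hasFDerivAt
    have h6 : HasFDerivAt (spray G) (fderiv ℝ (spray G) z) (z + (0 : ℝ) • w) := by simpa using this
    exact h6.comp_hasDerivAt 0 hl
  have h7 := h5.unique h4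
  rw [h7]
  simp

set_option maxRecDepth 8000 in
set_option maxHeartbeats 1000000 in
/-- The algebraic core of the Jacobi equation. With `B = J'`, the vector in the first argument is the second
covariant derivative of a Jacobi field `J` along a geodesic with velocity `T`, and its inner product with
`J` is `-⟨R(J, T) T, J⟩`, which on a surface is minus the Gaussian curvature times the square of the area
spanned by `T` and `J`. -/
theorem form_curvature {y : Plane} (hy : y ∈ U) (T J B : Plane) :
    form G y (-(chr G y B T + chr G y T B + dchr G y J T T) +
      (chr G y (-chr G y T T) J + chr G y T B + dchr G y T T J) + chr G y T (B + chr G y T J)) J =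
    - (coordCurvature G y * (G y).det * (T 0 * J 1 - T 1 * J 0) ^ 2) := by
  have hdet := (hG.det_pos hy).ne'
  have c00 := hG.curvature_antisymm hy 0 0
  have c01 := hG.curvature_antisymm hy 0 1
  have c11 := hG.curvature_antisymm hy 1 1
  have hK : coordCurvature G y * (G y).det = curvatureCoeff G 0 1 0 1 y * G y 0 0 +
      curvatureCoeff G 1 1 0 1 y * G y 1 0 := by
    unfold coordCurvature
    rw [div_mul_cancel₀ _ hdet, Fin.sum_univ_two]
  rw [hK]
  have hs := fun k => hG.christoffel_symm hy k 1 0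
  have hds := fun m k => hG.partialD_christoffel_symm hy m k 1 0
  have hg := hG.symm y hy 1 0
  simp only [form, chr, dchr, curvatureCoeff, Fin.sum_univ_two, PiLp.add_apply, PiLp.neg_apply]
    at c00 c01 c11 ⊢
  simp only [hs, hds, hg] at c00 c01 c11 ⊢
  generalize T 0 = T0 at *
  generalize T 1 = T1 at *
  generalize J 0 = J0 at *
  generalize J 1 = J1 at *
  generalize B 0 = B0 at *
  generalize B 1 = B1 at *
  linear_combination (T0 * J1 - T1 * J0) *
    (T0 * J0 / 2 * c00 + T1 * J1 / 2 * c11 + T0 * J1 * c01)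

/-- The derivative of `⟨∇J, J⟩` along a geodesic is `⟨∇J, ∇J⟩ - K |T ∧ J|²`, for a Jacobi field `J`: the first
component of a solution `w` of the linearized geodesic equation. -/
theorem hasDerivAt_covD {z w : ℝ → Plane × Plane} {t : ℝ} (hz : HasDerivAt z (spray G (z t)) t)
    (hU : (z t).1 ∈ U) (hw : HasDerivAt w (fderiv ℝ (spray G) (z t) (w t)) t) :
    HasDerivAt (fun s => form G (z s).1 (covD G (z s) (w s)) (w s).1)
      (form G (z t).1 (covD G (z t) (w t)) (covD G (z t) (w t))
        - coordCurvature G (z t).1 * (G (z t).1).det *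
          ((z t).2 0 * (w t).1 1 - (z t).2 1 * (w t).1 0) ^ 2) t := by
  rw [hG.fderiv_spray hU] at hw
  have z1 : HasDerivAt (fun s => (z s).1) (z t).2 t :=
    (ContinuousLinearMap.fst ℝ Plane Plane).hasFDerivAt.comp_hasDerivAt t hz
  have z2 : HasDerivAt (fun s => (z s).2) (-chr G (z t).1 (z t).2 (z t).2) t :=
    (ContinuousLinearMap.snd ℝ Plane Plane).hasFDerivAt.comp_hasDerivAt t hz
  have w1 : HasDerivAt (fun s => (w s).1) (w t).2 t :=
    (ContinuousLinearMap.fst ℝ Plane Plane).hasFDerivAt.comp_hasDerivAt t hw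
  have w2 : HasDerivAt (fun s => (w s).2) (-(chr G (z t).1 (w t).2 (z t).2 +
      chr G (z t).1 (z t).2 (w t).2 + dchr G (z t).1 (w t).1 (z t).2 (z t).2)) t :=
    (ContinuousLinearMap.snd ℝ Plane Plane).hasFDerivAt.comp_hasDerivAt t hw
  have hA : HasDerivAt (fun s => covD G (z s) (w s)) _ t := w2.add (hG.hasDerivAt_chr z1 hU z2 w1)
  refine (hG.hasDerivAt_form z1 hU hA w1).congr_deriv ?_
  rw [add_comm, sub_eq_add_neg, ← hG.form_curvature hU (z t).2 (w t).1 (w t).2]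
  rfl

/-- The derivative of `⟨J, J⟩` is `2 ⟨∇J, J⟩`. -/
theorem hasDerivAt_form_self {z w : ℝ → Plane × Plane} {t : ℝ}
    (hz : HasDerivAt z (spray G (z t)) t)
    (hU : (z t).1 ∈ U) (hw : HasDerivAt w (fderiv ℝ (spray G) (z t) (w t)) t) :
    HasDerivAt (fun s => form G (z s).1 (w s).1 (w s).1)
      (2 * form G (z t).1 (covD G (z t) (w t)) (w t).1) t := by
  rw [hG.fderiv_spray hU] at hw
  have z1 : HasDerivAt (fun s => (z s).1) (z t).2 t :=
    (ContinuousLinearMap.fst ℝ Plane Plane).hasFDerivAt.comp_hasDerivAt t hz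
  have w1 : HasDerivAt (fun s => (w s).1) (w t).2 t :=
    (ContinuousLinearMap.fst ℝ Plane Plane).hasFDerivAt.comp_hasDerivAt t hw
  refine (hG.hasDerivAt_form z1 hU w1 w1).congr_deriv ?_
  rw [hG.form_symm hU (w t).1, two_mul]
  rfl

/-- Geodesics have constant speed. -/
theorem hasDerivAt_speed {z : ℝ → Plane × Plane} {t : ℝ}
    (hz : HasDerivAt z (spray G (z t)) t) (hU : (z t).1 ∈ U) :
    HasDerivAt (fun s => form G (z s).1 (z s).2 (z s).2) 0 t := by
  have z1 : HasDerivAt (fun s => (z s).1) (z t).2 t :=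
    (ContinuousLinearMap.fst ℝ Plane Plane).hasFDerivAt.comp_hasDerivAt t hz
  have z2 : HasDerivAt (fun s => (z s).2) (-chr G (z t).1 (z t).2 (z t).2) t :=
    (ContinuousLinearMap.snd ℝ Plane Plane).hasFDerivAt.comp_hasDerivAt t hz
  refine (hG.hasDerivAt_form z1 hU z2 z2).congr_deriv ?_
  simp [form]

/-- Cauchy-Schwarz inequality for the metric. -/
theorem form_sq_le {y : Plane} (hy : y ∈ U) (u v : Plane) :
    form G y u v ^ 2 ≤ form G y u u * form G y v v := by
  have hd := (hG.det_pos hy).le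
  rw [Matrix.det_fin_two] at hd
  have hg := hG.symm y hy 1 0
  have : form G y u u * form G y v v - form G y u v ^ 2 =
      (G y 0 0 * G y 1 1 - G y 0 1 * G y 1 0) * (u 0 * v 1 - u 1 * v 0) ^ 2 := by
    simp only [form, Fin.sum_univ_two, hg]
    ring
  nlinarith [mul_nonneg hd (sq_nonneg (u 0 * v 1 - u 1 * v 0))]

theorem form_nonneg {y : Plane} (hy : y ∈ U) (u : Plane) : 0 ≤ form G y u u := by
  by_cases hu : u = 0
  · simp [hu, form]
  · exact (hG.pos y hy u hu).le

end IsMetricOn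
end Surface

/-! ### Differentiable dependence of flows on initial conditions -/

namespace Surface

section Flow
variable {E : Type*} [NormedAddCommGroup E] [NormedSpace ℝ E]

open scoped NNReal

/-- Differentiable dependence on the initial value for an autonomous equation: if `Y` solves the
linearized equation along `Φ z`, it is the (strict) derivative of the flow at `z`. -/
theorem hasStrictFDerivAt_flow {V : E → E} {B s : Set E} {K : ℝ≥0} (hK : 0 < K)
    (hBc : Convex ℝ B) (hV : ∀ z ∈ B, ContDiffAt ℝ 1 V z) (hVK : ∀ z ∈ B, ‖fderiv ℝ V z‖ ≤ K)
    {Φ : E → ℝ → E} {t : ℝ} (ht : 0 ≤ t) {z : E} (hs : s ∈ 𝓝 z) (h0 : ∀ z' ∈ s, Φ z' 0 = z')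
    (hΦB : ∀ z' ∈ s, ∀ τ ∈ Icc 0 t, Φ z' τ ∈ B)
    (hΦ : ∀ z' ∈ s, ∀ τ ∈ Icc 0 t, HasDerivAt (Φ z') (V (Φ z' τ)) τ)
    {Y : ℝ → E →L[ℝ] E} (hY0 : Y 0 = ContinuousLinearMap.id ℝ E)
    (hY : ∀ τ ∈ Icc 0 t, HasDerivAt Y (fderiv ℝ V (Φ z τ) ∘L Y τ) τ) :
    HasStrictFDerivAt (fun z' => Φ z' t) (Y t) z := by
  have hz : z ∈ s := mem_of_mem_nhds hs
  have hcont : ∀ z' ∈ s, ContinuousOn (Φ z') (Icc 0 t) := fun z' hz' τ hτ =>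
    (hΦ z' hz' τ hτ).continuousAt.continuousWithinAt
  have hlip : LipschitzOnWith K V B :=
    hBc.lipschitzOnWith_of_nnnorm_fderiv_le (fun x hx => (hV x hx).differentiableAt (by simp))
      (fun x hx => hVK x hx)
  -- by Gronwall's inequality, trajectories separate at most exponentially
  have hdist : ∀ z1 ∈ s, ∀ z2 ∈ s, ∀ τ ∈ Icc 0 t,
      dist (Φ z1 τ) (Φ z2 τ) ≤ dist z1 z2 * Real.exp (K * t) := by
    intro z1 h1 z2 h2 τ hτ
    have := dist_le_of_trajectories_ODE_of_mem (v := fun _ => V) (s := fun _ => B) (K := K)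
      (f := Φ z1) (g := Φ z2) (a := 0) (b := t) (δ := dist z1 z2) (fun _ _ => hlip) (hcont z1 h1)
      (fun τ hτ => (hΦ z1 h1 τ (Ico_subset_Icc_self hτ)).hasDerivWithinAt)
      (fun τ hτ => hΦB z1 h1 τ (Ico_subset_Icc_self hτ)) (hcont z2 h2)
      (fun τ hτ => (hΦ z2 h2 τ (Ico_subset_Icc_self hτ)).hasDerivWithinAt)
      (fun τ hτ => hΦB z2 h2 τ (Ico_subset_Icc_self hτ)) (by rw [h0 z1 h1, h0 z2 h2]) τ hτ
    refine this.trans ?_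
    gcongr
    linarith [hτ.2]
  rw [hasStrictFDerivAt_iff_isLittleO, Asymptotics.isLittleO_iff]
  intro c hc
  set M := Real.exp (K * t) with hM
  have hMpos : 0 < M := Real.exp_pos _
  -- the modulus of continuity of `DV` for which the final estimate has constant `c`
  set η : ℝ := c * K / (M * M) with hη
  have hKpos : (0 : ℝ) < K := hK
  have hηpos : 0 < η := by positivity
  -- the derivative of `V` is uniformly continuous along the compact trajectory of `z`
  have hcomp : IsCompact (Φ z '' Icc 0 t) := isCompact_Icc.image_of_continuousOn (hcont z hz)
  have hunif := hcomp.uniformContinuousAt_of_continuousAt (fderiv ℝ V) (by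
    rintro _ ⟨τ, hτ, rfl⟩
    exact (hV _ (hΦB z hz τ hτ)).continuousAt_fderiv (by simp)) (Metric.dist_mem_uniformity hηpos)
  obtain ⟨δ, hδ, hδ'⟩ := Metric.mem_uniformity_dist.1 hunif
  have hball : Metric.ball z (δ / M) ∩ s ∈ 𝓝 z := inter_mem (Metric.ball_mem_nhds z (by positivity)) hs
  filter_upwards [prod_mem_nhds hball hball] with ⟨z1, z2⟩ ⟨⟨hz1, hs1⟩, ⟨hz2, hs2⟩⟩
  dsimp only at hs1 hs2 hz1 hz2 ⊢
  have hnear : ∀ z1 ∈ s, z1 ∈ Metric.ball z (δ / M) → ∀ τ ∈ Icc 0 t, Φ z1 τ ∈ Metric.ball (Φ z τ) δ := by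
    intro z1 hs1 hz1 τ hτ
    have h1 := hdist z1 hs1 z hz τ hτ
    rw [Metric.mem_ball] at hz1 ⊢
    rw [lt_div_iff₀ hMpos] at hz1
    exact h1.trans_lt hz1
  -- mean value inequality: linearizing `V` at `Φ z τ` costs at most `η` times the distance
  have hmv : ∀ τ ∈ Icc 0 t, ‖V (Φ z1 τ) - V (Φ z2 τ) - fderiv ℝ V (Φ z τ) (Φ z1 τ - Φ z2 τ)‖ ≤
      η * ‖Φ z1 τ - Φ z2 τ‖ := by
    intro τ hτ
    refine (hBc.inter (convex_ball (Φ z τ) δ)).norm_image_sub_le_of_norm_hasFDerivWithin_le'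
      (f' := fderiv ℝ V) (fun x hx => ((hV x hx.1).differentiableAt (by simp)).hasFDerivAt.hasFDerivWithinAt)
      (fun x hx => ?_) ⟨hΦB z2 hs2 τ hτ, hnear z2 hs2 hz2 τ hτ⟩ ⟨hΦB z1 hs1 τ hτ, hnear z1 hs1 hz1 τ hτ⟩
    have := hδ' (a := Φ z τ) (b := x) (by rw [dist_comm]; exact hx.2) ⟨τ, hτ, rfl⟩
    rw [← dist_eq_norm, dist_comm]
    exact (show dist _ _ < η from this).le
  have hd : ∀ τ ∈ Icc 0 t, HasDerivAt (fun τ => Φ z1 τ - Φ z2 τ - Y τ (z1 - z2))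
      (V (Φ z1 τ) - V (Φ z2 τ) - fderiv ℝ V (Φ z τ) (Y τ (z1 - z2))) τ := by
    intro τ hτ
    have h3 := (hY τ hτ).clm_apply (hasDerivAt_const τ (z1 - z2))
    simpa using ((hΦ z1 hs1 τ hτ).fun_sub (hΦ z2 hs2 τ hτ)).fun_sub h3
  -- the error of the linear approximation satisfies a Gronwall inequality with initial value zero
  have hg := norm_le_gronwallBound_of_norm_deriv_right_le
    (f := fun τ => Φ z1 τ - Φ z2 τ - Y τ (z1 - z2)) (δ := 0) (K := K) (ε := η * (dist z1 z2 * M))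
    (a := 0) (b := t)
    (fun τ hτ => (hd τ hτ).continuousAt.continuousWithinAt)
    (fun τ hτ => (hd τ (Ico_subset_Icc_self hτ)).hasDerivWithinAt)
    (by simp [h0 z1 hs1, h0 z2 hs2, hY0]) (by
      intro τ hτ'
      have hτ := Ico_subset_Icc_self hτ'
      have e1 : V (Φ z1 τ) - V (Φ z2 τ) - fderiv ℝ V (Φ z τ) (Y τ (z1 - z2)) =
        fderiv ℝ V (Φ z τ) (Φ z1 τ - Φ z2 τ - Y τ (z1 - z2)) +
        (V (Φ z1 τ) - V (Φ z2 τ) - fderiv ℝ V (Φ z τ) (Φ z1 τ - Φ z2 τ)) := by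
        simp only [map_sub]; abel
      rw [e1]
      refine (norm_add_le _ _).trans (add_le_add ?_ ?_)
      · exact ((fderiv ℝ V (Φ z τ)).le_opNorm _).trans
          (mul_le_mul_of_nonneg_right (hVK _ (hΦB z hz τ hτ)) (norm_nonneg _))
      · refine (hmv τ hτ).trans ?_
        rw [← dist_eq_norm]
        exact mul_le_mul_of_nonneg_left (hdist z1 hs1 z2 hs2 τ hτ) hηpos.le) t (right_mem_Icc.2 ht)
  refine hg.trans ?_
  rw [gronwallBound_of_K_ne_0 hKpos.ne', sub_zero]
  dsimp only
  rw [← hM, hη, dist_eq_norm]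
  have : 0 * M + c * K / (M * M) * (‖z1 - z2‖ * M) / K * (M - 1) = c * ‖z1 - z2‖ * ((M - 1) / M) := by
    field_simp
    ring
  rw [this]
  refine mul_le_of_le_one_right (by positivity) ?_
  rw [div_le_one hMpos]
  linarith

/-- A `C²` vector field has a local flow which is differentiable with respect to the initial value,
and the derivative solves the linearized equation. -/
theorem exists_local_flow [CompleteSpace E] {V : E → E} {z0 : E} (hV : ContDiffAt ℝ 2 V z0)
    {W : Set E} (hW : W ∈ 𝓝 z0) :
    ∃ ε > 0, ∃ r > 0, ∃ Φ : E → ℝ → E, ∃ Y : E → ℝ → (E →L[ℝ] E), ∀ z ∈ Metric.ball z0 r,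
      Φ z 0 = z ∧ Y z 0 = ContinuousLinearMap.id ℝ E ∧ ∀ t ∈ Ioo (-ε) ε, Φ z t ∈ W ∧
        HasDerivAt (Φ z) (V (Φ z t)) t ∧ HasDerivAt (Y z) (fderiv ℝ V (Φ z t) ∘L Y z t) t ∧
        (0 ≤ t → HasStrictFDerivAt (fun z' => Φ z' t) (Y z t) z) := by
  have h1 : ∀ᶠ z in 𝓝 z0, ContDiffAt ℝ 1 V z :=
    (hV.of_le (by norm_num : (1 : ℕ∞ω) ≤ 2)).eventually (by simp)
  have hfd : ContDiffAt ℝ 1 (fderiv ℝ V) z0 := hV.fderiv_right (by norm_num)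
  set K : ℝ≥0 := ‖fderiv ℝ V z0‖₊ + 1 with hK
  have h2 : ∀ᶠ z in 𝓝 z0, ‖fderiv ℝ V z‖ < K := by
    refine hfd.continuousAt.norm.eventually_lt_const ?_
    simp [hK]
  obtain ⟨ρ, hρ, hρ'⟩ := Metric.mem_nhds_iff.1 (inter_mem hW (inter_mem h1 h2))
  -- the flow and its linearization solve one equation `z' = V(z)`, `Y' = DV(z) Y`, to which the
  -- Picard-Lindelöf theorem is applied
  have hVhat : ContDiffAt ℝ 1 (fun p : E × (E →L[ℝ] E) => (V p.1, fderiv ℝ V p.1 ∘L p.2))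
      (z0, ContinuousLinearMap.id ℝ E) := by
    have hc : ContDiffAt ℝ 1 V z0 := hV.of_le (by norm_num : (1 : ℕ∞ω) ≤ 2)
    refine ContDiffAt.prodMk (hc.comp (z0, ContinuousLinearMap.id ℝ E) contDiffAt_fst) ?_
    exact ContDiffAt.clm_comp (hfd.comp (z0, ContinuousLinearMap.id ℝ E) contDiffAt_fst) contDiffAt_snd
  obtain ⟨ε, hε, a, r, L, K', hr, hpl⟩ := IsPicardLindelof.of_contDiffAt_one hVhat
  obtain ⟨α, hα, hαc⟩ := (hpl 0).exists_forall_mem_closedBall_eq_hasDerivWithinAt_continuousOn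
  set p0 : E × (E →L[ℝ] E) := (z0, ContinuousLinearMap.id ℝ E) with hp0
  have hmem : (Metric.closedBall p0 (r : ℝ)) ×ˢ Icc (0 - ε) (0 + ε) ∈ 𝓝 (p0, (0 : ℝ)) :=
    prod_mem_nhds (Metric.closedBall_mem_nhds _ (by exact_mod_cast hr))
      (Icc_mem_nhds (by linarith) (by linarith))
  have hα0 : α (p0, 0) = p0 := (hα p0 (Metric.mem_closedBall_self r.2)).1
  have hcat : ContinuousAt α (p0, 0) := hαc.continuousAt hmem
  have hst : {q : E × (E →L[ℝ] E) | q.1 ∈ Metric.ball z0 ρ} ∈ 𝓝 (α (p0, 0)) := by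
    rw [hα0]
    exact continuous_fst.continuousAt.preimage_mem_nhds (Metric.ball_mem_nhds _ hρ)
  obtain ⟨δ, hδ, hδ'⟩ := Metric.mem_nhds_iff.1 (inter_mem hmem (hcat.preimage_mem_nhds hst))
  have hin : ∀ z ∈ Metric.ball z0 δ, ∀ t ∈ Ioo (-δ) δ,
      (((z, ContinuousLinearMap.id ℝ E), t) : (E × (E →L[ℝ] E)) × ℝ) ∈ Metric.ball (p0, (0 : ℝ)) δ := by
    intro z hz t ht
    rw [Metric.mem_ball, Prod.dist_eq, max_lt_iff]
    constructor
    · rw [hp0, Prod.dist_eq]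
      simpa [hδ] using hz
    · rw [Real.dist_eq, sub_zero, abs_lt]
      exact ht
  set Φ : E → ℝ → E := fun z t => (α ((z, ContinuousLinearMap.id ℝ E), t)).1 with hΦdef
  set Y : E → ℝ → (E →L[ℝ] E) := fun z t => (α ((z, ContinuousLinearMap.id ℝ E), t)).2 with hYdef
  have h00 : ∀ z ∈ Metric.ball z0 δ, Φ z 0 = z ∧ Y z 0 = ContinuousLinearMap.id ℝ E := by
    intro z hz
    have := (hα (z, ContinuousLinearMap.id ℝ E) (hδ' (hin z hz 0 ⟨by linarith, hδ⟩)).1.1).1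
    exact ⟨congrArg Prod.fst this, congrArg Prod.snd this⟩
  have hder : ∀ z ∈ Metric.ball z0 δ, ∀ t ∈ Ioo (-δ) δ, Φ z t ∈ Metric.ball z0 ρ ∧
      HasDerivAt (Φ z) (V (Φ z t)) t ∧ HasDerivAt (Y z) (fderiv ℝ V (Φ z t) ∘L Y z t) t := by
    intro z hz t ht
    have hb := hδ' (hin z hz t ht)
    have hnh : Icc (0 - ε) (0 + ε) ∈ 𝓝 t := by
      refine mem_of_superset (Ioo_mem_nhds ht.1 ht.2) fun s hs => ?_
      exact (hδ' (hin z hz s hs)).1.2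
    have h5 := ((hα (z, ContinuousLinearMap.id ℝ E) hb.1.1).2 t hb.1.2).hasDerivAt hnh
    exact ⟨hb.2, (ContinuousLinearMap.fst ℝ E (E →L[ℝ] E)).hasFDerivAt.comp_hasDerivAt t h5,
      (ContinuousLinearMap.snd ℝ E (E →L[ℝ] E)).hasFDerivAt.comp_hasDerivAt t h5⟩
  refine ⟨δ, hδ, δ, hδ, Φ, Y, fun z hz => ⟨(h00 z hz).1, (h00 z hz).2, fun t ht => ?_⟩⟩
  obtain ⟨d1, d2, d3⟩ := hder z hz t ht
  refine ⟨(hρ' d1).1, d2, d3, fun ht0 => ?_⟩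
  have hI : ∀ τ ∈ Icc 0 t, τ ∈ Ioo (-δ) δ := fun τ hτ => ⟨by linarith [hτ.1], hτ.2.trans_lt ht.2⟩
  exact hasStrictFDerivAt_flow (B := Metric.ball z0 ρ) (s := Metric.ball z0 δ) (K := K)
    (by positivity) (convex_ball _ _) (fun z hz => (hρ' hz).2.1)
    (fun z hz => (show ‖fderiv ℝ V z‖ < K from (hρ' hz).2.2).le) ht0 (Metric.isOpen_ball.mem_nhds hz)
    (fun z' hz' => (h00 z' hz').1) (fun z' hz' τ hτ => (hder z' hz' τ (hI τ hτ)).1)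
    (fun z' hz' τ hτ => (hder z' hz' τ (hI τ hτ)).2.1) (h00 z hz).2
    (fun τ hτ => (hder z hz τ (hI τ hτ)).2.2)

end Flow
end Surface

/-! ### Geodesics as integral curves of the spray, and change of charts -/

namespace Surface

theorem form_add_left (G : Plane → Matrix (Fin 2) (Fin 2) ℝ) (y u u' v : Plane) :
    form G y (u + u') v = form G y u v + form G y u' v := by
  simp only [form, Fin.sum_univ_two, PiLp.add_apply]; ring

theorem form_sub_left (G : Plane → Matrix (Fin 2) (Fin 2) ℝ) (y u u' v : Plane) :
    form G y (u - u') v = form G y u v - form G y u' v := by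
  simp only [form, Fin.sum_univ_two, PiLp.sub_apply]; ring

theorem form_add_right (G : Plane → Matrix (Fin 2) (Fin 2) ℝ) (y u v v' : Plane) :
    form G y u (v + v') = form G y u v + form G y u v' := by
  simp only [form, Fin.sum_univ_two, PiLp.add_apply]; ring

theorem _root_.HasDerivAt.fderiv_apply {E F : Type*} [NormedAddCommGroup E] [NormedSpace ℝ E]
    [NormedAddCommGroup F] [NormedSpace ℝ F] {φ : E → F} {x w : ℝ → E} {x' w' : E} {t : ℝ}
    (hφ : DifferentiableAt ℝ (fderiv ℝ φ) (x t)) (hx : HasDerivAt x x' t) (hw : HasDerivAt w w' t) :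
    HasDerivAt (fun s => fderiv ℝ φ (x s) (w s))
      (fderiv ℝ (fderiv ℝ φ) (x t) x' (w t) + fderiv ℝ φ (x t) w') t :=
  (hφ.hasFDerivAt.comp_hasDerivAt t hx).clm_apply hw

/-- Transformation rule of the Christoffel symbols under an isometric change of coordinates. -/
theorem chr_transform {G G' : Plane → Matrix (Fin 2) (Fin 2) ℝ} {U U' : Set Plane}
    (hG : IsMetricOn G U) (hG' : IsMetricOn G' U') {φ : Plane → Plane} {x : Plane} (hx : x ∈ U)
    (hx' : φ x ∈ U') (hφ : ContDiffAt ℝ 2 φ x)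
    (hiso : ∀ᶠ y in 𝓝 x, ∀ u, form G y u u = form G' (φ y) (fderiv ℝ φ y u) (fderiv ℝ φ y u))
    (v : Plane) : fderiv ℝ φ x (chr G x v v) =
      chr G' (φ x) (fderiv ℝ φ x v) (fderiv ℝ φ x v) + fderiv ℝ (fderiv ℝ φ) x v v := by
  have hφd : DifferentiableAt ℝ φ x := hφ.differentiableAt (by simp)
  have hfd : DifferentiableAt ℝ (fderiv ℝ φ) x :=
    (hφ.fderiv_right (m := 1) (by norm_num)).differentiableAt (by simp)
  have hsymm : IsSymmSndFDerivAt ℝ φ x := hφ.isSymmSndFDerivAt (by simp)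
  have hU' : ∀ᶠ y in 𝓝 x, φ y ∈ U' := hφ.continuousAt.preimage_mem_nhds (hG'.isOpen.mem_nhds hx')
  -- polarization of `hiso`
  have hpol : ∀ᶠ y in 𝓝 x, ∀ a b, form G y a b = form G' (φ y) (fderiv ℝ φ y a) (fderiv ℝ φ y b) := by
    filter_upwards [hiso, hU', hG.isOpen.mem_nhds hx] with y h1 h2 h3 a b
    have e1 := h1 (a + b)
    rw [map_add, form_add_left, form_add_right, form_add_right, form_add_left, form_add_right,
      form_add_right, ← h1 a, ← h1 b, hG.form_symm h3 b a, hG'.form_symm h2 _ (fderiv ℝ φ y a)] at e1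
    linarith
  set P := fderiv ℝ φ x with hP
  set D := fderiv ℝ (fderiv ℝ φ) x with hD
  -- `S` is the defect in the transformation rule; metric compatibility makes it skew.
  set S : Plane → Plane → Plane := fun a b => P (chr G x a b) - (D a b + chr G' (φ x) (P a) (P b)) with hS
  have hSsymm : ∀ a b, S a b = S b a := by
    intro a b
    simp only [hS]
    rw [hG.chr_symm hx a b, hG'.chr_symm hx' (P a), hsymm.eq a b]
  have hskew : ∀ c a b, form G' (φ x) (S c a) (P b) + form G' (φ x) (S c b) (P a) = 0 := by
    intro c a b
    have hl : HasDerivAt (fun s : ℝ => x + s • c) c 0 := by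
      simpa using ((hasDerivAt_id (0 : ℝ)).smul_const c).const_add x
    have hl0 : x + (0 : ℝ) • c = x := by simp
    have hφl : HasDerivAt (fun s : ℝ => φ (x + s • c)) (P c) 0 := by
      have : HasFDerivAt φ P (x + (0 : ℝ) • c) := by rw [hl0]; exact hφd.hasFDerivAt
      exact this.comp_hasDerivAt 0 hl
    have hDl : ∀ a, HasDerivAt (fun s : ℝ => fderiv ℝ φ (x + s • c) a) (D c a) 0 := by
      intro a
      have := HasDerivAt.fderiv_apply (by rw [hl0]; exact hfd) hl (hasDerivAt_const 0 a)
      rwa [hl0, map_zero, add_zero] at this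
    have d1 := hG.hasDerivAt_form hl (by rw [hl0]; exact hx) (hasDerivAt_const 0 a) (hasDerivAt_const 0 b)
    have d2 := hG'.hasDerivAt_form hφl (by rw [hl0]; exact hx') (hDl a) (hDl b)
    have hcl : ContinuousAt (fun s : ℝ => x + s • c) 0 := hl.continuousAt
    have hev : (fun s : ℝ => form G (x + s • c) a b) =ᶠ[𝓝 0] fun s => form G' (φ (x + s • c))
        (fderiv ℝ φ (x + s • c) a) (fderiv ℝ φ (x + s • c) b) := by
      have hp0 : {y | ∀ a b, form G y a b = form G' (φ y) (fderiv ℝ φ y a) (fderiv ℝ φ y b)} ∈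
        𝓝 (x + (0 : ℝ) • c) := by rw [hl0]; exact hpol
      filter_upwards [hcl.preimage_mem_nhds hp0] with s hs using hs a b
    have h3 := d1.unique (d2.congr_of_eventuallyEq hev)
    simp only [hl0, zero_add] at h3
    have hp := hpol.self_of_nhds
    rw [hp, hp, ← hP] at h3
    rw [hG'.form_symm hx' (P a) (P _), hG'.form_symm hx' (P a) (D c b + _)] at h3
    simp only [hS, form_sub_left]
    linarith
  -- a trilinear form which is symmetric in one pair of arguments and skew in another vanishes
  have hzero : ∀ a b c, form G' (φ x) (S c a) (P b) = 0 := by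
    intro a b c
    have h1 := hskew c a b
    have h2 := hskew a b c
    have h3 := hskew b c a
    rw [hSsymm c b] at h1
    rw [hSsymm a c] at h2
    rw [hSsymm b a] at h3
    linarith
  have hinj : Function.Injective P := by
    rw [injective_iff_map_eq_zero]
    intro u hu
    by_contra hne
    have h1 := hG.pos x hx u hne
    rw [hiso.self_of_nhds u, ← hP, hu] at h1
    simp [form] at h1
  obtain ⟨b, hb⟩ := (LinearMap.injective_iff_surjective (f := (P : Plane →ₗ[ℝ] Plane))).1 hinj (S v v)
  have h4 := hzero v b v
  have hb' : P b = S v v := hb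
  rw [hb'] at h4
  have h5 : S v v = 0 := by
    by_contra hne
    exact (hG'.pos _ hx' _ hne).ne' h4
  have h6 := sub_eq_zero.1 h5
  rw [h6, add_comm]

/-- The tangent map `(x, v) ↦ (φ(x), dφ(x) v)` of `φ`. -/
noncomputable def tmap (φ : Plane → Plane) (z : Plane × Plane) : Plane × Plane := (φ z.1, fderiv ℝ φ z.1 z.2)

theorem tmap_contDiffAt {φ : Plane → Plane} {z : Plane × Plane} (hφ : ContDiffAt ℝ 2 φ z.1) :
    ContDiffAt ℝ 1 (tmap φ) z := by
  have h1 : ContDiffAt ℝ 1 (fderiv ℝ φ) z.1 := hφ.fderiv_right (by norm_num)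
  have h0 : ContDiffAt ℝ 1 φ z.1 := hφ.of_le (by norm_num)
  exact (h0.comp z contDiffAt_fst).prodMk ((h1.comp z contDiffAt_fst).clm_apply contDiffAt_snd)

/-- Isometric changes of coordinates map integral curves of the spray to integral curves. -/
theorem hasDerivAt_tmap {G G' : Plane → Matrix (Fin 2) (Fin 2) ℝ} {U U' : Set Plane}
    (hG : IsMetricOn G U) (hG' : IsMetricOn G' U') {φ : Plane → Plane} {z : ℝ → Plane × Plane} {t : ℝ}
    (hx : (z t).1 ∈ U) (hx' : φ (z t).1 ∈ U') (hφ : ContDiffAt ℝ 2 φ (z t).1)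
    (hiso : ∀ᶠ y in 𝓝 (z t).1, ∀ u, form G y u u = form G' (φ y) (fderiv ℝ φ y u) (fderiv ℝ φ y u))
    (hz : HasDerivAt z (spray G (z t)) t) :
    HasDerivAt (fun s => tmap φ (z s)) (spray G' (tmap φ (z t))) t := by
  have hφd : DifferentiableAt ℝ φ (z t).1 := hφ.differentiableAt (by simp)
  have hfd : DifferentiableAt ℝ (fderiv ℝ φ) (z t).1 :=
    (hφ.fderiv_right (m := 1) (by norm_num)).differentiableAt (by simp)
  have z1 : HasDerivAt (fun s => (z s).1) (z t).2 t :=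
    (ContinuousLinearMap.fst ℝ Plane Plane).hasFDerivAt.comp_hasDerivAt t hz
  have z2 : HasDerivAt (fun s => (z s).2) (-chr G (z t).1 (z t).2 (z t).2) t :=
    (ContinuousLinearMap.snd ℝ Plane Plane).hasFDerivAt.comp_hasDerivAt t hz
  have h1 := hφd.hasFDerivAt.comp_hasDerivAt t z1
  have h2 := HasDerivAt.fderiv_apply hfd z1 z2
  refine (h1.prodMk h2).congr_deriv ?_
  simp only [spray, tmap]
  rw [map_neg, chr_transform hG hG' hx hx' hφ hiso (z t).2]
  congr 1
  abel

section Charts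
variable {M : Type*} [MetricSpace M] [ChartedSpace Plane M]

section
variable [RiemannianBundle (fun x : M => TangentSpace (𝓡 2) x)]

theorem isMetricOn_metricMatrix [IsManifold (𝓡 2) ∞ M]
    [IsContMDiffRiemannianBundle (𝓡 2) ∞ Plane (fun x : M => TangentSpace (𝓡 2) x)]
    {e : OpenPartialHomeomorph M Plane} (he : e ∈ IsManifold.maximalAtlas (𝓡 2) ∞ M) :
    IsMetricOn (metricMatrix e) e.target where
  isOpen := e.open_target
  smooth := contDiffOn_metricMatrix he
  symm := fun y _ i j => metricMatrix_symm e y i j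
  pos := fun _ hy _ hu => form_metricMatrix_pos he hy hu
end

theorem transition_contDiffAt {e e' : OpenPartialHomeomorph M Plane}
    (he : e ∈ IsManifold.maximalAtlas (𝓡 2) ∞ M) (he' : e' ∈ IsManifold.maximalAtlas (𝓡 2) ∞ M)
    {x : Plane} (hx : x ∈ e.target) (hx' : e.symm x ∈ e'.source) :
    ContDiffAt ℝ ∞ (e' ∘ e.symm) x := by
  rw [← contMDiffAt_iff_contDiffAt]
  exact (contMDiffAt_chart he' hx').comp x (contMDiffAt_chart_symm he hx)

/-- Position and velocity of a curve in a chart. -/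
noncomputable def phase (e : OpenPartialHomeomorph M Plane) (γ : ℝ → M) (t : ℝ) : Plane × Plane :=
  (e (γ t), deriv (fun s => e (γ s)) t)

variable [RiemannianBundle (fun x : M => TangentSpace (𝓡 2) x)]

/-- Changes of charts are isometric for the metric coefficients. -/
theorem transition_isometry {e e' : OpenPartialHomeomorph M Plane}
    (he : e ∈ IsManifold.maximalAtlas (𝓡 2) ∞ M) (he' : e' ∈ IsManifold.maximalAtlas (𝓡 2) ∞ M)
    {x : Plane} (hx : x ∈ e.target) (hx' : e.symm x ∈ e'.source) :
    ∀ᶠ y in 𝓝 x, ∀ u, form (metricMatrix e) y u u = form (metricMatrix e') ((e' ∘ e.symm) y)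
      (fderiv ℝ (e' ∘ e.symm) y u) (fderiv ℝ (e' ∘ e.symm) y u) := by
  have h1 : ∀ᶠ y in 𝓝 x, y ∈ e.target := e.open_target.mem_nhds hx
  have h2 : ∀ᶠ y in 𝓝 x, e.symm y ∈ e'.source :=
    (e.continuousAt_symm hx).preimage_mem_nhds (e'.open_source.mem_nhds hx')
  filter_upwards [h1, h2, h1.eventually_nhds, h2.eventually_nhds] with y hy hy' hyn hyn' u
  have hd := ((transition_contDiffAt he he' hy hy').differentiableAt (by simp)).hasFDerivAt
  rw [form_metricMatrix_self he' (f := e.symm) hd (e'.map_source hy')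
    (by filter_upwards [hyn'] with z hz using (e'.left_inv hz).symm) u]
  exact form_metricMatrix_self he (f := e.symm) (hasFDerivAt_id y) hy (Eventually.of_forall fun _ => rfl) u

/-- Near time `t`, the curve `γ` runs in the domain of the chart `e` and solves the geodesic
equation there. -/
def IsGeodesicIn (e : OpenPartialHomeomorph M Plane) (γ : ℝ → M) (t : ℝ) : Prop :=
  ∀ᶠ s in 𝓝 t, γ s ∈ e.source ∧ HasDerivAt (phase e γ) (spray (metricMatrix e) (phase e γ s)) s

/-- The curve `γ` is a geodesic (of arbitrary constant speed) near time `t`. -/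
def IsGeodesicAt (γ : ℝ → M) (t : ℝ) : Prop :=
  ∃ e ∈ IsManifold.maximalAtlas (𝓡 2) ∞ M, IsGeodesicIn e γ t

/-- An integral curve of the spray in a chart is the phase of the curve that it describes, so that this
curve is a geodesic. -/
theorem isGeodesicIn_of_phase {e : OpenPartialHomeomorph M Plane} {γ : ℝ → M} {t : ℝ}
    {z : ℝ → Plane × Plane} (h : ∀ᶠ s in 𝓝 t, (z s).1 ∈ e.target ∧ γ s = e.symm (z s).1 ∧
      HasDerivAt z (spray (metricMatrix e) (z s)) s) :
    IsGeodesicIn e γ t ∧ phase e γ =ᶠ[𝓝 t] z := by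
  have hph : phase e γ =ᶠ[𝓝 t] z := by
    filter_upwards [h, h.eventually_nhds] with s hs hsn
    have h1 : (fun s => e (γ s)) =ᶠ[𝓝 s] fun s => (z s).1 := by
      filter_upwards [hsn] with r hr
      rw [hr.2.1, e.right_inv hr.1]
    have h2 : HasDerivAt (fun s => (z s).1) (z s).2 s :=
      (ContinuousLinearMap.fst ℝ Plane Plane).hasFDerivAt.comp_hasDerivAt s hs.2.2
    exact Prod.ext h1.self_of_nhds (by rw [phase, h1.deriv_eq, h2.deriv])
  refine ⟨?_, hph⟩
  filter_upwards [h, hph, hph.eventually_nhds] with s hs hps hpn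
  refine ⟨by rw [hs.2.1]; exact e.map_target hs.1, ?_⟩
  rw [hps]
  exact hs.2.2.congr_of_eventuallyEq hpn

theorem IsGeodesicIn.continuousAt {e : OpenPartialHomeomorph M Plane} {γ : ℝ → M} {t : ℝ}
    (h : IsGeodesicIn e γ t) : ContinuousAt γ t := by
  have h1 : ContinuousAt (fun s => (phase e γ s).1) t := h.self_of_nhds.2.continuousAt.fst
  have h2 : γ =ᶠ[𝓝 t] fun s => e.symm (phase e γ s).1 := by
    filter_upwards [h] with s hs using (e.left_inv hs.1).symm
  refine ContinuousAt.congr ?_ h2.symm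
  exact ContinuousAt.comp (f := fun s => (phase e γ s).1)
    (e.continuousAt_symm (e.map_source h.self_of_nhds.1)) h1

theorem IsGeodesicAt.continuousAt {γ : ℝ → M} {t : ℝ} (h : IsGeodesicAt γ t) : ContinuousAt γ t := by
  obtain ⟨e, -, h⟩ := h
  exact h.continuousAt

theorem IsGeodesicIn.congr {e : OpenPartialHomeomorph M Plane} {γ γ' : ℝ → M} {t : ℝ}
    (h : IsGeodesicIn e γ t) (hγ : γ =ᶠ[𝓝 t] γ') : IsGeodesicIn e γ' t := by
  have hph : ∀ᶠ s in 𝓝 t, phase e γ =ᶠ[𝓝 s] phase e γ' := by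
    filter_upwards [hγ.eventually_nhds.eventually_nhds] with s hs
    filter_upwards [hs] with r hr
    have h1 : (fun s => e (γ s)) =ᶠ[𝓝 r] fun s => e (γ' s) := by
      filter_upwards [hr] with q hq
      rw [hq]
    exact Prod.ext h1.self_of_nhds h1.deriv_eq
  filter_upwards [h, hγ, hph] with s hs hs' hp
  rw [← hs', ← hp.self_of_nhds]
  exact ⟨hs.1, hs.2.congr_of_eventuallyEq hp.symm⟩

theorem IsGeodesicAt.congr {γ γ' : ℝ → M} {t : ℝ} (h : IsGeodesicAt γ t) (hγ : γ =ᶠ[𝓝 t] γ') :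
    IsGeodesicAt γ' t := by
  obtain ⟨e, he, h⟩ := h
  exact ⟨e, he, h.congr hγ⟩

variable [IsManifold (𝓡 2) ∞ M]
    [IsContMDiffRiemannianBundle (𝓡 2) ∞ Plane (fun x : M => TangentSpace (𝓡 2) x)]

/-- The geodesic equation does not depend on the chart. -/
theorem IsGeodesicIn.change {e e' : OpenPartialHomeomorph M Plane}
    (he : e ∈ IsManifold.maximalAtlas (𝓡 2) ∞ M) (he' : e' ∈ IsManifold.maximalAtlas (𝓡 2) ∞ M)
    {γ : ℝ → M} {t : ℝ} (h : IsGeodesicIn e γ t) (ht : γ t ∈ e'.source) :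
    IsGeodesicIn e' γ t ∧ phase e' γ =ᶠ[𝓝 t] fun s => tmap (e' ∘ e.symm) (phase e γ s) := by
  refine isGeodesicIn_of_phase ?_
  have hc : ∀ᶠ s in 𝓝 t, γ s ∈ e'.source := h.continuousAt.preimage_mem_nhds (e'.open_source.mem_nhds ht)
  filter_upwards [h, hc] with s hs hs'
  have hx : (phase e γ s).1 ∈ e.target := e.map_source hs.1
  have hl : e.symm (phase e γ s).1 = γ s := e.left_inv hs.1
  have hx' : e.symm (phase e γ s).1 ∈ e'.source := by rw [hl]; exact hs'
  have hφ : ContDiffAt ℝ 2 (e' ∘ e.symm) _ := (transition_contDiffAt he he' hx hx').of_le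
    (WithTop.coe_le_coe.2 le_top)
  refine ⟨e'.map_source hx', ?_, ?_⟩
  · simp only [tmap, Function.comp, hl, e'.left_inv hs']
  · exact hasDerivAt_tmap (isMetricOn_metricMatrix he) (isMetricOn_metricMatrix he') hx
      (e'.map_source hx') hφ (transition_isometry he he' hx hx') hs.2

theorem IsGeodesicAt.isGeodesicIn {e : OpenPartialHomeomorph M Plane}
    (he : e ∈ IsManifold.maximalAtlas (𝓡 2) ∞ M) {γ : ℝ → M} {t : ℝ} (h : IsGeodesicAt γ t)
    (ht : γ t ∈ e.source) : IsGeodesicIn e γ t := by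
  obtain ⟨e', he', h⟩ := h
  exact (h.change he' he ht).1

/-- Local uniqueness of geodesics. -/
theorem IsGeodesicIn.eventuallyEq {e : OpenPartialHomeomorph M Plane}
    (he : e ∈ IsManifold.maximalAtlas (𝓡 2) ∞ M) {γ γ' : ℝ → M} {t : ℝ} (h : IsGeodesicIn e γ t)
    (h' : IsGeodesicIn e γ' t) (heq : phase e γ t = phase e γ' t) : γ =ᶠ[𝓝 t] γ' := by
  have hx : (phase e γ t).1 ∈ e.target := e.map_source h.self_of_nhds.1
  have hC : ContDiffAt ℝ 1 _ _ := ((isMetricOn_metricMatrix he).spray_contDiffAt hx).of_le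
    (WithTop.coe_le_coe.2 le_top)
  obtain ⟨K, s, hs, hl⟩ := hC.exists_lipschitzOnWith
  have hc1 : ∀ᶠ τ in 𝓝 t, phase e γ τ ∈ s := h.self_of_nhds.2.continuousAt.preimage_mem_nhds hs
  have hc2 : ∀ᶠ τ in 𝓝 t, phase e γ' τ ∈ s :=
    h'.self_of_nhds.2.continuousAt.preimage_mem_nhds (by rw [← heq]; exact hs)
  have := ODE_solution_unique_of_eventually (v := fun _ => spray (metricMatrix e)) (s := fun _ => s)
    (K := K) (t₀ := t) (f := phase e γ) (g := phase e γ') (Eventually.of_forall fun _ => hl)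
    (by filter_upwards [h, hc1] with τ h1 h2 using ⟨h1.2, h2⟩)
    (by filter_upwards [h', hc2] with τ h1 h2 using ⟨h1.2, h2⟩) heq
  filter_upwards [this, h, h'] with τ h1 h2 h3
  rw [← e.left_inv h2.1, ← e.left_inv h3.1]
  exact congrArg (fun z : Plane × Plane => e.symm z.1) h1

/-- Two geodesics that coincide near times accumulating at `t` coincide near `t`: by continuity, they
have the same position and velocity at time `t`. -/
theorem IsGeodesicAt.eventuallyEq_of_frequently {γ γ' : ℝ → M} {t : ℝ} (h : IsGeodesicAt γ t)
    (h' : IsGeodesicAt γ' t) (hfr : ∃ᶠ s in 𝓝 t, γ =ᶠ[𝓝 s] γ') : γ =ᶠ[𝓝 t] γ' := by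
  obtain ⟨e, he, h⟩ := h
  have heq : γ t = γ' t := by
    exact tendsto_nhds_unique_of_frequently_eq h.continuousAt h'.continuousAt
      (hfr.mono fun s hs => hs.self_of_nhds)
  have h'' := h'.isGeodesicIn he (by rw [← heq]; exact h.self_of_nhds.1)
  refine h.eventuallyEq he h'' ?_
  refine tendsto_nhds_unique_of_frequently_eq h.self_of_nhds.2.continuousAt
    h''.self_of_nhds.2.continuousAt (hfr.mono fun s hs => ?_)
  have h1 : (fun s => e (γ s)) =ᶠ[𝓝 s] fun s => e (γ' s) := by
    filter_upwards [hs] with q hq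
    rw [hq]
  exact Prod.ext h1.self_of_nhds h1.deriv_eq

end Charts
end Surface

/-! ### Continuation of solutions, speed of geodesics -/

namespace Surface

section Continuation
variable {X : Type*} {Q : (ℝ → X) → ℝ → Prop}

/-- Local uniqueness of solutions implies uniqueness on connected sets. -/
theorem eventuallyEq_of_local_uniqueness
    (huniq : ∀ f g t, Q f t → Q g t → (∃ᶠ s in 𝓝 t, f =ᶠ[𝓝 s] g) → f =ᶠ[𝓝 t] g)
    {f g : ℝ → X} {s : Set ℝ} (hs : IsPreconnected s) (hf : ∀ t ∈ s, Q f t) (hg : ∀ t ∈ s, Q g t)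
    {t0 : ℝ} (ht0 : t0 ∈ s) (h : f =ᶠ[𝓝 t0] g) : ∀ t ∈ s, f =ᶠ[𝓝 t] g := by
  have hopen : IsOpen {t | f =ᶠ[𝓝 t] g} := isOpen_iff_mem_nhds.2 fun t ht => ht.eventually_nhds
  refine hs.subset_of_closure_inter_subset hopen ⟨t0, ht0, h⟩ ?_
  rintro t ⟨htc, hts⟩
  exact huniq f g t (hf t hts) (hg t hts) (mem_closure_iff_frequently.1 htc)

/-- Continuation principle for a local property `Q f t` of a curve `f` near time `t`, read as `f` solves
an equation at time `t`: if solutions are locally unique, a local solution extends to `(a, ∞)` as soon as a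
solution on a bounded interval `(a, b)` can always be continued beyond `b`. -/
theorem exists_global_solution
    (hcongr : ∀ f g t, f =ᶠ[𝓝 t] g → Q f t → Q g t)
    (huniq : ∀ f g t, Q f t → Q g t → (∃ᶠ s in 𝓝 t, f =ᶠ[𝓝 s] g) → f =ᶠ[𝓝 t] g)
    {a b0 : ℝ} (ha : a < 0) (hb0 : 0 < b0) {f0 : ℝ → X} (hf0 : ∀ t ∈ Ioo a b0, Q f0 t)
    (hext : ∀ f b, 0 < b → (∀ t ∈ Ioo a b, Q f t) → f =ᶠ[𝓝 0] f0 →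
      ∃ t1 ∈ Ioo 0 b, ∃ c > b, ∃ h, (∀ t ∈ Ico t1 c, Q h t) ∧ h =ᶠ[𝓝 t1] f) :
    ∃ f, (∀ t > a, Q f t) ∧ f =ᶠ[𝓝 0] f0 := by
  classical
  -- the right endpoints of intervals on which there is a solution; this set has no greatest element
  set S : Set ℝ := {b | 0 < b ∧ ∃ f, (∀ t ∈ Ioo a b, Q f t) ∧ f =ᶠ[𝓝 0] f0} with hS
  have hstep : ∀ b ∈ S, ∃ c ∈ S, b < c := by
    rintro b ⟨hb, f, hf, hff0⟩
    obtain ⟨t1, ht1, c, hc, h, hh, hhf⟩ := hext f b hb hf hff0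
    set g : ℝ → X := fun t => if t < t1 then f t else h t with hg
    have g1 : ∀ t < t1, f =ᶠ[𝓝 t] g := by
      intro t ht
      filter_upwards [Iio_mem_nhds ht] with s hs
      simp [hg, mem_Iio.1 hs]
    have g2 : ∀ t ≥ t1, h =ᶠ[𝓝 t] g := by
      intro t ht
      rcases ht.lt_or_eq with ht | rfl
      · filter_upwards [Ioi_mem_nhds ht] with s hs
        simp [hg, not_lt.2 (mem_Ioi.1 hs).le]
      · filter_upwards [hhf] with s hs
        by_cases h' : s < t1 <;> simp [hg, h', hs]
    refine ⟨c, ⟨hb.trans hc, g, fun t ht => ?_, (g1 0 ht1.1).symm.trans hff0⟩, hc⟩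
    by_cases h' : t < t1
    · exact hcongr _ _ _ (g1 t h') (hf t ⟨ht.1, h'.trans ht1.2⟩)
    · exact hcongr _ _ _ (g2 t (not_lt.1 h')) (hh t ⟨not_lt.1 h', ht.2⟩)
  have : Nonempty (ℝ → X) := ⟨f0⟩
  choose! sol hsol using fun b (hb : b ∈ S) => hb.2
  have hagree : ∀ b ∈ S, ∀ c ∈ S, ∀ t ∈ Ioo a (min b c), sol b =ᶠ[𝓝 t] sol c := by
    intro b hb c hc
    refine eventuallyEq_of_local_uniqueness huniq isPreconnected_Ioo
      (fun t ht => (hsol b hb).1 t ⟨ht.1, ht.2.trans_le (min_le_left _ _)⟩)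
      (fun t ht => (hsol c hc).1 t ⟨ht.1, ht.2.trans_le (min_le_right _ _)⟩)
      (t0 := 0) ⟨ha, lt_min hb.1 hc.1⟩ ((hsol b hb).2.trans (hsol c hc).2.symm)
  -- `β t` is the endpoint of an interval of existence that contains `t`; the solutions agree on
  -- common intervals, so that they glue to `F`
  set β : ℝ → ℝ := fun t => if h : ∃ b ∈ S, t < b then h.choose else 0 with hβ
  have hβ' : ∀ t, (∃ b ∈ S, t < b) → β t ∈ S ∧ t < β t := by
    intro t h
    simp only [hβ, dif_pos h]
    exact h.choose_spec
  set F : ℝ → X := fun t => sol (β t) t with hF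
  have hFsol : ∀ b ∈ S, ∀ t ∈ Ioo a b, sol b =ᶠ[𝓝 t] F := by
    intro b hb t ht
    filter_upwards [Ioo_mem_nhds ht.1 ht.2] with s hs
    obtain ⟨h1, h2⟩ := hβ' s ⟨b, hb, hs.2⟩
    exact (hagree b hb (β s) h1 s ⟨hs.1, lt_min hs.2 h2⟩).self_of_nhds
  have hb0S : b0 ∈ S := ⟨hb0, f0, hf0, EventuallyEq.rfl⟩
  have hF0 : F =ᶠ[𝓝 0] f0 := (hFsol b0 hb0S 0 ⟨ha, hb0⟩).symm.trans (hsol b0 hb0S).2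
  have hFQ : ∀ t > a, (∃ b ∈ S, t < b) → Q F t := by
    rintro t ht ⟨b, hb, htb⟩
    exact hcongr _ _ _ (hFsol b hb t ⟨ht, htb⟩) ((hsol b hb).1 t ⟨ht, htb⟩)
  -- otherwise the supremum would be the greatest element, as `F` is a solution up to it
  have hunb : ¬ BddAbove S := by
    intro hbdd
    have hlub := isLUB_csSup ⟨b0, hb0S⟩ hbdd
    have hmem : sSup S ∈ S := by
      refine ⟨hb0.trans_le (hlub.1 hb0S), F, fun t ht => hFQ t ht.1 ?_, hF0⟩
      obtain ⟨b, hb, htb⟩ := (lt_isLUB_iff hlub).1 ht.2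
      exact ⟨b, hb, htb⟩
    obtain ⟨c, hc, hlt⟩ := hstep _ hmem
    exact absurd (hlub.1 hc) (not_le.2 hlt)
  refine ⟨F, fun t ht => hFQ t ht ?_, hF0⟩
  by_contra hcon
  push Not at hcon
  exact hunb ⟨t, hcon⟩

end Continuation

section Speed
variable {M : Type*} [MetricSpace M] [ChartedSpace Plane M]
    [RiemannianBundle (fun x : M => TangentSpace (𝓡 2) x)]

theorem edist_le_of_speed_le [IsManifold (𝓡 2) ∞ M] [IsRiemannianManifold (𝓡 2) M]
    {γ : ℝ → M} {a b : ℝ} {σ : ℝ≥0∞} (hab : a ≤ b)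
    (hγ : ∀ t ∈ Icc a b, ContMDiffAt 𝓘(ℝ, ℝ) (𝓡 2) 1 γ t)
    (hσ : ∀ t ∈ Icc a b, ‖mfderiv 𝓘(ℝ, ℝ) (𝓡 2) γ t (1 : ℝ)‖ₑ ≤ σ) :
    edist (γ a) (γ b) ≤ σ * ENNReal.ofReal (b - a) := by
  rw [IsRiemannianManifold.out (I := 𝓡 2) (γ a) (γ b)]
  refine (Manifold.riemannianEDist_le_pathELength (I := 𝓡 2) (γ := γ)
    (fun t ht => (hγ t ht).contMDiffWithinAt) rfl rfl hab).trans ?_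
  rw [Manifold.pathELength_eq_lintegral_mfderiv_Icc]
  refine (MeasureTheory.setLIntegral_mono measurable_const hσ).trans ?_
  simp

/-- The speed of a geodesic in terms of its phase. -/
theorem IsGeodesicIn.form_phase {e : OpenPartialHomeomorph M Plane}
    (he : e ∈ IsManifold.maximalAtlas (𝓡 2) ∞ M) {γ : ℝ → M} {t : ℝ} (h : IsGeodesicIn e γ t) :
    form (metricMatrix e) (phase e γ t).1 (phase e γ t).2 (phase e γ t).2 =
      ‖mfderiv 𝓘(ℝ, ℝ) (𝓡 2) γ t (1 : ℝ)‖ ^ 2 := by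
  have h1 : HasDerivAt (fun s => (phase e γ s).1) (phase e γ t).2 t :=
    (ContinuousLinearMap.fst ℝ Plane Plane).hasFDerivAt.comp_hasDerivAt t h.self_of_nhds.2
  have := form_metricMatrix_self he h1.hasFDerivAt (e.map_source h.self_of_nhds.1) (f := γ)
    (by filter_upwards [h] with s hs using (e.left_inv hs.1).symm) (1 : ℝ)
  simpa using this

theorem IsGeodesicIn.contMDiffAt {e : OpenPartialHomeomorph M Plane}
    (he : e ∈ IsManifold.maximalAtlas (𝓡 2) ∞ M) {γ : ℝ → M} {t : ℝ} (h : IsGeodesicIn e γ t) :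
    ContMDiffAt 𝓘(ℝ, ℝ) (𝓡 2) 1 γ t := by
  have h1 : ∀ᶠ s in 𝓝 t, HasDerivAt (fun s => (phase e γ s).1) (phase e γ s).2 s := by
    filter_upwards [h] with s hs
    exact (ContinuousLinearMap.fst ℝ Plane Plane).hasFDerivAt.comp_hasDerivAt s hs.2
  have h2 : ContDiffAt ℝ 1 (fun s => (phase e γ s).1) t := by
    obtain ⟨u, hu, huo, htu⟩ := eventually_nhds_iff.1 (h1.and h)
    have hcd : ContDiffOn ℝ 1 (fun s => (phase e γ s).1) u := by
      rw [show (1 : ℕ∞ω) = 0 + 1 from rfl, contDiffOn_succ_iff_deriv_of_isOpen huo]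
      refine ⟨fun s hs => (hu s hs).1.differentiableAt.differentiableWithinAt, by simp, ?_⟩
      refine ContDiffOn.congr (f := fun s => (phase e γ s).2) ?_ fun s hs => (hu s hs).1.deriv
      exact contDiffOn_zero.2 fun s hs => ((hu s hs).2.2.continuousAt.snd).continuousWithinAt
    exact hcd.contDiffAt (huo.mem_nhds htu)
  have h3 : γ =ᶠ[𝓝 t] e.symm ∘ fun s => (phase e γ s).1 := by
    filter_upwards [h] with s hs using (e.left_inv hs.1).symm
  refine ContMDiffAt.congr_of_eventuallyEq ?_ h3
  exact ((contMDiffAt_chart_symm he (e.map_source h.self_of_nhds.1)).of_le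
    (by exact_mod_cast le_top)).comp t h2.contMDiffAt

/-- The curve with phase `Φ` starting at time `t1`. -/
theorem isGeodesicIn_flow {e : OpenPartialHomeomorph M Plane} {Φ : ℝ → Plane × Plane} {ε t1 : ℝ}
    (hΦ : ∀ t ∈ Ioo (-ε) ε, (Φ t).1 ∈ e.target ∧ HasDerivAt Φ (spray (metricMatrix e) (Φ t)) t)
    {t : ℝ} (ht : t ∈ Ioo (t1 - ε) (t1 + ε)) :
    IsGeodesicIn e (fun s => e.symm (Φ (s - t1)).1) t ∧
      phase e (fun s => e.symm (Φ (s - t1)).1) =ᶠ[𝓝 t] fun s => Φ (s - t1) := by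
  refine isGeodesicIn_of_phase ?_
  filter_upwards [Ioo_mem_nhds ht.1 ht.2] with s hs
  have := hΦ (s - t1) ⟨by linarith [hs.1], by linarith [hs.2]⟩
  exact ⟨this.1, rfl, this.2.comp_sub_const s t1⟩

variable [IsManifold (𝓡 2) ∞ M]
    [IsContMDiffRiemannianBundle (𝓡 2) ∞ Plane (fun x : M => TangentSpace (𝓡 2) x)]

theorem IsGeodesicAt.hasDerivAt_speed {γ : ℝ → M} {t : ℝ} (h : IsGeodesicAt γ t) :
    HasDerivAt (fun s => ‖mfderiv 𝓘(ℝ, ℝ) (𝓡 2) γ s (1 : ℝ)‖ ^ 2) 0 t := by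
  obtain ⟨e, he, h⟩ := h
  refine ((isMetricOn_metricMatrix he).hasDerivAt_speed h.self_of_nhds.2
    (e.map_source h.self_of_nhds.1)).congr_of_eventuallyEq ?_
  filter_upwards [h.eventually_nhds] with s hs
  exact (IsGeodesicIn.form_phase he hs).symm

theorem speed_eq_of_geodesic {γ : ℝ → M} {a b : ℝ} (h : ∀ t ∈ Ioo a b, IsGeodesicAt γ t)
    {s t : ℝ} (hs : s ∈ Ioo a b) (ht : t ∈ Ioo a b) :
    ‖mfderiv 𝓘(ℝ, ℝ) (𝓡 2) γ s (1 : ℝ)‖ = ‖mfderiv 𝓘(ℝ, ℝ) (𝓡 2) γ t (1 : ℝ)‖ := by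
  have := isOpen_Ioo.is_const_of_deriv_eq_zero isPreconnected_Ioo
    (f := fun s => ‖mfderiv 𝓘(ℝ, ℝ) (𝓡 2) γ s (1 : ℝ)‖ ^ 2)
    (fun r hr => (h r hr).hasDerivAt_speed.differentiableAt.differentiableWithinAt)
    (fun r hr => (h r hr).hasDerivAt_speed.deriv) hs ht
  exact (pow_left_inj₀ (norm_nonneg _) (norm_nonneg _) two_ne_zero).1 this

/-- Local existence of geodesics, with a time of existence that is uniform over nearby initial
conditions. -/
theorem exists_geodesic_flow {e : OpenPartialHomeomorph M Plane}
    (he : e ∈ IsManifold.maximalAtlas (𝓡 2) ∞ M) {z0 : Plane × Plane} (hz0 : z0.1 ∈ e.target) :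
    ∃ ε > 0, ∃ r > 0, ∃ Φ : Plane × Plane → ℝ → Plane × Plane,
      ∃ Y : Plane × Plane → ℝ → (Plane × Plane →L[ℝ] Plane × Plane), ∀ z ∈ Metric.ball z0 r,
      Φ z 0 = z ∧ Y z 0 = ContinuousLinearMap.id ℝ _ ∧ ∀ t ∈ Ioo (-ε) ε, (Φ z t).1 ∈ e.target ∧
        HasDerivAt (Φ z) (spray (metricMatrix e) (Φ z t)) t ∧
        HasDerivAt (Y z) (fderiv ℝ (spray (metricMatrix e)) (Φ z t) ∘L Y z t) t ∧
        (0 ≤ t → HasStrictFDerivAt (fun z' => Φ z' t) (Y z t) z) :=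
  exists_local_flow (V := spray (metricMatrix e)) (W := e.target ×ˢ univ)
    (((isMetricOn_metricMatrix he).spray_contDiffAt hz0).of_le (WithTop.coe_le_coe.2 le_top))
    ((e.open_target.prod isOpen_univ).mem_nhds ⟨hz0, mem_univ _⟩) |>.imp fun ε h => ⟨h.1, by
      obtain ⟨r, hr, Φ, Y, h⟩ := h.2
      exact ⟨r, hr, Φ, Y, fun z hz => ⟨(h z hz).1, (h z hz).2.1, fun t ht =>
        ⟨((h z hz).2.2 t ht).1.1, ((h z hz).2.2 t ht).2⟩⟩⟩⟩

end Speed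
end Surface

/-! ### Geodesic completeness and uniqueness of geodesics -/

namespace Surface

open scoped NNReal in
theorem _root_.LipschitzOnWith.exists_tendsto_left {X : Type*} [MetricSpace X] [CompleteSpace X]
    {f : ℝ → X} {K : ℝ≥0} {a b : ℝ} (hab : a < b) (h : LipschitzOnWith K f (Ioo a b)) :
    ∃ x, Tendsto f (𝓝[<] b) (𝓝 x) := by
  have hc : Cauchy (𝓝[<] b) := (cauchy_nhds (a := b)).mono nhdsWithin_le_nhds
  exact CompleteSpace.complete (hc.map_of_le h.uniformContinuousOn
    (le_principal_iff.2 (Ioo_mem_nhdsLT hab)))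

variable {M : Type*} [MetricSpace M] [ChartedSpace Plane M] [IsManifold (𝓡 2) ∞ M]
    [RiemannianBundle (fun x : M => TangentSpace (𝓡 2) x)]
    [IsContMDiffRiemannianBundle (𝓡 2) ∞ Plane (fun x : M => TangentSpace (𝓡 2) x)]

/-- The speed of a geodesic is a Lipschitz constant. -/
theorem lipschitzOnWith_geodesic [IsRiemannianManifold (𝓡 2) M] {γ : ℝ → M} {a b t0 : ℝ}
    (h : ∀ t ∈ Ioo a b, IsGeodesicAt γ t) (ht0 : t0 ∈ Ioo a b) :
    LipschitzOnWith ‖mfderiv 𝓘(ℝ, ℝ) (𝓡 2) γ t0 (1 : ℝ)‖₊ γ (Ioo a b) := by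
  have key : ∀ s ∈ Ioo a b, ∀ t ∈ Ioo a b, s ≤ t → edist (γ s) (γ t) ≤
      ‖mfderiv 𝓘(ℝ, ℝ) (𝓡 2) γ t0 (1 : ℝ)‖₊ * edist s t := by
    intro s hs t ht hst
    have hsub : ∀ r ∈ Icc s t, r ∈ Ioo a b := fun r hr => ⟨hs.1.trans_le hr.1, hr.2.trans_lt ht.2⟩
    have := edist_le_of_speed_le (γ := γ) (σ := ‖mfderiv 𝓘(ℝ, ℝ) (𝓡 2) γ t0 (1 : ℝ)‖ₑ) hst
      (fun r hr => by
        obtain ⟨e, he, hg⟩ := h r (hsub r hr)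
        exact hg.contMDiffAt he)
      (fun r hr => by
        have := speed_eq_of_geodesic h (hsub r hr) ht0
        rw [← ofReal_norm, this, ofReal_norm])
    rw [edist_comm s t, edist_dist t s, Real.dist_eq, abs_of_nonneg (sub_nonneg.2 hst)]
    exact this
  intro s hs t ht
  rcases le_total s t with hst | hst
  · exact key s hs t ht hst
  · rw [edist_comm, edist_comm s t]
    exact key t ht s hs hst

/-- On a complete surface a geodesic on a bounded interval can be continued. -/
theorem exists_geodesic_continuation [IsRiemannianManifold (𝓡 2) M] [CompleteSpace M] {γ : ℝ → M}
    {a b : ℝ} (ha : a < 0) (hb : 0 < b) (h : ∀ t ∈ Ioo a b, IsGeodesicAt γ t) :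
    ∃ t1 ∈ Ioo 0 b, ∃ c > b, ∃ η : ℝ → M, (∀ t ∈ Ico t1 c, IsGeodesicAt η t) ∧ η =ᶠ[𝓝 t1] γ := by
  obtain ⟨x, hx⟩ := (lipschitzOnWith_geodesic h ⟨ha, hb⟩).exists_tendsto_left (ha.trans hb)
  set e := chartAt Plane x with he'
  have he : e ∈ IsManifold.maximalAtlas (𝓡 2) ∞ M := IsManifold.chart_mem_maximalAtlas x
  have hxe : x ∈ e.source := mem_chart_source Plane x
  have hG := isMetricOn_metricMatrix he
  have hex : e x ∈ e.target := e.map_source hxe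
  set σ : ℝ := ‖mfderiv 𝓘(ℝ, ℝ) (𝓡 2) γ 0 (1 : ℝ)‖ with hσ
  -- the coordinate velocity stays bounded, because the speed is constant
  set q : Plane → ℝ := fun y => (metricMatrix e y 0 0 + metricMatrix e y 1 1) / (metricMatrix e y).det * σ ^ 2
    with hq
  have hqc : ContinuousAt q (e x) := by
    have hc := fun i j => (hG.contDiffAt hex i j).continuousAt
    have hdet : ContinuousAt (fun y => (metricMatrix e y).det) (e x) := by
      simp only [Matrix.det_fin_two]
      exact ((hc 0 0).mul (hc 1 1)).sub ((hc 0 1).mul (hc 1 0))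
    exact (((hc 0 0).add (hc 1 1)).div hdet (hG.det_pos hex).ne').mul continuousAt_const
  obtain ⟨ρ, hρ, hρ'⟩ := Metric.nhds_basis_closedBall.mem_iff.1
    (inter_mem (e.open_target.mem_nhds hex) (hqc.eventually_lt_const (lt_add_one (q (e x)))))
  set R : ℝ := Real.sqrt (q (e x) + 1) with hR
  set Kc : Set (Plane × Plane) := Metric.closedBall (e x) ρ ×ˢ Metric.closedBall 0 R with hKc
  have hcomp : IsCompact Kc := (isCompact_closedBall _ _).prod (isCompact_closedBall _ _)
  have htend : Tendsto (fun t => e (γ t)) (𝓝[<] b) (𝓝 (e x)) := (e.continuousAt hxe).tendsto.comp hx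
  have hin : ∀ᶠ t in 𝓝[<] b, t ∈ Ioo 0 b ∧ γ t ∈ e.source ∧ phase e γ t ∈ Kc := by
    filter_upwards [Ioo_mem_nhdsLT hb, hx (e.open_source.mem_nhds hxe),
      htend (Metric.closedBall_mem_nhds _ hρ)] with t ht hts htρ
    refine ⟨ht, hts, htρ, ?_⟩
    have hab : t ∈ Ioo a b := ⟨ha.trans ht.1, ht.2⟩
    have hgeo := (h t hab).isGeodesicIn he hts
    have h1 := hgeo.form_phase he
    rw [speed_eq_of_geodesic h hab ⟨ha, hb⟩, ← hσ] at h1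
    have hy : (phase e γ t).1 ∈ e.target := e.map_source hts
    have h2 := hG.norm_sq_le hy (phase e γ t).2
    rw [h1] at h2
    have h3 : ‖(phase e γ t).2‖ ^ 2 ≤ q (phase e γ t).1 := by
      rw [hq]
      simp only
      rw [div_mul_eq_mul_div, le_div_iff₀ (hG.det_pos hy)]
      linarith
    have h4 : q (phase e γ t).1 < q (e x) + 1 := (hρ' htρ).2
    rw [mem_closedBall_zero_iff, hR]
    exact Real.le_sqrt_of_sq_le (h3.trans h4.le)
  -- the phase accumulates at some `z`; the time of existence is bounded below near `z`, so that the
  -- flow started close enough to time `b` exists beyond `b`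
  obtain ⟨z, hzK, hz⟩ := hcomp.exists_mapClusterPt_of_frequently (hin.mono fun t ht => ht.2.2).frequently
  obtain ⟨ε, hε, r, hr, Φ, Y, hΦ⟩ := exists_geodesic_flow he (z0 := z) (hρ' hzK.1).1
  have hfr := (mapClusterPt_iff_frequently.1 hz) _ (Metric.ball_mem_nhds z hr)
  obtain ⟨t1, hball, ⟨ht1, hts, -⟩, ht1b⟩ := (hfr.and_eventually (hin.and
    (Ioo_mem_nhdsLT (show b - ε < b by linarith)))).exists
  have hfl := hΦ _ hball
  have hfl' : ∀ t ∈ Ioo (-ε) ε, (Φ (phase e γ t1) t).1 ∈ e.target ∧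
      HasDerivAt (Φ (phase e γ t1)) (spray (metricMatrix e) (Φ (phase e γ t1) t)) t :=
    fun t ht => ⟨(hfl.2.2 t ht).1, (hfl.2.2 t ht).2.1⟩
  refine ⟨t1, ht1, t1 + ε, by linarith [ht1b.1], fun s => e.symm (Φ (phase e γ t1) (s - t1)).1,
    fun t ht => ⟨e, he, (isGeodesicIn_flow hfl' ⟨by linarith [ht.1], ht.2⟩).1⟩, ?_⟩
  obtain ⟨g1, g2⟩ := isGeodesicIn_flow hfl' (t := t1) (t1 := t1) ⟨by linarith, by linarith⟩
  refine g1.eventuallyEq he ((h t1 ⟨ha.trans ht1.1, ht1.2⟩).isGeodesicIn he hts) ?_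
  rw [g2.self_of_nhds]
  dsimp only
  rw [sub_self, hfl.1]

/-- On a complete surface there is a geodesic ray with any given initial velocity. -/
theorem exists_geodesic [IsRiemannianManifold (𝓡 2) M] [CompleteSpace M]
    {e : OpenPartialHomeomorph M Plane} (he : e ∈ IsManifold.maximalAtlas (𝓡 2) ∞ M) {p : M}
    (hp : p ∈ e.source) (w : Plane) :
    ∃ γ : ℝ → M, (∃ a < 0, ∀ t > a, IsGeodesicAt γ t) ∧ γ 0 = p ∧ phase e γ 0 = (e p, w) := by
  obtain ⟨ε, hε, r, hr, Φ, Y, hΦ⟩ := exists_geodesic_flow he (z0 := (e p, w)) (e.map_source hp)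
  have hfl := hΦ _ (Metric.mem_ball_self hr)
  have hfl' : ∀ t ∈ Ioo (-ε) ε, (Φ (e p, w) t).1 ∈ e.target ∧
      HasDerivAt (Φ (e p, w)) (spray (metricMatrix e) (Φ (e p, w) t)) t :=
    fun t ht => ⟨(hfl.2.2 t ht).1, (hfl.2.2 t ht).2.1⟩
  have hg := fun t ht => isGeodesicIn_flow hfl' (t := t) (t1 := 0) ht
  simp only [zero_sub, zero_add] at hg
  obtain ⟨γ, h1, h2⟩ := exists_global_solution (Q := IsGeodesicAt (M := M)) (a := -ε) (b0 := ε)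
    (f0 := fun s => e.symm (Φ (e p, w) (s - 0)).1)
    (fun f g t hfg hf => hf.congr hfg) (fun _ _ _ hf hg hfr => hf.eventuallyEq_of_frequently hg hfr)
    (by linarith) hε (fun t ht => ⟨e, he, (hg t ht).1⟩)
    (fun f b hb hf _ => exists_geodesic_continuation (by linarith) hb hf)
  refine ⟨γ, ⟨-ε, by linarith, h1⟩, ?_, ?_⟩
  · rw [h2.self_of_nhds]
    dsimp only
    rw [sub_zero, hfl.1]
    exact e.left_inv hp
  have h3 : (fun s => e (γ s)) =ᶠ[𝓝 0] fun s => e (e.symm (Φ (e p, w) (s - 0)).1) := by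
    filter_upwards [h2] with s hs
    rw [hs]
  have h4 := (hg 0 ⟨by linarith, by linarith⟩).2.self_of_nhds
  dsimp only at h4
  rw [sub_zero, hfl.1] at h4
  rw [← h4]
  exact Prod.ext h3.self_of_nhds h3.deriv_eq

/-- Geodesics with the same position and velocity at one time coincide. -/
theorem geodesic_unique {e : OpenPartialHomeomorph M Plane}
    (he : e ∈ IsManifold.maximalAtlas (𝓡 2) ∞ M) {γ γ' : ℝ → M} {a b t0 : ℝ}
    (h : ∀ t ∈ Ioo a b, IsGeodesicAt γ t) (h' : ∀ t ∈ Ioo a b, IsGeodesicAt γ' t) (ht0 : t0 ∈ Ioo a b)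
    (hs : γ t0 ∈ e.source) (hs' : γ' t0 ∈ e.source) (heq : phase e γ t0 = phase e γ' t0) :
    ∀ t ∈ Ioo a b, γ =ᶠ[𝓝 t] γ' :=
  eventuallyEq_of_local_uniqueness (Q := IsGeodesicAt (M := M))
    (fun _ _ _ hf hg hfr => hf.eventuallyEq_of_frequently hg hfr) isPreconnected_Ioo h h' ht0
    (((h t0 ht0).isGeodesicIn he hs).eventuallyEq he ((h' t0 ht0).isGeodesicIn he hs') heq)

end Surface

/-! ### Families of geodesics from a point -/

namespace Surface

section SqrtConvex

/-- If `√h` is convex on `[0, ∞)` and `h(t) ~ c t²` at zero, then `c ≤ h(1)`. Convexity of `√h` is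
expressed by the inequality `h'² ≤ 2 h h''`, which makes sense at the zeros of `h` too. -/
theorem le_of_sqrt_convex {h h1 h2 : ℝ → ℝ} {c : ℝ} (h0 : ∀ t, 0 ≤ h t) (hz : h 0 = 0)
    (hd : ∀ t > 0, HasDerivAt h (h1 t) t) (hd2 : ∀ t > 0, HasDerivAt h1 (h2 t) t)
    (hpos : ∀ t > 0, 0 ≤ h2 t) (hq : ∀ t > 0, h1 t ^ 2 ≤ 2 * h t * h2 t)
    (hlim : Tendsto (fun t => h t / t ^ 2) (𝓝[>] 0) (𝓝 c)) : c ≤ h 1 := by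
  have hc0 : ContinuousWithinAt h (Ici 0) 0 := by
    rw [← continuousWithinAt_Ioi_iff_Ici, ContinuousWithinAt, hz]
    have h3 : Tendsto (fun t : ℝ => h t / t ^ 2 * t ^ 2) (𝓝[>] 0) (𝓝 (c * 0 ^ 2)) :=
      hlim.mul ((continuous_pow 2).tendsto' 0 _ rfl |>.mono_left nhdsWithin_le_nhds)
    rw [zero_pow two_ne_zero, mul_zero] at h3
    refine h3.congr' ?_
    filter_upwards [self_mem_nhdsWithin] with t ht
    have : t ≠ 0 := (mem_Ioi.1 ht).ne'
    field_simp
  have hcont : ContinuousOn h (Ici 0) := by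
    intro t ht
    rcases eq_or_lt_of_le (mem_Ici.1 ht) with rfl | ht
    · exact hc0
    · exact (hd t ht).continuousAt.continuousWithinAt
  -- `√(h + η)` is twice differentiable on `(0, ∞)` and convex
  have hη : ∀ η > 0, ∀ t ∈ Icc (0 : ℝ) 1, √(h t + η) ≤ (1 - t) * √η + t * √(h 1 + η) := by
    intro η hη t ht
    have hp : ∀ t, 0 < h t + η := fun t => by linarith [h0 t]
    have d1 : ∀ t > 0, HasDerivAt (fun t => √(h t + η)) (h1 t / (2 * √(h t + η))) t := fun t ht =>
      ((hd t ht).add_const η).sqrt (hp t).ne'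
    have d2 : ∀ t > 0, HasDerivAt (fun t => h1 t / (2 * √(h t + η)))
        ((h2 t * (2 * √(h t + η)) - h1 t * (2 * (h1 t / (2 * √(h t + η))))) / (2 * √(h t + η)) ^ 2) t :=
      fun t ht => (hd2 t ht).div ((d1 t ht).const_mul 2) (by have := Real.sqrt_pos.2 (hp t); positivity)
    have hev : ∀ t > 0, deriv (fun t => √(h t + η)) =ᶠ[𝓝 t] fun t => h1 t / (2 * √(h t + η)) := by
      intro t ht
      filter_upwards [Ioi_mem_nhds ht] with s hs using (d1 s hs).deriv
    have hconv : ConvexOn ℝ (Ici 0) fun t => √(h t + η) := by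
      refine convexOn_of_deriv2_nonneg (convex_Ici 0)
        (Real.continuous_sqrt.comp_continuousOn (hcont.add continuousOn_const)) ?_ ?_ ?_
      · rw [interior_Ici]
        exact fun t ht => (d1 t ht).differentiableAt.differentiableWithinAt
      · rw [interior_Ici]
        exact fun t ht => ((d2 t ht).congr_of_eventuallyEq
          (hev t ht)).differentiableAt.differentiableWithinAt
      · rw [interior_Ici]
        intro t ht
        rw [show deriv^[2] (fun t => √(h t + η)) t = deriv (deriv fun t => √(h t + η)) t from rfl,
          ((d2 t ht).congr_of_eventuallyEq (hev t ht)).deriv]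
        have hs := Real.sqrt_pos.2 (hp t)
        have hsq := Real.sq_sqrt (hp t).le
        refine div_nonneg ?_ (sq_nonneg _)
        have : h2 t * (2 * √(h t + η)) - h1 t * (2 * (h1 t / (2 * √(h t + η)))) =
            (2 * (√(h t + η)) ^ 2 * h2 t - h1 t ^ 2) / √(h t + η) := by
          field_simp
        rw [this, hsq]
        refine div_nonneg ?_ hs.le
        nlinarith [hq t ht, mul_nonneg hη.le (hpos t ht)]
    have := hconv.2 (mem_Ici.2 le_rfl) (mem_Ici.2 zero_le_one) (sub_nonneg.2 ht.2) ht.1 (by ring)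
    simpa [hz] using this
  have hlin : ∀ t ∈ Icc (0 : ℝ) 1, √(h t) ≤ t * √(h 1) := by
    intro t ht
    have l1 : Tendsto (fun η => √(h t + η)) (𝓝[>] 0) (𝓝 √(h t + 0)) :=
      (Real.continuous_sqrt.comp (continuous_const.add continuous_id)).continuousAt.tendsto.mono_left
        nhdsWithin_le_nhds
    have l2 : Tendsto (fun η => (1 - t) * √η + t * √(h 1 + η)) (𝓝[>] 0)
        (𝓝 ((1 - t) * √0 + t * √(h 1 + 0))) :=
      ((continuous_const.mul Real.continuous_sqrt).add (continuous_const.mul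
        (Real.continuous_sqrt.comp (continuous_const.add continuous_id)))).continuousAt.tendsto.mono_left
        nhdsWithin_le_nhds
    have := le_of_tendsto_of_tendsto l1 l2
      (by filter_upwards [self_mem_nhdsWithin] with η hp using hη η hp t ht)
    simpa using this
  refine le_of_tendsto hlim ?_
  filter_upwards [Ioo_mem_nhdsGT zero_lt_one] with t ht
  have := hlin t ⟨ht.1.le, ht.2.le⟩
  rw [div_le_iff₀ (by have := ht.1; positivity)]
  have h3 := pow_le_pow_left₀ (Real.sqrt_nonneg _) this 2
  rw [mul_pow, Real.sq_sqrt (h0 t), Real.sq_sqrt (h0 1)] at h3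
  linarith

end SqrtConvex

variable {M : Type*} [MetricSpace M] [ChartedSpace Plane M]
    [RiemannianBundle (fun x : M => TangentSpace (𝓡 2) x)]

/-- The geodesics `γ w` emanate from `p` with initial velocity `w`, expressed in the chart `e₀`. Thus
`w ↦ γ w 1` is the exponential map of `p`. -/
structure IsGeodesicFamily (e₀ : OpenPartialHomeomorph M Plane) (p : M) (γ : Plane → ℝ → M) : Prop where
  chart : e₀ ∈ IsManifold.maximalAtlas (𝓡 2) ∞ M
  mem_source : p ∈ e₀.source
  geodesic : ∀ w, ∃ a < 0, ∀ t > a, IsGeodesicAt (γ w) t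
  zero : ∀ w, γ w 0 = p
  phase_zero : ∀ w, phase e₀ (γ w) 0 = (e₀ p, w)

/-- At time `t`, position and velocity of the curves `γ w` in the chart `e` have the strict derivative
`D` with respect to `w` at `w₀`. As charts have junk values outside of their domain, the positions are
required to lie in the domain of `e` for all `w` near `w₀`. -/
def HasPhaseDerivIn (e : OpenPartialHomeomorph M Plane) (γ : Plane → ℝ → M) (w₀ : Plane) (t : ℝ)
    (D : Plane →L[ℝ] Plane × Plane) : Prop :=
  γ w₀ t ∈ e.source ∧ (∀ᶠ w in 𝓝 w₀, γ w t ∈ e.source) ∧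
    HasStrictFDerivAt (fun w => phase e (γ w) t) D w₀

theorem exists_isGeodesicFamily [IsManifold (𝓡 2) ∞ M]
    [IsContMDiffRiemannianBundle (𝓡 2) ∞ Plane (fun x : M => TangentSpace (𝓡 2) x)]
    [IsRiemannianManifold (𝓡 2) M] [CompleteSpace M]
    {e : OpenPartialHomeomorph M Plane} (he : e ∈ IsManifold.maximalAtlas (𝓡 2) ∞ M) {p : M}
    (hp : p ∈ e.source) : ∃ γ, IsGeodesicFamily e p γ := by
  choose γ h1 h2 h3 using exists_geodesic he hp
  exact ⟨γ, he, hp, h1, h2, h3⟩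

namespace IsGeodesicFamily

variable {e₀ : OpenPartialHomeomorph M Plane} {p : M} {γ : Plane → ℝ → M}

theorem hasPhaseDerivIn_zero (hγ : IsGeodesicFamily e₀ p γ) (w₀ : Plane) :
    HasPhaseDerivIn e₀ γ w₀ 0 (ContinuousLinearMap.inr ℝ Plane Plane) := by
  refine ⟨by rw [hγ.zero]; exact hγ.mem_source,
    Eventually.of_forall fun w => by rw [hγ.zero]; exact hγ.mem_source, ?_⟩
  simp only [hγ.phase_zero]
  exact (hasStrictFDerivAt_const (e₀ p) w₀).prodMk (hasStrictFDerivAt_id w₀)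

theorem isGeodesicAt (hγ : IsGeodesicFamily e₀ p γ) (w : Plane) {t : ℝ} (ht : 0 ≤ t) :
    IsGeodesicAt (γ w) t := by
  obtain ⟨a, ha, h⟩ := hγ.geodesic w
  exact h t (ha.trans_le ht)

variable [IsManifold (𝓡 2) ∞ M]
    [IsContMDiffRiemannianBundle (𝓡 2) ∞ Plane (fun x : M => TangentSpace (𝓡 2) x)]

theorem hasPhaseDerivIn_change (hγ : IsGeodesicFamily e₀ p γ) {e e' : OpenPartialHomeomorph M Plane}
    (he : e ∈ IsManifold.maximalAtlas (𝓡 2) ∞ M) (he' : e' ∈ IsManifold.maximalAtlas (𝓡 2) ∞ M)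
    {w₀ : Plane} {t : ℝ} (ht : 0 ≤ t) {D : Plane →L[ℝ] Plane × Plane}
    (h : HasPhaseDerivIn e γ w₀ t D) (hs : γ w₀ t ∈ e'.source) :
    ∃ D', HasPhaseDerivIn e' γ w₀ t D' := by
  obtain ⟨h1, h2, h3⟩ := h
  have hx : (phase e (γ w₀) t).1 ∈ e.target := e.map_source h1
  have hl : e.symm (phase e (γ w₀) t).1 = γ w₀ t := e.left_inv h1
  have hx' : e.symm (phase e (γ w₀) t).1 ∈ e'.source := by rw [hl]; exact hs
  have hev : ∀ᶠ w in 𝓝 w₀, γ w t ∈ e'.source := by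
    have hc : ContinuousAt (fun w => e.symm (phase e (γ w) t).1) w₀ :=
      ContinuousAt.comp (f := fun w => (phase e (γ w) t).1) (e.continuousAt_symm hx)
        h3.continuousAt.fst
    filter_upwards [h2, hc.preimage_mem_nhds (e'.open_source.mem_nhds hx')] with w hw hw'
    rw [← e.left_inv hw]
    exact hw'
  have hφ : ContDiffAt ℝ 2 (e' ∘ e.symm) _ := (transition_contDiffAt he he' hx hx').of_le
    (WithTop.coe_le_coe.2 le_top)
  refine ⟨_, hs, hev, HasStrictFDerivAt.congr_of_eventuallyEq
    (((tmap_contDiffAt hφ).hasStrictFDerivAt one_ne_zero).comp w₀ h3) ?_⟩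
  filter_upwards [h2, hev] with w hw hw'
  exact ((((hγ.isGeodesicAt w ht).isGeodesicIn he hw).change he he' hw').2.self_of_nhds).symm

/-- Propagation of differentiability along the geodesics: the derivative `Z` of the family solves the
linearized geodesic equation. -/
theorem exists_hasPhaseDerivIn (hγ : IsGeodesicFamily e₀ p γ) {e : OpenPartialHomeomorph M Plane}
    (he : e ∈ IsManifold.maximalAtlas (𝓡 2) ∞ M) {w₀ : Plane} {t₀ : ℝ} (ht₀ : 0 ≤ t₀)
    (hs : γ w₀ t₀ ∈ e.source) : ∃ δ > 0, ∀ t₁ ∈ Ioc (t₀ - δ) t₀, 0 ≤ t₁ →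
      ∀ e' ∈ IsManifold.maximalAtlas (𝓡 2) ∞ M, ∀ D, HasPhaseDerivIn e' γ w₀ t₁ D →
      ∃ Z : ℝ → (Plane →L[ℝ] Plane × Plane), ∀ t ∈ Ico t₁ (t₀ + δ), HasPhaseDerivIn e γ w₀ t (Z t) ∧
        HasDerivAt (phase e (γ w₀)) (spray (metricMatrix e) (phase e (γ w₀) t)) t ∧
        HasDerivAt Z (fderiv ℝ (spray (metricMatrix e)) (phase e (γ w₀) t) ∘L Z t) t := by
  have hgeo := (hγ.isGeodesicAt w₀ ht₀).isGeodesicIn he hs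
  obtain ⟨ε, hε, r, hr, Φ, Y, hΦ⟩ := exists_geodesic_flow he (z0 := phase e (γ w₀) t₀) (e.map_source hs)
  obtain ⟨δ, hδ, hδ'⟩ := Metric.eventually_nhds_iff_ball.1 (hgeo.and
    (hgeo.self_of_nhds.2.continuousAt.preimage_mem_nhds (Metric.ball_mem_nhds _ hr)))
  refine ⟨min δ (ε / 2), by positivity, fun t₁ ht₁ h0 e' he' D' hD' => ?_⟩
  have hm1 := min_le_left δ (ε / 2)
  have hm2 := min_le_right δ (ε / 2)
  have hb : t₁ ∈ Metric.ball t₀ δ := by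
    rw [Metric.mem_ball, Real.dist_eq, abs_lt]
    constructor <;> linarith [ht₁.1, ht₁.2]
  obtain ⟨D, hD⟩ := hγ.hasPhaseDerivIn_change he' he h0 hD' (hδ' t₁ hb).1.1
  have hball : ∀ᶠ w in 𝓝 w₀, phase e (γ w) t₁ ∈ Metric.ball (phase e (γ w₀) t₀) r :=
    hD.2.2.continuousAt.preimage_mem_nhds (Metric.isOpen_ball.mem_nhds (hδ' t₁ hb).2)
  -- nearby geodesics of the family are given by the local flow
  have key : ∀ w, γ w t₁ ∈ e.source → phase e (γ w) t₁ ∈ Metric.ball (phase e (γ w₀) t₀) r →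
      ∀ t ∈ Ico t₁ (t₁ + ε), γ w t ∈ e.source ∧
        phase e (γ w) =ᶠ[𝓝 t] fun s => Φ (phase e (γ w) t₁) (s - t₁) := by
    intro w hws hwb t ht
    obtain ⟨a, ha, hga⟩ := hγ.geodesic w
    have hfl := hΦ _ hwb
    have hfl' : ∀ t ∈ Ioo (-ε) ε, (Φ (phase e (γ w) t₁) t).1 ∈ e.target ∧
        HasDerivAt (Φ (phase e (γ w) t₁)) (spray (metricMatrix e) (Φ (phase e (γ w) t₁) t)) t :=
      fun t ht => ⟨(hfl.2.2 t ht).1, (hfl.2.2 t ht).2.1⟩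
    have hflow := fun s hs => isGeodesicIn_flow hfl' (t1 := t₁) (t := s) hs
    have ht₁mem : t₁ ∈ Ioo (t₁ - ε) (t₁ + ε) := ⟨by linarith, by linarith⟩
    have hmem : ∀ s ∈ Ico t₁ (t₁ + ε), s ∈ Ioo (max a (t₁ - ε)) (t₁ + ε) := fun s hs =>
      ⟨max_lt (by linarith [hs.1]) (by linarith [hs.1]), hs.2⟩
    have heq := geodesic_unique he (γ := γ w) (γ' := fun s => e.symm (Φ (phase e (γ w) t₁) (s - t₁)).1)
      (a := max a (t₁ - ε)) (b := t₁ + ε) (t0 := t₁)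
      (fun s hs => hga s ((le_max_left _ _).trans_lt hs.1))
      (fun s hs => ⟨e, he, (hflow s ⟨(le_max_right _ _).trans_lt hs.1, hs.2⟩).1⟩)
      (hmem t₁ ⟨le_rfl, by linarith⟩) hws (hflow t₁ ht₁mem).1.self_of_nhds.1
      (by rw [(hflow t₁ ht₁mem).2.self_of_nhds]; dsimp only; rw [sub_self, hfl.1]) t (hmem t ht)
    have hft := hflow t ⟨by linarith [ht.1], ht.2⟩
    refine ⟨by rw [heq.self_of_nhds]; exact hft.1.self_of_nhds.1, ?_⟩
    refine EventuallyEq.trans ?_ hft.2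
    filter_upwards [heq.eventually_nhds] with s hs'
    have h1 : (fun s => e (γ w s)) =ᶠ[𝓝 s] fun s => e (e.symm (Φ (phase e (γ w) t₁) (s - t₁)).1) := by
      filter_upwards [hs'] with q hq
      rw [hq]
    exact Prod.ext h1.self_of_nhds h1.deriv_eq
  have hfl₀ := hΦ _ hball.self_of_nhds
  refine ⟨fun t => Y (phase e (γ w₀) t₁) (t - t₁) ∘L D, fun t ht => ?_⟩
  have ht' : t ∈ Ico t₁ (t₁ + ε) := ⟨ht.1, by linarith [ht.2, ht₁.1]⟩
  have htt : t - t₁ ∈ Ioo (-ε) ε := ⟨by linarith [ht'.1], by linarith [ht'.2]⟩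
  obtain ⟨k1, k2⟩ := key w₀ hD.1 hball.self_of_nhds t ht'
  have k3 : phase e (γ w₀) t = Φ (phase e (γ w₀) t₁) (t - t₁) := k2.self_of_nhds
  obtain ⟨-, f2, f3, f4⟩ := hfl₀.2.2 _ htt
  refine ⟨⟨k1, ?_, ?_⟩, ?_, ?_⟩
  · filter_upwards [hD.2.1, hball] with w hw hw' using (key w hw hw' t ht').1
  · refine HasStrictFDerivAt.congr_of_eventuallyEq
      ((f4 (sub_nonneg.2 ht.1)).comp w₀ hD.2.2) ?_
    filter_upwards [hD.2.1, hball] with w hw hw'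
    exact ((key w hw hw' t ht').2.self_of_nhds).symm
  · rw [k3]
    exact (f2.comp_sub_const t t₁).congr_of_eventuallyEq k2
  · rw [k3]
    have h5 := (f3.comp_sub_const t t₁).clm_comp (hasDerivAt_const t D)
    simpa [ContinuousLinearMap.comp_assoc] using h5

/-- The geodesics of a family depend differentiably on the initial velocity, at all times `t ≥ 0`. -/
theorem exists_hasPhaseDerivIn_chart (hγ : IsGeodesicFamily e₀ p γ) (w₀ : Plane) {t : ℝ} (ht : 0 ≤ t) :
    ∃ e ∈ IsManifold.maximalAtlas (𝓡 2) ∞ M, ∃ D, HasPhaseDerivIn e γ w₀ t D := by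
  set R : ℝ → Prop := fun t => ∃ e ∈ IsManifold.maximalAtlas (𝓡 2) ∞ M, ∃ D, HasPhaseDerivIn e γ w₀ t D
    with hR
  have hR0 : R 0 := ⟨e₀, hγ.chart, _, hγ.hasPhaseDerivIn_zero w₀⟩
  -- `[0, ∞)` is contained in the open set `u` by connectedness
  set u : Set ℝ := {t | ∃ b > t, ∀ s ∈ Ico 0 b, R s} with hu
  have hopen : IsOpen u := by
    refine isOpen_iff_mem_nhds.2 ?_
    rintro t ⟨b, hb, h⟩
    filter_upwards [Iio_mem_nhds hb] with s hs using ⟨b, hs, h⟩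
  have hstep : ∀ t ≥ 0, t ∈ closure u → t ∈ u := by
    intro t ht htc
    obtain ⟨δ, hδ, h⟩ := hγ.exists_hasPhaseDerivIn (e := chartAt Plane (γ w₀ t))
      (IsManifold.chart_mem_maximalAtlas _) (w₀ := w₀) ht (mem_chart_source Plane _)
    obtain ⟨t', ⟨b, hb, hb'⟩, htt'⟩ := Metric.mem_closure_iff.1 htc δ hδ
    rw [Real.dist_eq, abs_lt] at htt'
    rcases le_or_gt t t' with hle | hlt
    · exact ⟨b, hle.trans_lt hb, hb'⟩
    · have h1 : R (max t' 0) := by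
        rcases le_total t' 0 with h' | h'
        · rw [max_eq_right h']
          exact hR0
        · rw [max_eq_left h']
          exact hb' t' ⟨h', hb⟩
      obtain ⟨e', he', D, hD⟩ := h1
      obtain ⟨Z, hZ⟩ := h (max t' 0) ⟨lt_max_of_lt_left (by linarith), max_le hlt.le ht⟩
        (le_max_right _ _) e' he' D hD
      refine ⟨t + δ, by linarith, fun s hs => ?_⟩
      rcases lt_or_ge s b with hsb | hsb
      · exact hb' s ⟨hs.1, hsb⟩
      · exact ⟨_, IsManifold.chart_mem_maximalAtlas _, _,
          (hZ s ⟨max_le (hb.le.trans hsb) hs.1, hs.2⟩).1⟩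
  have hsub : Ici (0 : ℝ) ⊆ u := by
    refine isPreconnected_Ici.subset_of_closure_inter_subset hopen ⟨0, mem_Ici.2 le_rfl, ?_⟩
      fun t ht => hstep t ht.2 ht.1
    -- negative times belong to `u` for trivial reasons, so that `0` is in its closure
    have hneg : Iio 0 ⊆ u := fun t ht => ⟨0, ht, by simp⟩
    refine hstep 0 le_rfl (closure_mono hneg ?_)
    rw [closure_Iio]
    exact mem_Iic.2 le_rfl
  obtain ⟨b, hb, h⟩ := hsub ht
  exact h t ⟨ht, hb⟩

end IsGeodesicFamily
end Surface

/-! ### Jacobi fields in negative curvature -/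

namespace Surface

theorem form_smul (G : Plane → Matrix (Fin 2) (Fin 2) ℝ) (y : Plane) (a : ℝ) (u : Plane) :
    form G y (a • u) (a • u) = a ^ 2 * form G y u u := by
  simp only [form, Fin.sum_univ_two, PiLp.smul_apply, smul_eq_mul]
  ring

theorem IsMetricOn.tendsto_form {G : Plane → Matrix (Fin 2) (Fin 2) ℝ} {U : Set Plane}
    (hG : IsMetricOn G U) {X : Type*} {l : Filter X} {x u : X → Plane} {x₀ u₀ : Plane} (hx₀ : x₀ ∈ U)
    (hx : Tendsto x l (𝓝 x₀)) (hu : Tendsto u l (𝓝 u₀)) :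
    Tendsto (fun t => form G (x t) (u t) (u t)) l (𝓝 (form G x₀ u₀ u₀)) := by
  have hu' : ∀ i, Tendsto (fun t => u t i) l (𝓝 (u₀ i)) := fun i =>
    ((EuclideanSpace.proj i : Plane →L[ℝ] ℝ).continuous.tendsto u₀).comp hu
  exact tendsto_finsetSum _ fun i _ => tendsto_finsetSum _ fun j _ =>
    (((hG.contDiffAt hx₀ i j).continuousAt.tendsto.comp hx).mul (hu' i)).mul (hu' j)

variable {M : Type*} [MetricSpace M] [ChartedSpace Plane M]
    [RiemannianBundle (fun x : M => TangentSpace (𝓡 2) x)]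

/-- The norm of the Jacobi field `t ↦ ∂γ(w, t)/∂w (u)` in a chart. -/
theorem HasPhaseDerivIn.form_eq {e : OpenPartialHomeomorph M Plane}
    (he : e ∈ IsManifold.maximalAtlas (𝓡 2) ∞ M) {γ : Plane → ℝ → M} {w₀ : Plane} {t : ℝ}
    {D : Plane →L[ℝ] Plane × Plane} (h : HasPhaseDerivIn e γ w₀ t D) (u : Plane) :
    form (metricMatrix e) (phase e (γ w₀) t).1 (D u).1 (D u).1 =
      ‖mfderiv 𝓘(ℝ, Plane) (𝓡 2) (fun w => γ w t) w₀ u‖ ^ 2 :=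
  form_metricMatrix_self he
    (D := ContinuousLinearMap.fst ℝ Plane Plane ∘L D) (z := fun w => (phase e (γ w) t).1)
    ((ContinuousLinearMap.fst ℝ Plane Plane).hasFDerivAt.comp w₀ h.2.2.hasFDerivAt)
    (e.map_source h.1) (f := fun w => γ w t)
    (by filter_upwards [h.2.1] with w hw using (e.left_inv hw).symm) u

namespace IsGeodesicFamily

variable {e₀ : OpenPartialHomeomorph M Plane} {p : M} {γ : Plane → ℝ → M}
variable [IsManifold (𝓡 2) ∞ M]
    [IsContMDiffRiemannianBundle (𝓡 2) ∞ Plane (fun x : M => TangentSpace (𝓡 2) x)]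

/-- In negative curvature the square norm `h` of a Jacobi field satisfies `h'² ≤ 2 h h''`, as follows
from the Jacobi equation and the Cauchy-Schwarz inequality. -/
theorem jacobi_ineq (hγ : IsGeodesicFamily e₀ p γ) (hM : NegativelyCurved M) (w₀ u : Plane) {t : ℝ}
    (ht : 0 < t) {h : ℝ → ℝ}
    (hh : ∀ s, h s = ‖mfderiv 𝓘(ℝ, Plane) (𝓡 2) (fun w => γ w s) w₀ u‖ ^ 2) :
    HasDerivAt h (deriv h t) t ∧ HasDerivAt (deriv h) (deriv (deriv h) t) t ∧
      0 ≤ deriv (deriv h) t ∧ deriv h t ^ 2 ≤ 2 * h t * deriv (deriv h) t := by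
  set e := chartAt Plane (γ w₀ t) with he'
  have he : e ∈ IsManifold.maximalAtlas (𝓡 2) ∞ M := IsManifold.chart_mem_maximalAtlas _
  have hs : γ w₀ t ∈ e.source := mem_chart_source Plane _
  have hG := isMetricOn_metricMatrix he
  obtain ⟨δ, hδ, hstep⟩ := hγ.exists_hasPhaseDerivIn he ht.le hs
  obtain ⟨t₁, h1, h2⟩ := exists_between (max_lt (show t - δ < t by linarith) ht)
  have h10 : 0 ≤ t₁ := ((le_max_right _ _).trans_lt h1).le
  obtain ⟨e', he', D, hD⟩ := hγ.exists_hasPhaseDerivIn_chart w₀ h10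
  obtain ⟨Z, hZ⟩ := hstep t₁ ⟨(le_max_left _ _).trans_lt h1, h2.le⟩ h10 e' he' D hD
  set z := phase e (γ w₀)
  have hw : ∀ s ∈ Ico t₁ (t + δ), HasDerivAt (fun s => Z s u)
      (fderiv ℝ (spray (metricMatrix e)) (z s) (Z s u)) s := fun s hs => by
    simpa using (hZ s hs).2.2.clm_apply (hasDerivAt_const s u)
  have hmem : ∀ s ∈ Ico t₁ (t + δ), (z s).1 ∈ e.target := fun s hs => e.map_source (hZ s hs).1.1
  have hnhds : ∀ s ∈ Ioo t₁ (t + δ), ∀ᶠ r in 𝓝 s, r ∈ Ico t₁ (t + δ) := fun s hs =>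
    Filter.mem_of_superset (Ioo_mem_nhds hs.1 hs.2) Ioo_subset_Ico_self
  have d1 : ∀ s ∈ Ioo t₁ (t + δ), HasDerivAt h
      (2 * form (metricMatrix e) (z s).1 (covD (metricMatrix e) (z s) (Z s u)) (Z s u).1) s := by
    intro s hs
    have hs' := Ioo_subset_Ico_self hs
    refine (hG.hasDerivAt_form_self (hZ s hs').2.1 (hmem s hs') (hw s hs')).congr_of_eventuallyEq ?_
    filter_upwards [hnhds s hs] with r hr
    rw [hh, (hZ r hr).1.form_eq he]
  have htm : t ∈ Ioo t₁ (t + δ) := ⟨h2, by linarith⟩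
  have htm' := Ioo_subset_Ico_self htm
  have hev : deriv h =ᶠ[𝓝 t] fun s =>
      2 * form (metricMatrix e) (z s).1 (covD (metricMatrix e) (z s) (Z s u)) (Z s u).1 := by
    filter_upwards [Ioo_mem_nhds htm.1 htm.2] with s hs using (d1 s hs).deriv
  have d2 := ((hG.hasDerivAt_covD (hZ t htm').2.1 (hmem t htm') (hw t htm')).const_mul 2
    ).congr_of_eventuallyEq hev
  have hK : coordCurvature (metricMatrix e) (z t).1 < 0 := hM e he _ hs
  have hdet := hG.det_pos (hmem t htm')
  have hA := hG.form_nonneg (hmem t htm') (covD (metricMatrix e) (z t) (Z t u))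
  have hCS := hG.form_sq_le (hmem t htm') (covD (metricMatrix e) (z t) (Z t u)) (Z t u).1
  have hform := (hZ t htm').1.form_eq he u
  have hP : 0 ≤ -(coordCurvature (metricMatrix e) (z t).1 * (metricMatrix e (z t).1).det *
      ((z t).2 0 * (Z t u).1 1 - (z t).2 1 * (Z t u).1 0) ^ 2) := by
    rw [← neg_mul, ← neg_mul]
    exact mul_nonneg (mul_nonneg (by linarith) hdet.le) (sq_nonneg _)
  have hh0 : 0 ≤ h t := by rw [hh]; positivity
  rw [d2.deriv, (d1 t htm).deriv]
  refine ⟨d1 t htm, d2, by linarith, ?_⟩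
  rw [hform, ← hh] at hCS
  nlinarith [mul_nonneg hh0 hP]

/-- A Jacobi field with `J(0) = 0` and `J'(0) = u` has norm `‖u‖ t + o(t)`. -/
theorem tendsto_jacobi (hγ : IsGeodesicFamily e₀ p γ) (w₀ u : Plane) :
    Tendsto (fun t => ‖mfderiv 𝓘(ℝ, Plane) (𝓡 2) (fun w => γ w t) w₀ u‖ ^ 2 / t ^ 2) (𝓝[>] 0)
      (𝓝 (form (metricMatrix e₀) (e₀ p) u u)) := by
  have he := hγ.chart
  have hG := isMetricOn_metricMatrix he
  have hp0 : e₀ p ∈ e₀.target := e₀.map_source hγ.mem_source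
  obtain ⟨δ, hδ, hstep⟩ := hγ.exists_hasPhaseDerivIn he (w₀ := w₀) le_rfl
    (by rw [hγ.zero]; exact hγ.mem_source)
  obtain ⟨Z, hZ⟩ := hstep 0 ⟨by linarith, le_rfl⟩ le_rfl e₀ he _ (hγ.hasPhaseDerivIn_zero w₀)
  have h0 := hZ 0 ⟨le_rfl, by linarith⟩
  have hZ0 : Z 0 = ContinuousLinearMap.inr ℝ Plane Plane :=
    h0.1.2.2.hasFDerivAt.unique (hγ.hasPhaseDerivIn_zero w₀).2.2.hasFDerivAt
  have hJ : HasDerivAt (fun t => (Z t u).1) u 0 := by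
    have h1 := h0.2.2.clm_apply (hasDerivAt_const (0 : ℝ) u)
    have h2 := (ContinuousLinearMap.fst ℝ Plane Plane).hasFDerivAt.comp_hasDerivAt (0 : ℝ) h1
    refine h2.congr_deriv ?_
    simp [hG.fderiv_spray (z := phase e₀ (γ w₀) 0) (e₀.map_source h0.1.1), hZ0]
  have hslope : Tendsto (fun t : ℝ => t⁻¹ • (Z t u).1) (𝓝[>] 0) (𝓝 u) := by
    have := (hasDerivAt_iff_tendsto_slope_zero.1 hJ).mono_left
      (nhdsWithin_mono (0 : ℝ) (show Ioi (0 : ℝ) ⊆ {0}ᶜ from fun t ht => ne_of_gt ht))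
    simpa [hZ0] using this
  have hx : Tendsto (fun t => (phase e₀ (γ w₀) t).1) (𝓝[>] 0) (𝓝 (e₀ p)) := by
    have := h0.2.1.continuousAt.fst.tendsto.mono_left (nhdsWithin_le_nhds (s := Ioi (0 : ℝ)))
    rwa [hγ.phase_zero] at this
  refine (hG.tendsto_form hp0 hx hslope).congr' ?_
  filter_upwards [Ioo_mem_nhdsGT (show (0 : ℝ) < 0 + δ by linarith)] with t ht
  rw [form_smul, (hZ t ⟨ht.1.le, ht.2⟩).1.form_eq he]
  field_simp

/-- In negative curvature the exponential map does not decrease lengths. -/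
theorem form_le_norm_mfderiv (hγ : IsGeodesicFamily e₀ p γ) (hM : NegativelyCurved M) (w₀ u : Plane) :
    form (metricMatrix e₀) (e₀ p) u u ≤ ‖mfderiv 𝓘(ℝ, Plane) (𝓡 2) (fun w => γ w 1) w₀ u‖ ^ 2 := by
  have hj := fun t (ht : 0 < t) => hγ.jacobi_ineq hM w₀ u ht
    (h := fun s => ‖mfderiv 𝓘(ℝ, Plane) (𝓡 2) (fun w => γ w s) w₀ u‖ ^ 2) fun _ => rfl
  refine le_of_sqrt_convex (h := fun s => ‖mfderiv 𝓘(ℝ, Plane) (𝓡 2) (fun w => γ w s) w₀ u‖ ^ 2)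
    (fun _ => sq_nonneg _) ?_ (fun t ht => (hj t ht).1) (fun t ht => (hj t ht).2.1)
    (fun t ht => (hj t ht).2.2.1) (fun t ht => (hj t ht).2.2.2) (hγ.tendsto_jacobi w₀ u)
  have := (hγ.hasPhaseDerivIn_zero w₀).form_eq hγ.chart u
  exact this.symm.trans (by simp [form])

end IsGeodesicFamily
end Surface

/-! ### Path lifting through expanding local diffeomorphisms -/

namespace Surface

section Topology

open unitInterval

/-- A map lifts paths if each point of the base has a neighbourhood over which there is a continuous
section through any given point. -/
theorem exists_path_lift_of_sections {E X : Type*} [TopologicalSpace E] [TopologicalSpace X] {F : E → X}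
    (hF : ∀ x, ∃ V ∈ 𝓝 x, ∀ w, F w ∈ V → ∃ s : X → E, ContinuousOn s V ∧ (∀ y ∈ V, F (s y) = y) ∧
      s (F w) = w) (c : C(I, X)) (w : E) (hw : F w = c 0) :
    ∃ Γ : C(I, E), Γ 0 = w ∧ ∀ t, F (Γ t) = c t := by
  choose V hV sec using hF
  obtain ⟨t, t_0, t_mono, ⟨n_max, h_max⟩, t_sub⟩ := exists_monotone_Icc_subset_open_cover_unitInterval
    (fun x => isOpen_interior.preimage (t := interior (V x)) c.continuous)
    fun t _ => mem_iUnion.2 ⟨c t, mem_interior_iff_mem_nhds.2 (hV _)⟩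
  suffices ∀ n, ∃ Γ : I → E, ContinuousOn Γ (Icc 0 (t n)) ∧ (∀ s ∈ Icc 0 (t n), F (Γ s) = c s) ∧
      Γ 0 = w by
    obtain ⟨Γ, h1, h2, h3⟩ := this n_max
    have huniv : Icc 0 (t n_max) = univ := by
      rw [h_max _ le_rfl, eq_univ_iff_forall]
      exact fun s => ⟨bot_le, le_top⟩
    rw [huniv] at h1 h2
    exact ⟨⟨Γ, continuousOn_univ.1 h1⟩, h3, fun s => h2 s (mem_univ s)⟩
  intro n
  induction n with
  | zero =>
    refine ⟨fun _ => w, continuousOn_const, fun s hs => ?_, rfl⟩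
    rw [t_0, Icc_self, mem_singleton_iff] at hs
    rw [hs, hw]
  | succ n ih =>
    obtain ⟨Γ, cont, lifts, Γ_0⟩ := ih
    obtain ⟨x, hx⟩ := t_sub n
    have hxV : ∀ s ∈ Icc (t n) (t (n + 1)), c s ∈ V x := fun s hs => interior_subset (hx hs)
    have htn : F (Γ (t n)) = c (t n) := lifts _ ⟨t_0 ▸ t_mono n.zero_le, le_rfl⟩
    obtain ⟨q, q1, q2, q3⟩ := sec x (Γ (t n)) (htn ▸ hxV _ ⟨le_rfl, t_mono n.le_succ⟩)
    refine ⟨fun s => if s ≤ t n then Γ s else q (c s), .if (fun s hs => ?_) (cont.mono fun s hs => ?_) ?_,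
      fun s hs => ?_, ?_⟩
    · cases frontier_Iic_subset _ hs.2
      rw [← htn, q3]
    · rw [closure_le_eq continuous_id' continuous_const] at hs
      exact ⟨hs.1.1, hs.2⟩
    · refine q1.comp c.continuous.continuousOn ?_
      simp_rw [not_le]
      intro s hs
      have h1 : t n ≤ s := closure_lt_subset_le (f := fun _ => t n) (g := fun s => s) continuous_const
        continuous_id' hs.2
      exact hxV s ⟨h1, hs.1.2⟩
    · dsimp only
      split_ifs with h
      exacts [lifts s ⟨hs.1, h⟩, q2 _ (hxV s ⟨(not_le.1 h).le, hs.2⟩)]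
    · dsimp only
      rwa [if_pos (t_0 ▸ t_mono n.zero_le)]

end Topology

variable {M : Type*} [MetricSpace M] [ChartedSpace Plane M]
    [RiemannianBundle (fun x : M => TangentSpace (𝓡 2) x)]

/-- The map `F` from the Euclidean plane to `M` is strictly differentiable with invertible derivative,
and `m ‖u‖² ≤ ‖dF u‖²`, where `m > 0`. These properties are expressed in charts of `M`, which may depend on the
point. -/
def IsExpanding (F : Plane → M) (m : ℝ) : Prop :=
  0 < m ∧ ∀ w, ∃ e ∈ IsManifold.maximalAtlas (𝓡 2) ∞ M, F w ∈ e.source ∧ (∀ᶠ w' in 𝓝 w, F w' ∈ e.source) ∧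
    ∃ D : Plane ≃L[ℝ] Plane, HasStrictFDerivAt (fun w => e (F w)) (D : Plane →L[ℝ] Plane) w ∧
      ∀ u, m * ‖u‖ ^ 2 ≤ form (metricMatrix e) (e (F w)) (D u) (D u)

namespace IsExpanding

variable {F : Plane → M} {m : ℝ}

theorem isLocalHomeomorph (hF : IsExpanding F m) : IsLocalHomeomorph F := by
  refine IsLocalHomeomorph.mk F fun w => ?_
  obtain ⟨e, -, hw, hev, D, hD, -⟩ := hF.2 w
  obtain ⟨o, ho, hoo, hwo⟩ := eventually_nhds_iff.1 hev
  refine ⟨((hD.toOpenPartialHomeomorph _).restrOpen o hoo).trans e.symm, ?_, ?_⟩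
  · simp [hD.mem_toOpenPartialHomeomorph_source, hwo, e.map_source hw]
  · intro x hx
    have hxo : x ∈ o := by
      simp at hx
      exact hx.1.2
    simp [e.left_inv (ho x hxo)]


/-- The velocity of the lift of a curve is bounded in terms of the speed of the curve. -/
theorem norm_deriv_lift_le (hF : IsExpanding F m) {e : OpenPartialHomeomorph M Plane}
    (he : e ∈ IsManifold.maximalAtlas (𝓡 2) ∞ M) {y : ℝ → Plane} {y' : Plane} {t : ℝ}
    (hy : HasDerivAt y y' t) (hmem : y t ∈ e.target) {f : ℝ → Plane} (hf : ContinuousAt f t)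
    (hlift : ∀ᶠ s in 𝓝 t, F (f s) = e.symm (y s)) :
    DifferentiableAt ℝ f t ∧ m * ‖deriv f t‖ ^ 2 ≤ form (metricMatrix e) (y t) y' y' := by
  obtain ⟨e', he', hw, hev, D, hD, hm⟩ := hF.2 (f t)
  have hx' : e.symm (y t) ∈ e'.source := by rw [← hlift.self_of_nhds]; exact hw
  have h1 : HasDerivAt (fun s => e' (e.symm (y s))) (fderiv ℝ (e' ∘ e.symm) (y t) y') t :=
    ((transition_contDiffAt he he' hmem hx').differentiableAt (by simp)).hasFDerivAt.comp_hasDerivAt t hy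
  have hval : e' (F (f t)) = e' (e.symm (y t)) := by rw [hlift.self_of_nhds]
  have h2 := hD.to_localInverse.hasFDerivAt
  rw [hval] at h2
  have h3 : HasDerivAt f (D.symm (fderiv ℝ (e' ∘ e.symm) (y t) y')) t := by
    refine (h2.comp_hasDerivAt t h1).congr_of_eventuallyEq ?_
    filter_upwards [hlift, hf.tendsto.eventually hD.eventually_left_inverse] with s hs hs'
    simp only [Function.comp]
    rw [← hs, hs']
  refine ⟨h3.differentiableAt, ?_⟩
  rw [h3.deriv]
  refine (hm _).trans_eq ?_
  have hc : ∀ᶠ s in 𝓝 t, e.symm (y s) ∈ e'.source :=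
    (ContinuousAt.comp (f := y) (e.continuousAt_symm hmem) hy.continuousAt).preimage_mem_nhds
      (e'.open_source.mem_nhds hx')
  have k1 := form_metricMatrix_self he' (f := fun s => e.symm (y s)) h1.hasFDerivAt
    (e'.map_source hx') (by filter_upwards [hc] with s hs using (e'.left_inv hs).symm) (1 : ℝ)
  have k2 := form_metricMatrix_self he (f := fun s => e.symm (y s)) hy.hasFDerivAt hmem
    (Eventually.of_forall fun _ => rfl) (1 : ℝ)
  rw [hval]
  simp only [ContinuousLinearEquiv.apply_symm_apply]
  simpa using k1.trans k2.symm

variable [IsManifold (𝓡 2) ∞ M]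
    [IsContMDiffRiemannianBundle (𝓡 2) ∞ Plane (fun x : M => TangentSpace (𝓡 2) x)]

/-- Differentiable curves lift through expanding maps: the lift has finite length, hence cannot leave
the complete plane in finite time. -/
theorem exists_lift_curve (hF : IsExpanding F m) {e : OpenPartialHomeomorph M Plane}
    (he : e ∈ IsManifold.maximalAtlas (𝓡 2) ∞ M) {y y' : ℝ → Plane}
    (hy : ∀ t, HasDerivAt y (y' t) t) (hy' : Continuous y') (hmem : ∀ t, y t ∈ e.target) {w : Plane}
    (hw : F w = e.symm (y 0)) :
    ∃ f : ℝ → Plane, (∀ t ≥ 0, ContinuousAt f t ∧ F (f t) = e.symm (y t)) ∧ f 0 = w := by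
  have hyc : Continuous y := continuous_iff_continuousAt.2 fun t => (hy t).continuousAt
  have hτ : Continuous fun t => e.symm (y t) := e.continuousOn_symm.comp_continuous hyc hmem
  have hloc := hF.isLocalHomeomorph
  -- local lifts through a given point
  have hlocal : ∀ t x, F x = e.symm (y t) → ∃ h : ℝ → Plane, h t = x ∧ ∀ᶠ s in 𝓝 t,
      ContinuousAt h s ∧ F (h s) = e.symm (y s) ∧
        ∀ f : ℝ → Plane, ContinuousAt f t → f t = x → (∀ᶠ s in 𝓝 t, F (f s) = e.symm (y s)) →
          f =ᶠ[𝓝 t] h := by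
    intro t x hx
    obtain ⟨φ, hxφ, hφ⟩ := hloc x
    have hxt : e.symm (y t) ∈ φ.target := by
      rw [← hx, hφ]
      exact φ.map_source hxφ
    refine ⟨fun s => φ.symm (e.symm (y s)), ?_, ?_⟩
    · dsimp only
      rw [← hx, hφ, φ.left_inv hxφ]
    · filter_upwards [hτ.continuousAt.preimage_mem_nhds (φ.open_target.mem_nhds hxt)] with s hs
      refine ⟨ContinuousAt.comp (f := fun s => e.symm (y s)) (φ.continuousAt_symm hs) hτ.continuousAt, ?_,
        fun f hf hfx hfl => ?_⟩
      · rw [hφ, φ.right_inv hs]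
      · filter_upwards [hfl, hf.preimage_mem_nhds (φ.open_source.mem_nhds (hfx ▸ hxφ))] with r hr hr'
        rw [← hr, hφ, φ.left_inv hr']
  set Q : (ℝ → Plane) → ℝ → Prop := fun f t => ∀ᶠ s in 𝓝 t, ContinuousAt f s ∧ F (f s) = e.symm (y s)
    with hQ
  have hQlift : ∀ {f t}, Q f t → ∀ᶠ s in 𝓝 t, F (f s) = e.symm (y s) := fun h => h.mono fun _ h => h.2
  have hcongr : ∀ f g t, f =ᶠ[𝓝 t] g → Q f t → Q g t := by
    intro f g t hfg hf
    filter_upwards [hf, hfg.eventually_nhds] with s hs hs'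
    exact ⟨hs.1.congr hs', by rw [← hs'.self_of_nhds]; exact hs.2⟩
  have huniq : ∀ f g t, Q f t → Q g t → (∃ᶠ s in 𝓝 t, f =ᶠ[𝓝 s] g) → f =ᶠ[𝓝 t] g := by
    intro f g t hf hg hfr
    have heq : f t = g t := tendsto_nhds_unique_of_frequently_eq hf.self_of_nhds.1 hg.self_of_nhds.1
      (hfr.mono fun s hs => hs.self_of_nhds)
    obtain ⟨h, -, hh⟩ := hlocal t (g t) hg.self_of_nhds.2
    exact (hh.self_of_nhds.2.2 f hf.self_of_nhds.1 heq (hQlift hf)).trans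
      (hh.self_of_nhds.2.2 g hg.self_of_nhds.1 rfl (hQlift hg)).symm
  obtain ⟨f0, hf0w, hf0⟩ := hlocal 0 w hw
  obtain ⟨b0, hb0, hb0'⟩ := Metric.eventually_nhds_iff_ball.1 hf0.eventually_nhds
  have hext : ∀ f b, 0 < b → (∀ t ∈ Ioo (-b0) b, Q f t) → f =ᶠ[𝓝 0] f0 →
      ∃ t1 ∈ Ioo 0 b, ∃ c > b, ∃ h, (∀ t ∈ Ico t1 c, Q h t) ∧ h =ᶠ[𝓝 t1] f := by
    intro f b hb hf _
    set q : ℝ → ℝ := fun t => form (metricMatrix e) (y t) (y' t) (y' t) with hq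
    have hqc : ContinuousAt q b := (isMetricOn_metricMatrix he).tendsto_form (hmem b)
      hyc.continuousAt hy'.continuousAt
    obtain ⟨δ, hδ, hδ'⟩ := Metric.eventually_nhds_iff_ball.1 (hqc.eventually_lt_const (lt_add_one (q b)))
    set C : ℝ := (q b + 1) / m with hC
    have hderiv : ∀ t ∈ Ioo (max (b - δ) 0) b, DifferentiableAt ℝ f t ∧ ‖deriv f t‖ ≤ √C := by
      intro t ht
      have hQt := hf t ⟨by linarith [(le_max_right _ _).trans_lt ht.1], ht.2⟩
      obtain ⟨h1, h2⟩ := hF.norm_deriv_lift_le he (hy t) (hmem t) hQt.self_of_nhds.1 (hQlift hQt)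
      refine ⟨h1, Real.le_sqrt_of_sq_le ?_⟩
      have h3 : q t < q b + 1 := hδ' t (by
        rw [Metric.mem_ball, Real.dist_eq, abs_lt]
        constructor <;> linarith [(le_max_left _ _).trans_lt ht.1, ht.2])
      rw [hC, le_div_iff₀ hF.1]
      linarith
    have hlip : LipschitzOnWith (√C).toNNReal f (Ioo (max (b - δ) 0) b) :=
      (convex_Ioo _ _).lipschitzOnWith_of_nnnorm_deriv_le (fun t ht => (hderiv t ht).1) fun t ht => by
        rw [← NNReal.coe_le_coe, Real.coe_toNNReal _ (Real.sqrt_nonneg _)]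
        exact (hderiv t ht).2
    have hmax : max (b - δ) 0 < b := max_lt (by linarith) hb
    -- completeness of the plane
    obtain ⟨x, hx⟩ := hlip.exists_tendsto_left hmax
    have hFx : F x = e.symm (y b) := by
      refine tendsto_nhds_unique ((hloc.continuous.tendsto x).comp hx)
        ((hτ.tendsto b).mono_left nhdsWithin_le_nhds |>.congr' ?_)
      filter_upwards [Ioo_mem_nhdsLT hb] with t ht
      exact (hf t ⟨by linarith [ht.1], ht.2⟩).self_of_nhds.2.symm
    obtain ⟨φ, hxφ, hφ⟩ := hloc x
    have hxt : e.symm (y b) ∈ φ.target := by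
      rw [← hFx, hφ]
      exact φ.map_source hxφ
    obtain ⟨η, hη, hη'⟩ := Metric.eventually_nhds_iff_ball.1
      (hτ.continuousAt.preimage_mem_nhds (φ.open_target.mem_nhds hxt))
    have hmem1 : max (b - η) 0 < b := max_lt (by linarith) hb
    obtain ⟨t1, ht1, ht1φ⟩ := Filter.nonempty_of_mem (inter_mem (Ioo_mem_nhdsLT hmem1)
      (hx (φ.open_source.mem_nhds hxφ)))
    have ht1' : t1 ∈ Ioo (-b0) b := ⟨by linarith [(le_max_right _ _).trans_lt ht1.1], ht1.2⟩
    refine ⟨t1, ⟨(le_max_right _ _).trans_lt ht1.1, ht1.2⟩, b + η, by linarith,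
      fun s => φ.symm (e.symm (y s)), fun t ht => ?_, ?_⟩
    · have htb : t ∈ Metric.ball b η := by
        rw [Metric.mem_ball, Real.dist_eq, abs_lt]
        constructor <;> linarith [(le_max_left _ _).trans_lt ht1.1, ht.1, ht.2]
      filter_upwards [Metric.isOpen_ball.mem_nhds htb] with s hs
      refine ⟨ContinuousAt.comp (f := fun s => e.symm (y s)) (φ.continuousAt_symm (hη' s hs))
        hτ.continuousAt, ?_⟩
      rw [hφ, φ.right_inv (hη' s hs)]
    · filter_upwards [hQlift (hf t1 ht1'), (hf t1 ht1').self_of_nhds.1.preimage_mem_nhds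
        (φ.open_source.mem_nhds ht1φ)] with s hs hs'
      rw [← hs, hφ, φ.left_inv hs']
  obtain ⟨f, hf, hff0⟩ := exists_global_solution hcongr huniq (a := -b0) (by linarith) hb0 (f0 := f0)
    (fun t ht => (hb0' t (by
      rw [Metric.mem_ball, Real.dist_eq, abs_lt]
      constructor <;> linarith [ht.1, ht.2])).mono fun s hs => ⟨hs.1, hs.2.1⟩) hext
  exact ⟨f, fun t ht => (hf t (by linarith)).self_of_nhds, hff0.self_of_nhds.trans hf0w⟩

open unitInterval in
/-- Sections of an expanding map over a coordinate ball, obtained by lifting the coordinate segments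
which start at a given point of the ball. -/
theorem exists_section (hF : IsExpanding F m) (x : M) :
    ∃ V ∈ 𝓝 x, ∀ w, F w ∈ V → ∃ s : M → Plane, ContinuousOn s V ∧ (∀ q ∈ V, F (s q) = q) ∧
      s (F w) = w := by
  classical
  set e := chartAt Plane x with he'
  have he : e ∈ IsManifold.maximalAtlas (𝓡 2) ∞ M := IsManifold.chart_mem_maximalAtlas _
  have hxe : x ∈ e.source := mem_chart_source Plane x
  obtain ⟨r, hr, hB⟩ := Metric.mem_nhds_iff.1 (e.open_target.mem_nhds (e.map_source hxe))
  set B := Metric.ball (e x) r with hBdef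
  have hloc := hF.isLocalHomeomorph
  refine ⟨e.source ∩ e ⁻¹' B, inter_mem (e.open_source.mem_nhds hxe)
    ((e.continuousAt hxe).preimage_mem_nhds (Metric.ball_mem_nhds _ hr)), fun w hw => ?_⟩
  set y₀ := e (F w) with hy₀
  -- a smooth reparametrization of the unit interval which is defined for all times
  set ρ : ℝ → ℝ := fun t => (1 - Real.cos (Real.pi * t)) / 2 with hρ
  have hρ01 : ∀ t, ρ t ∈ Icc (0 : ℝ) 1 := fun t => by
    simp only [hρ]
    constructor <;> linarith [Real.neg_one_le_cos (Real.pi * t), Real.cos_le_one (Real.pi * t)]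
  have hρd : ∀ t, HasDerivAt ρ (Real.sin (Real.pi * t) * Real.pi / 2) t := fun t => by
    have h1 : HasDerivAt (fun t => Real.pi * t) Real.pi t := by
      simpa using (hasDerivAt_id t).const_mul Real.pi
    refine ((h1.cos.const_sub 1).div_const 2).congr_deriv (by ring)
  have hρc : Continuous ρ := continuous_iff_continuousAt.2 fun t => (hρd t).continuousAt
  have hyB : ∀ b ∈ B, ∀ t, y₀ + ρ t • (b - y₀) ∈ B := fun b hb t =>
    (convex_ball (e x) r).add_smul_sub_mem hw.2 hb (hρ01 t)
  have hlift : ∀ b : B, ∃ f : ℝ → Plane, (∀ t ≥ 0, ContinuousAt f t ∧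
      F (f t) = e.symm (y₀ + ρ t • (b.1 - y₀))) ∧ f 0 = w := fun b =>
    hF.exists_lift_curve he (y := fun t => y₀ + ρ t • (b.1 - y₀))
      (y' := fun t => (Real.sin (Real.pi * t) * Real.pi / 2) • (b.1 - y₀))
      (fun t => ((hρd t).smul_const _).const_add y₀) (by fun_prop) (fun t => hB (hyB b b.2 t))
      (by simp [hρ, hy₀, e.left_inv hw.1])
  choose f hf hf0 using hlift
  have hcontA : ∀ b : B, Continuous fun t : I => f b t := fun b =>
    continuous_iff_continuousAt.2 fun t => ContinuousAt.comp (f := fun t : I => (t : ℝ)) (hf b t t.2.1).1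
      continuous_subtype_val.continuousAt
  -- the lifts of the segments depend continuously on their endpoints
  have hg := hloc.continuous_lift (T2Space.isSeparatedMap F)
    (f := ⟨fun tb : I × B => e.symm (y₀ + ρ tb.1 • (tb.2.1 - y₀)),
      e.continuousOn_symm.comp_continuous (by fun_prop) fun tb => hB (hyB _ tb.2.2 _)⟩)
    (g := fun tb => f tb.2 tb.1) (by ext tb; exact (hf tb.2 tb.1 tb.1.2.1).2)
    (by simp only [Icc.coe_zero, hf0]; exact continuous_const) hcontA
  refine ⟨fun q => if h : e q ∈ B then f ⟨e q, h⟩ 1 else w, ?_, ?_, ?_⟩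
  · rw [continuousOn_iff_continuous_domRestrict]
    have h1 : Continuous fun q : ↥(e.source ∩ e ⁻¹' B) => f ⟨e q.1, q.2.2⟩ (1 : I) :=
      hg.comp (f := fun q : ↥(e.source ∩ e ⁻¹' B) => ((1 : I), (⟨e q.1, q.2.2⟩ : B)))
        (continuous_const.prodMk ((e.continuousOn.comp_continuous continuous_subtype_val
          fun q => q.2.1).subtype_mk _))
    refine h1.congr fun q => ?_
    have : e q.1 ∈ B := q.2.2
    simp [this]
  · intro q hq
    have : e q ∈ B := hq.2
    simp only [this, dif_pos]
    rw [(hf _ 1 zero_le_one).2]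
    simp [hρ, e.left_inv hq.1]
  · have : e (F w) ∈ B := hw.2
    simp only [this, dif_pos]
    have h1 := (T2Space.isSeparatedMap F).const_of_comp hloc.isLocallyInjective (hcontA ⟨e (F w), this⟩)
      (fun t t' => by
        rw [(hf _ t t.2.1).2, (hf _ t' t'.2.1).2]
        simp [hy₀]) 1 0
    simpa [hf0] using h1

end IsExpanding
end Surface

/-! ### Lifts of geodesics to a simply connected cover -/

namespace Surface

theorem chr_smul (G : Plane → Matrix (Fin 2) (Fin 2) ℝ) (y : Plane) (a : ℝ) (u v : Plane) :
    chr G y (a • u) (a • v) = a ^ 2 • chr G y u v := by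
  ext k
  simp only [chr, Fin.sum_univ_two, PiLp.smul_apply, smul_eq_mul]
  ring

variable {M : Type*} [MetricSpace M] [ChartedSpace Plane M]
    [RiemannianBundle (fun x : M => TangentSpace (𝓡 2) x)]

theorem IsGeodesicIn.comp_mul {e : OpenPartialHomeomorph M Plane} {γ : ℝ → M} {a t : ℝ}
    (h : IsGeodesicIn e γ (a * t)) : IsGeodesicIn e (fun s => γ (a * s)) t ∧
      phase e (fun s => γ (a * s)) =ᶠ[𝓝 t] fun s => ((phase e γ (a * s)).1, a • (phase e γ (a * s)).2) := by
  have hc : ContinuousAt (fun s : ℝ => a * s) t := (continuous_const.mul continuous_id).continuousAt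
  refine isGeodesicIn_of_phase ?_
  filter_upwards [hc.tendsto.eventually h] with s hs
  refine ⟨e.map_source hs.1, (e.left_inv hs.1).symm, ?_⟩
  have h1 : HasDerivAt (fun s : ℝ => a * s) a s := by simpa using (hasDerivAt_id s).const_mul a
  have h2 := HasDerivAt.scomp s hs.2 h1
  have h3 := (ContinuousLinearMap.fst ℝ Plane Plane).hasFDerivAt.comp_hasDerivAt s h2
  have h4 := ((ContinuousLinearMap.snd ℝ Plane Plane).hasFDerivAt.comp_hasDerivAt s h2).const_smul a
  refine (h3.prodMk h4).congr_deriv ?_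
  simp only [spray, chr_smul, Prod.smul_mk, ContinuousLinearMap.coe_fst', ContinuousLinearMap.coe_snd',
    smul_neg, smul_smul, ← sq]

theorem IsUnitSpeedGeodesic.isGeodesicIn {c : ℝ → M} (hc : IsUnitSpeedGeodesic c)
    {e : OpenPartialHomeomorph M Plane} (he : e ∈ IsManifold.maximalAtlas (𝓡 2) ∞ M) {t : ℝ}
    (ht : c t ∈ e.source) : IsGeodesicIn e c t := by
  have hev : ∀ᶠ s in 𝓝 t, c s ∈ e.source :=
    hc.smooth.continuous.continuousAt.preimage_mem_nhds (e.open_source.mem_nhds ht)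
  have hsm : ∀ s, c s ∈ e.source → ContDiffAt ℝ 2 (fun s => e (c s)) s := fun s hs =>
    (contMDiffAt_iff_contDiffAt.1 ((contMDiffAt_chart he hs).comp s hc.smooth.contMDiffAt)).of_le
      (WithTop.coe_le_coe.2 le_top)
  refine hev.eventually_nhds.mono fun s hs => ⟨hs.self_of_nhds, ?_⟩
  have d1 : ∀ r, c r ∈ e.source → HasDerivAt (fun s => e (c s)) (deriv (fun s => e (c s)) r) r :=
    fun r hr => ((hsm r hr).differentiableAt (by simp)).hasDerivAt
  have d2 : HasDerivAt (deriv fun s => e (c s)) (deriv (deriv fun s => e (c s)) s) s := by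
    have : ContDiffAt ℝ 1 (fderiv ℝ fun s => e (c s)) s := (hsm s hs.self_of_nhds).fderiv_right (by norm_num)
    have h3 := (this.differentiableAt (by simp)).clm_apply (differentiableAt_const (1 : ℝ))
    exact h3.hasDerivAt
  have d1' : ∀ k : Fin 2, ∀ r, c r ∈ e.source → deriv (fun s => e (c s) k) r = deriv (fun s => e (c s)) r k :=
    fun k r hr => (hasDerivAt_plane.1 (d1 r hr) k).deriv
  have d2' : ∀ k : Fin 2, deriv (deriv fun s => e (c s) k) s = deriv (deriv fun s => e (c s)) s k := by
    intro k
    have h4 : deriv (fun s => e (c s) k) =ᶠ[𝓝 s] fun r => deriv (fun s => e (c s)) r k := by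
      filter_upwards [hs] with r hr using d1' k r hr
    rw [h4.deriv_eq]
    exact (hasDerivAt_plane.1 d2 k).deriv
  refine ((d1 s hs.self_of_nhds).prodMk d2).congr_deriv (Prod.ext rfl ?_)
  ext k
  have := hc.geodesic_eq e he s hs.self_of_nhds k
  simp only [d1' _ s hs.self_of_nhds, d2'] at this
  simp only [spray, phase, chr, PiLp.neg_apply]
  linarith

section Family
variable {e₀ : OpenPartialHomeomorph M Plane} {p : M} {γ : Plane → ℝ → M}
variable [IsManifold (𝓡 2) ∞ M]
    [IsContMDiffRiemannianBundle (𝓡 2) ∞ Plane (fun x : M => TangentSpace (𝓡 2) x)]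

/-- In negative curvature the exponential map is an expanding local diffeomorphism. -/
theorem IsGeodesicFamily.exists_isExpanding (hγ : IsGeodesicFamily e₀ p γ) (hM : NegativelyCurved M) :
    ∃ m, IsExpanding (fun w => γ w 1) m := by
  have hG := isMetricOn_metricMatrix hγ.chart
  have hp : e₀ p ∈ e₀.target := e₀.map_source hγ.mem_source
  have hdet := hG.det_pos hp
  have htr : 0 < metricMatrix e₀ (e₀ p) 0 0 + metricMatrix e₀ (e₀ p) 1 1 :=
    add_pos (hG.diag_pos hp 0) (hG.diag_pos hp 1)
  refine ⟨(metricMatrix e₀ (e₀ p)).det / (metricMatrix e₀ (e₀ p) 0 0 + metricMatrix e₀ (e₀ p) 1 1),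
    div_pos hdet htr, fun w => ?_⟩
  obtain ⟨e, he, D, hD⟩ := hγ.exists_hasPhaseDerivIn_chart w zero_le_one
  have hm : ∀ u, (metricMatrix e₀ (e₀ p)).det / (metricMatrix e₀ (e₀ p) 0 0 + metricMatrix e₀ (e₀ p) 1 1) *
      ‖u‖ ^ 2 ≤ form (metricMatrix e) (e (γ w 1)) (D u).1 (D u).1 := by
    intro u
    refine le_trans ?_ ((hγ.form_le_norm_mfderiv hM w u).trans_eq (hD.form_eq he u).symm)
    rw [div_mul_eq_mul_div, div_le_iff₀ htr, mul_comm (form _ _ _ _)]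
    exact hG.norm_sq_le hp u
  set D₁ : Plane →L[ℝ] Plane := ContinuousLinearMap.fst ℝ Plane Plane ∘L D with hD₁
  have hinj : Function.Injective D₁ := by
    refine (injective_iff_map_eq_zero D₁).2 fun u hu => ?_
    have h1 := hm u
    have h2 : (D u).1 = 0 := hu
    rw [h2] at h1
    have h3 : form (metricMatrix e) (e (γ w 1)) 0 0 = 0 := by simp [form]
    rw [h3] at h1
    have h4 : ‖u‖ ^ 2 ≤ 0 := by
      by_contra hcon
      exact absurd h1 (not_le.2 (mul_pos (div_pos hdet htr) (not_le.1 hcon)))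
    have h5 : ‖u‖ = 0 := by nlinarith [norm_nonneg u, sq_nonneg ‖u‖]
    exact norm_eq_zero.1 h5
  refine ⟨e, he, hD.1, hD.2.1,
    (LinearEquiv.ofInjectiveEndo (D₁ : Plane →ₗ[ℝ] Plane) hinj).toContinuousLinearEquiv, ?_, hm⟩
  have h6 : (((LinearEquiv.ofInjectiveEndo (D₁ : Plane →ₗ[ℝ] Plane) hinj).toContinuousLinearEquiv :
      Plane ≃L[ℝ] Plane) : Plane →L[ℝ] Plane) = D₁ := by
    ext1 u
    rfl
  rw [h6]
  exact (ContinuousLinearMap.fst ℝ Plane Plane).hasStrictFDerivAt.comp w hD.2.2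

/-- The exponential map sends rays from the origin to geodesics. -/
theorem IsGeodesicFamily.apply_smul (hγ : IsGeodesicFamily e₀ p γ) {c : ℝ → M}
    (hc : IsUnitSpeedGeodesic c) (hcp : c 0 = p) (t : ℝ) :
    γ (t • (phase e₀ c 0).2) 1 = c t := by
  obtain ⟨a, ha, hg⟩ := hγ.geodesic (t • (phase e₀ c 0).2)
  have hsrc : c 0 ∈ e₀.source := by rw [hcp]; exact hγ.mem_source
  have h0 : c (t * 0) ∈ e₀.source := by rw [mul_zero]; exact hsrc
  obtain ⟨k1, k2⟩ := (hc.isGeodesicIn hγ.chart h0).comp_mul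
  have := geodesic_unique hγ.chart (γ := γ (t • (phase e₀ c 0).2)) (γ' := fun s => c (t * s))
    (a := a) (b := 2) (t0 := 0) (fun s hs => hg s hs.1)
    (fun s _ => ⟨_, IsManifold.chart_mem_maximalAtlas (c (t * s)),
      ((hc.isGeodesicIn (IsManifold.chart_mem_maximalAtlas _) (mem_chart_source Plane _)).comp_mul).1⟩)
    ⟨ha, by norm_num⟩ (by rw [hγ.zero]; exact hγ.mem_source) h0
    (by
      rw [hγ.phase_zero, k2.self_of_nhds]
      simp only [mul_zero]
      rw [← hcp]
      rfl) 1 ⟨by linarith, by norm_num⟩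
  simpa using this.self_of_nhds

open unitInterval in
/-- The lift of a geodesic to a simply connected cover of a complete negatively curved surface is
not a closed curve: through the exponential map, it would lift to a closed curve in the plane,
but the lift is a straight line. -/
theorem IsUnitSpeedGeodesic.lift_not_closed [IsRiemannianManifold (𝓡 2) M] [CompleteSpace M]
    (hM : NegativelyCurved M) {N : Type*} [TopologicalSpace N] [SimplyConnectedSpace N] {P : C(N, M)}
    {c : ℝ → M} (hc : IsUnitSpeedGeodesic c) {L : ℝ} (hL : 0 < L) {x : N} (l : Path x x)
    (hc' : ∀ s : I, P (l s) = c (L * s)) : False := by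
  set e := chartAt Plane (c 0)
  have he : e ∈ IsManifold.maximalAtlas (𝓡 2) ∞ M := IsManifold.chart_mem_maximalAtlas _
  have hp : c 0 ∈ e.source := mem_chart_source Plane _
  obtain ⟨γ, hγ⟩ := exists_isGeodesicFamily he hp
  obtain ⟨m, hF⟩ := hγ.exists_isExpanding hM
  set F : Plane → M := fun w => γ w 1 with hFdef
  set w₀ := (phase e c 0).2 with hw₀
  have hFc : ∀ t, F (t • w₀) = c t := fun t => hγ.apply_smul hc rfl t
  -- a homotopy in the cover from the constant path to the closed lift, projected to `M`
  obtain ⟨H⟩ := ContinuousMap.HomotopicRel.comp_continuousMap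
    (SimplyConnectedSpace.paths_homotopic (Path.refl x) l) P
  have hH0 : ∀ t, H (t, 0) = c 0 := fun t => by
    rw [H.eq_fst t (by simp)]
    have := hc' 0
    simpa using this
  have hlift := fun t : I => exists_path_lift_of_sections hF.exists_section
    (⟨fun s => H (t, s), by fun_prop⟩ : C(I, M)) 0 (by
      have := hFc 0
      rw [zero_smul] at this
      rw [this]
      exact (hH0 t).symm)
  choose Γ hΓ0 hΓ using hlift
  have hsep : IsSeparatedMap F := T2Space.isSeparatedMap F
  have hmono := fun t => hF.isLocalHomeomorph.monodromy_theorem hsep H Γ hΓ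
    (fun t => by rw [hΓ0, hΓ0]) t
  have hx : P x = c 0 := by simpa using hc' 0
  have h0 : Γ 0 1 = 0 := by
    have := hsep.const_of_comp hF.isLocalHomeomorph.isLocallyInjective (Γ 0).continuous (fun s s' => by
      rw [hΓ, hΓ]
      simp) 1 0
    rw [this, hΓ0]
  -- uniqueness of lifts: over the geodesic, the lift is the straight line
  have h1 : Γ 1 1 = L • w₀ := by
    have := congr_fun (hsep.eq_of_comp_eq hF.isLocalHomeomorph.isLocallyInjective (Γ 1).continuous
      (g₂ := fun s : I => (L * (s : ℝ)) • w₀) (by fun_prop) (by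
        ext s
        simp only [Function.comp, hFc, ← hc']
        rw [hΓ]
        simp) 0 (by simp [hΓ0])) 1
    simpa using this
  have hw : w₀ = 0 := by
    have := (h1.symm.trans (hmono 1)).trans h0
    exact (smul_eq_zero.1 this).resolve_left hL.ne'
  -- the initial velocity `w₀` vanishes, in contradiction to unit speed
  have hs := (hc.isGeodesicIn he hp).form_phase he
  rw [hc.unit_speed, ← hw₀, hw] at hs
  simp [form] at hs

end Family
end Surface

/-! ### Deck transformations and the injectivity radius -/

namespace Surface

theorem _root_.IsPreconnected.exists_mem_frontier {X : Type*} [TopologicalSpace X] {s t : Set X}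
    (hs : IsPreconnected s) {x y : X} (hx : x ∈ s) (hxt : x ∈ t) (hy : y ∈ s) (hyt : y ∉ t) :
    ∃ z ∈ s, z ∈ frontier t := by
  by_contra! hcon
  have hsub : s ⊆ interior t ∪ (closure t)ᶜ := fun z hz => by
    by_contra h
    rw [mem_union, not_or, notMem_compl_iff] at h
    exact hcon z hz ⟨h.2, h.1⟩
  obtain ⟨z, -, hz, hz'⟩ := hs _ _ isOpen_interior isClosed_closure.isOpen_compl hsub
    ⟨x, hx, (hsub hx).resolve_right fun h => h (subset_closure hxt)⟩
    ⟨y, hy, (hsub hy).resolve_left fun h => hyt (interior_subset h)⟩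
  exact hz' (subset_closure (interior_subset hz))

section Shift
variable {M : Type*} [MetricSpace M] [ChartedSpace Plane M]
    [RiemannianBundle (fun x : M => TangentSpace (𝓡 2) x)]

theorem IsUnitSpeedGeodesic.comp_const_add {c : ℝ → M} (hc : IsUnitSpeedGeodesic c) (a : ℝ) :
    IsUnitSpeedGeodesic fun t => c (a + t) := by
  have hadd : ContMDiff 𝓘(ℝ, ℝ) 𝓘(ℝ, ℝ) ∞ fun t : ℝ => a + t :=
    (contDiff_const.add contDiff_id).contMDiff
  refine ⟨hc.smooth.comp hadd, fun t => ?_, fun e he t ht k => ?_⟩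
  · have h1 : mfderiv 𝓘(ℝ, ℝ) (𝓡 2) (c ∘ fun t : ℝ => a + t) t (1 : ℝ) =
        mfderiv 𝓘(ℝ, ℝ) (𝓡 2) c (a + t) (mfderiv 𝓘(ℝ, ℝ) 𝓘(ℝ, ℝ) (fun t : ℝ => a + t) t (1 : ℝ)) :=
      mfderiv_comp_apply t (hc.smooth.contMDiffAt.mdifferentiableAt (by simp))
        (hadd.contMDiffAt.mdifferentiableAt (by simp)) _
    have h2 : mfderiv 𝓘(ℝ, ℝ) 𝓘(ℝ, ℝ) (fun t : ℝ => a + t) t (1 : ℝ) = (1 : ℝ) := by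
      rw [mfderiv_eq_fderiv]
      have : HasFDerivAt (fun t : ℝ => a + t) (ContinuousLinearMap.id ℝ ℝ) t :=
        (hasFDerivAt_id t).const_add a
      exact congrArg (fun D : ℝ →L[ℝ] ℝ => D 1) this.fderiv
    rw [h2] at h1
    have h3 := congrArg norm h1
    exact h3.trans (hc.unit_speed (a + t))
  · have := hc.geodesic_eq e he (a + t) ht k
    have hd : ∀ i : Fin 2, deriv (fun s => e (c (a + s)) i) = fun s => deriv (fun r => e (c r) i) (a + s) :=
      fun i => funext fun s => deriv_comp_const_add (fun r => e (c r) i) a s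
    have hdd : deriv (deriv fun s => e (c (a + s)) k) t = deriv (deriv fun r => e (c r) k) (a + t) := by
      rw [hd]
      exact deriv_comp_const_add (deriv fun r => e (c r) k) a t
    rw [hdd]
    simp only [hd]
    exact this

end Shift

section Cover
variable {M : Type*} [MetricSpace M] [ChartedSpace Plane M]
    [RiemannianBundle (fun x : M => TangentSpace (𝓡 2) x)]
    {N : Type*} [MetricSpace N] [ChartedSpace Plane N]
    [RiemannianBundle (fun x : N => TangentSpace (𝓡 2) x)]
    {proj : N → M}

namespace IsRiemannianUniversalCover

theorem enorm_mfderiv_lift (hp : IsRiemannianUniversalCover proj) {l : ℝ → N} {t : ℝ}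
    (hl : ContMDiffAt 𝓘(ℝ, ℝ) (𝓡 2) 1 l t) :
    ‖mfderiv 𝓘(ℝ, ℝ) (𝓡 2) l t (1 : ℝ)‖ₑ = ‖mfderiv 𝓘(ℝ, ℝ) (𝓡 2) (proj ∘ l) t (1 : ℝ)‖ₑ := by
  have h1 : mfderiv 𝓘(ℝ, ℝ) (𝓡 2) (proj ∘ l) t (1 : ℝ) =
      mfderiv (𝓡 2) (𝓡 2) proj (l t) (mfderiv 𝓘(ℝ, ℝ) (𝓡 2) l t (1 : ℝ)) :=
    mfderiv_comp_apply t (hp.smooth.contMDiffAt.mdifferentiableAt (by simp))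
      (hl.mdifferentiableAt (by simp)) _
  rw [← ofReal_norm, ← ofReal_norm]
  have h3 := congrArg norm h1
  exact congrArg ENNReal.ofReal (h3.trans (hp.norm_mfderiv _ _)).symm

variable [IsManifold (𝓡 2) ∞ M] [IsManifold (𝓡 2) ∞ N]

/-- The lift of a `C¹` curve is `C¹`, by the inverse function theorem. -/
theorem contMDiffAt_lift (hp : IsRiemannianUniversalCover proj) {l : ℝ → N} {t : ℝ}
    (hl : ContinuousAt l t) (hpl : ContMDiffAt 𝓘(ℝ, ℝ) (𝓡 2) 1 (proj ∘ l) t) :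
    ContMDiffAt 𝓘(ℝ, ℝ) (𝓡 2) 1 l t := by
  set e := chartAt Plane (l t)
  have he : e ∈ IsManifold.maximalAtlas (𝓡 2) ∞ N := IsManifold.chart_mem_maximalAtlas _
  have hs : l t ∈ e.source := mem_chart_source Plane _
  set e' := chartAt Plane (proj (l t))
  have he' : e' ∈ IsManifold.maximalAtlas (𝓡 2) ∞ M := IsManifold.chart_mem_maximalAtlas _
  have hs' : proj (l t) ∈ e'.source := mem_chart_source Plane _
  have hy : e (l t) ∈ e.target := e.map_source hs
  have hinv : e.symm (e (l t)) = l t := e.left_inv hs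
  have hs'' : proj (e.symm (e (l t))) ∈ e'.source := by rw [hinv]; exact hs'
  set g : Plane → Plane := fun y => e' (proj (e.symm y)) with hg
  have hpe : ContMDiffAt (𝓡 2) (𝓡 2) ∞ (proj ∘ e.symm) (e (l t)) :=
    hp.smooth.contMDiffAt.comp _ (contMDiffAt_chart_symm he hy)
  have hgs : ContDiffAt ℝ ∞ g (e (l t)) :=
    contMDiffAt_iff_contDiffAt.1 (ContMDiffAt.comp (f := proj ∘ e.symm) _ (contMDiffAt_chart he' hs'') hpe)
  have hgd := (hgs.differentiableAt (by simp)).hasFDerivAt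
  have hsrc : ∀ᶠ y in 𝓝 (e (l t)), proj (e.symm y) ∈ e'.source :=
    hpe.continuousAt.preimage_mem_nhds (e'.open_source.mem_nhds hs'')
  -- the coordinate expression of the projection is an isometry, hence has invertible derivative
  have hiso : ∀ u, form (metricMatrix e') (g (e (l t))) (fderiv ℝ g (e (l t)) u)
      (fderiv ℝ g (e (l t)) u) = form (metricMatrix e) (e (l t)) u u := by
    intro u
    rw [form_metricMatrix_self he' (f := proj ∘ e.symm) hgd (e'.map_source hs'')
      (by filter_upwards [hsrc] with y hy using (e'.left_inv hy).symm) u]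
    have h1 := form_metricMatrix_self he (f := e.symm) (hasFDerivAt_id (𝕜 := ℝ) (e (l t))) hy
      (Eventually.of_forall fun _ => rfl) u
    refine Eq.trans ?_ h1.symm
    have h2 : mfderiv (𝓡 2) (𝓡 2) (proj ∘ e.symm) (e (l t)) u =
        mfderiv (𝓡 2) (𝓡 2) proj (e.symm (e (l t))) (mfderiv (𝓡 2) (𝓡 2) e.symm (e (l t)) u) :=
      mfderiv_comp_apply _ (hp.smooth.contMDiffAt.mdifferentiableAt (by simp))
        ((contMDiffAt_chart_symm he hy).mdifferentiableAt (by simp)) _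
    have h3 := (congrArg norm h2).trans (hp.norm_mfderiv _ _)
    exact congrArg (· ^ 2) h3
  have hinj : Function.Injective (fderiv ℝ g (e (l t))) := by
    refine (injective_iff_map_eq_zero _).2 fun u hu => ?_
    by_contra hne
    have h1 := hiso u
    rw [hu] at h1
    have h2 := form_metricMatrix_pos he hy hne
    rw [← h1] at h2
    simp [form] at h2
  set D : Plane ≃L[ℝ] Plane := (LinearEquiv.ofInjectiveEndo
    (fderiv ℝ g (e (l t)) : Plane →ₗ[ℝ] Plane) hinj).toContinuousLinearEquiv with hD
  have hDg : (D : Plane →L[ℝ] Plane) = fderiv ℝ g (e (l t)) := by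
    ext1 u
    rfl
  have hgd' : HasFDerivAt g (D : Plane →L[ℝ] Plane) (e (l t)) := by rw [hDg]; exact hgd
  have hgs1 : ContDiffAt ℝ 1 g (e (l t)) := hgs.of_le (by exact_mod_cast le_top)
  have hloc := hgs1.to_localInverse hgd' one_ne_zero
  have hleft := (hgs1.hasStrictFDerivAt' hgd' one_ne_zero).eventually_left_inverse
  have hcomp : ContDiffAt ℝ 1 (fun s => e' (proj (l s))) t :=
    contMDiffAt_iff_contDiffAt.1 (ContMDiffAt.comp (f := proj ∘ l) t
      ((contMDiffAt_chart he' hs').of_le (by exact_mod_cast le_top)) hpl)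
  have hval : e' (proj (l t)) = g (e (l t)) := by simp only [hg, hinv]
  rw [← hval] at hloc
  have hel : ContDiffAt ℝ 1 (fun s => e (l s)) t := by
    refine (ContDiffAt.comp (f := fun s => e' (proj (l s))) t hloc hcomp).congr_of_eventuallyEq ?_
    filter_upwards [((e.continuousAt hs).comp hl).tendsto.eventually hleft,
      hl.preimage_mem_nhds (e.open_source.mem_nhds hs)] with s h1 h2
    refine h1.symm.trans ?_
    simp only [Function.comp, hg, e.left_inv h2]
    rfl
  refine ContMDiffAt.congr_of_eventuallyEq (ContMDiffAt.comp (f := fun s => e (l s)) t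
    ((contMDiffAt_chart_symm he hy).of_le (by exact_mod_cast le_top)) hel.contMDiffAt) ?_
  filter_upwards [hl.preimage_mem_nhds (e.open_source.mem_nhds hs)] with s hs
  exact (e.left_inv hs).symm

variable [IsRiemannianManifold (𝓡 2) N]

/-- A lift of the projection to a self-map of the cover does not increase distances, because it preserves
the length of curves. -/
theorem edist_le_of_proj_eq (hp : IsRiemannianUniversalCover proj) (φ : C(N, N))
    (hφ : ∀ x, proj (φ x) = proj x) (x y : N) : edist (φ x) (φ y) ≤ edist x y := by
  refine le_of_forall_gt fun r hr => ?_
  rw [IsRiemannianManifold.out (I := 𝓡 2) x y] at hr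
  obtain ⟨η, h0, h1, hη, hlen, -⟩ :=
    Manifold.exists_lt_locally_constant_of_riemannianEDist_lt hr zero_lt_one
  have hpη : proj ∘ (φ ∘ η) = proj ∘ η := by
    ext t
    exact hφ _
  have hη' : ContMDiff 𝓘(ℝ, ℝ) (𝓡 2) 1 (φ ∘ η) := fun t =>
    hp.contMDiffAt_lift (φ.continuous.comp hη.continuous).continuousAt (by
      rw [hpη]
      exact (hp.smooth.of_le (by exact_mod_cast le_top)).contMDiffAt.comp t hη.contMDiffAt)
  refine lt_of_le_of_lt ?_ hlen
  rw [IsRiemannianManifold.out (I := 𝓡 2) (φ x) (φ y)]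
  refine (Manifold.riemannianEDist_le_pathELength (I := 𝓡 2) hη'.contMDiffOn
    (congrArg φ h0) (congrArg φ h1) zero_le_one).trans_eq ?_
  rw [Manifold.pathELength_eq_lintegral_mfderiv_Icc, Manifold.pathELength_eq_lintegral_mfderiv_Icc]
  refine MeasureTheory.lintegral_congr fun t => ?_
  have h2 : ‖mfderiv 𝓘(ℝ, ℝ) (𝓡 2) (proj ∘ (φ ∘ η)) t (1 : ℝ)‖ₑ =
      ‖mfderiv 𝓘(ℝ, ℝ) (𝓡 2) (proj ∘ η) t (1 : ℝ)‖ₑ := by rw [hpη]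
  exact (hp.enorm_mfderiv_lift (hη' t)).trans (h2.trans (hp.enorm_mfderiv_lift (hη t)).symm)

/-- The deck group acts transitively on the fibres. -/
theorem exists_mem_deckGroup (hp : IsRiemannianUniversalCover proj) {q q' : N}
    (hq : proj q = proj q') : ∃ γ ∈ deckGroup proj, γ q = q' := by
  have := hp.simplyConnected
  have : LocallyPathConnectedSpace N := ChartedSpace.locallyPathConnectedSpace Plane N
  obtain ⟨φ, ⟨hφq, hφ⟩, -⟩ := hp.isCoveringMap.existsUnique_continuousMap_lifts
    ⟨proj, hp.smooth.continuous⟩ q q' hq.symm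
  obtain ⟨ψ, ⟨hψq, hψ⟩, -⟩ := hp.isCoveringMap.existsUnique_continuousMap_lifts
    ⟨proj, hp.smooth.continuous⟩ q' q hq
  have hφ' : ∀ x, proj (φ x) = proj x := fun x => congr_fun hφ x
  have hψ' : ∀ x, proj (ψ x) = proj x := fun x => congr_fun hψ x
  -- both sides lift the projection and agree at `q`
  have h1 : ψ ∘ φ = id := hp.isCoveringMap.eq_of_comp_eq (ψ.continuous.comp φ.continuous) continuous_id
    (by ext x; exact (hψ' _).trans (hφ' _)) q (by simp [hφq, hψq])
  have h2 : φ ∘ ψ = id := hp.isCoveringMap.eq_of_comp_eq (φ.continuous.comp ψ.continuous) continuous_id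
    (by ext x; exact (hφ' _).trans (hψ' _)) q' (by simp [hφq, hψq])
  refine ⟨⟨⟨φ, ψ, congr_fun h1, congr_fun h2⟩, fun x y => ?_⟩, hφ', hφq⟩
  refine le_antisymm (hp.edist_le_of_proj_eq φ hφ' x y) ?_
  have := hp.edist_le_of_proj_eq ψ hψ' (φ x) (φ y)
  rwa [show ψ (φ x) = x from congr_fun h1 x, show ψ (φ y) = y from congr_fun h1 y] at this

variable [IsContMDiffRiemannianBundle (𝓡 2) ∞ Plane (fun x : M => TangentSpace (𝓡 2) x)]
    [IsRiemannianManifold (𝓡 2) M] [CompleteSpace M]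

/-- A closed geodesic of length `L` through `c 0` lifts to a geodesic whose endpoints differ by a
nontrivial deck transformation. -/
theorem injRadius_le (hp : IsRiemannianUniversalCover proj) (hM : NegativelyCurved M) {c : ℝ → M}
    (hc : IsUnitSpeedGeodesic c) {L : ℝ} (hL : 0 < L) (hper : c L = c 0) :
    injRadius proj (c 0) ≤ ENNReal.ofReal L := by
  have := hp.simplyConnected
  obtain ⟨q, hq⟩ := hp.surjective (c 0)
  obtain ⟨l, ⟨hlq, hl⟩, -⟩ := hp.isCoveringMap.existsUnique_continuousMap_lifts
    (A := ℝ) ⟨c, hc.smooth.continuous⟩ 0 q hq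
  have hl' : proj ∘ l = c := hl
  have hpl : ∀ t, proj (l t) = c t := congr_fun hl'
  obtain ⟨γ, hγ, hγq⟩ := hp.exists_mem_deckGroup (q := q) (q' := l L) (by rw [hpl, hper, hq])
  have hne : γ ≠ 1 := by
    rintro rfl
    have hLq : l L = q := hγq.symm
    exact hc.lift_not_closed hM (P := ⟨proj, hp.smooth.continuous⟩) hL (x := q)
      { toFun := fun s => l (L * s)
        continuous_toFun := by fun_prop
        source' := by simp [hlq]
        target' := by simp [hLq] } fun s => hpl _
  have hsm : ∀ t, ContMDiffAt 𝓘(ℝ, ℝ) (𝓡 2) 1 l t := fun t => hp.contMDiffAt_lift l.continuous.continuousAt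
    (by rw [hl']; exact (hc.smooth.of_le (by exact_mod_cast le_top)).contMDiffAt)
  have hdist := edist_le_of_speed_le (γ := l) (σ := 1) hL.le (fun t _ => hsm t) fun t _ => by
    rw [hp.enorm_mfderiv_lift (hsm t), hl', ← ofReal_norm, hc.unit_speed, ENNReal.ofReal_one]
  rw [one_mul, sub_zero, hlq, ← hγq] at hdist
  exact (iInf₂_le_of_le q hq (iInf₂_le γ ⟨hγ, hne⟩)).trans hdist

/-- The ray meets boundary components of the exhaustion at arbitrarily large times, and these are closed
geodesics of length at most `A`. -/
theorem rayInjRadius_le (hp : IsRiemannianUniversalCover proj) {A : ℝ} (hM : IsTight proj A)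
    {v : ℝ → M} (hv : IsUnitSpeedGeodesic v) (hmin : IsAlmostMinimizing v) :
    rayInjRadius proj v ≤ ENNReal.ofReal A := by
  refine Filter.liminf_le_of_frequently_le' (Filter.frequently_atTop.2 fun T => ?_)
  obtain ⟨S, hS, -, hcomp, hfr⟩ := hM.exhaustion
  set T' := max T 0
  obtain ⟨n, hn⟩ := mem_iUnion.1 (hS ▸ mem_univ (v T') : v T' ∈ ⋃ n, S n)
  -- an almost minimizing ray leaves every compact set
  obtain ⟨t₂, ht₂, hout⟩ : ∃ t₂ ≥ T', v t₂ ∉ S n := by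
    obtain ⟨C, -, hC⟩ := hmin
    obtain ⟨R, hR⟩ := (hcomp n).isCompact.isBounded.subset_closedBall (v 0)
    have hT0 : 0 ≤ T' := le_max_right _ _
    refine ⟨T' + |R| + |C| + 1, by linarith [abs_nonneg R, abs_nonneg C], fun hmem => ?_⟩
    have h1 := hC (T' + |R| + |C| + 1) (by linarith [abs_nonneg R, abs_nonneg C])
    have h2 := Metric.mem_closedBall.1 (hR hmem)
    linarith [le_abs_self R, le_abs_self C]
  obtain ⟨-, ⟨t, ht, rfl⟩, htf⟩ := (isPreconnected_Icc.image v
    hv.smooth.continuous.continuousOn).exists_mem_frontier (mem_image_of_mem v ⟨le_rfl, ht₂⟩) hn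
    (mem_image_of_mem v ⟨ht₂, le_rfl⟩) hout
  refine ⟨t, (le_max_left _ _).trans ht.1, ?_⟩
  obtain ⟨L, hLA, hL, c, hc, hper, -, hrange⟩ := hfr n (v t) htf
  obtain ⟨s, hs⟩ : v t ∈ range c := hrange ▸ mem_connectedComponentIn htf
  have := hp.injRadius_le hM.negativelyCurved (hc.comp_const_add s) hL
    (by rw [add_zero]; exact hper s)
  rw [add_zero, hs] at this
  exact this.trans (ENNReal.ofReal_le_ofReal hLA)

end IsRiemannianUniversalCover
end Cover
end Surface

theorem mainTheorem7
    {M : Type*} [MetricSpace M] [ChartedSpace Plane M] [IsManifold (𝓡 2) ∞ M]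
    [RiemannianBundle (fun x : M => TangentSpace (𝓡 2) x)]
    [IsContMDiffRiemannianBundle (𝓡 2) ∞ Plane (fun x : M => TangentSpace (𝓡 2) x)]
    [IsRiemannianManifold (𝓡 2) M] [ConnectedSpace M] [CompleteSpace M]
    {N : Type*} [MetricSpace N] [ChartedSpace Plane N] [IsManifold (𝓡 2) ∞ N]
    [RiemannianBundle (fun x : N => TangentSpace (𝓡 2) x)]
    [IsContMDiffRiemannianBundle (𝓡 2) ∞ Plane (fun x : N => TangentSpace (𝓡 2) x)]
    [IsRiemannianManifold (𝓡 2) N]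
    (proj : N → M) (hproj : Surface.IsRiemannianUniversalCover proj)
    (A : ℝ) (hM : Surface.IsTight proj A)
    (v : ℝ → M) (hv : Surface.IsUnitSpeedGeodesic v) (hmin : Surface.IsAlmostMinimizing v) :
    Surface.rayInjRadius proj v < ⊤ ∧ Surface.rayInjRadius proj v ≤ ENNReal.ofReal A := by
  have h := hproj.rayInjRadius_le hM hv hmin
  exact ⟨h.trans_lt ENNReal.ofReal_lt_top, h⟩
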